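/- Let $(P_t)_{t\in T}$ be a measurable family of probability measures (a Markov kernel) from a parameter space $T$ to a space $\mathcal X$, and let $\mathcal P$ be a collection of probability measures on $\mathcal X$. Let $n\ge 1$, let $\theta=(\theta_1,\dots,\theta_n)\in T^n$ be a deterministic or random vector with $P_{\theta_1},\dots,P_{\theta_n}\in\mathcal P$ (almost surely), let $\pi$ be a uniformly random permutation of $\{1,\dots,n\}$ independent of $\theta$, and put $\vartheta_i=\theta_{\pi(i)}$. Conditionally on $(\theta,\vartheta)$, let $X=(X_1,\dots,X_n)$ have independent coordinates $X_i\sim P_{\vartheta_i}$. For probability measures $P,Q$ write $\mathrm{KL}(P\|Q)=\int \log\frac{dP}{dQ}\,dP$, $\chi^2(P\|Q)=\int\frac{(dP-dQ)^2}{dQ}$ (both $+\infty$ if $P\not\ll Q$) and $H^2(P,Q)=\int(\sqrt{dP}-\sqrt{dQ})^2$. For random variables $U,V$ let $I(U;V)=\mathrm{KL}(P_{UV}\|P_U\otimes P_V)$ and $I_{\chi^2}(U;V)=\chi^2(P_{UV}\|P_U\otimes P_V)$. Define, with values in $[0,\infty]$, $$\mathsf C_{\chi^2}(\mathcal P)=\sup_{\rho}\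 \mathbb E_{P\sim\rho}\big[\chi^2(P\,\|\,\mathbb E_{P'\sim\rho}[P'])\big],\qquad \mathsf\Delta_{H^2}(\mathcal P)=\Big(1-\tfrac12\sup_{P_1,P_2\in\mathcal P}H^2(P_1,P_2)\Big)^{-2},$$ where $\rho$ ranges over all probability measures on $\mathcal P$; let $\mathrm{conv}(\mathcal P)$ be the convex hull of $\mathcal P$, and for a family $\mathcal Q$ of probability measures and $\varepsilon>0$ let $$N_{\mathrm{KL}}(\mathcal Q,\varepsilon)=\min\Big\{m:\ \inf_{\mathcal Q_0\subseteq\mathcal Q,\ |\mathcal Q_0|=m}\ \sup_{Q\in\mathcal Q}\ \min_{Q_0\in\mathcal Q_0}\mathrm{KL}(Q\|Q_0)\le\varepsilon^2\Big\}$$ ($+\infty$ if there is no such $m$). Logarithms are natural, $0\cdot\infty=0$, and right-hand sides may be $+\infty$. 1. If $\theta$ is deterministic, then $I(\vartheta_1;X_1)$, $I(\vartheta;X)$ and $I_{\chi^2}(\vartheta_1;X_1)$ are finite and $$0\le n\,I(\vartheta_1;X_1)-I(\vartheta;X)\le\min\Big\{10\sum_{\ell=2}^n I_{\chi^2}(\vartheta_1;X_1)^\ell,\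 \ I_{\chi^2}(\vartheta_1;X_1)\big(1+\log\mathsf\Delta_{H^2}(\mathcal P)\big)\Big\}.$$ 2. For possibly random $\theta$, $$I(\theta;X)\le\inf_{\varepsilon>0}\Big(n\varepsilon^2+\log N_{\mathrm{KL}}(\mathrm{conv}(\mathcal P),\varepsilon)\Big)+\mathsf C_{\chi^2}(\mathcal P)\big(1+\log\mathsf\Delta_{H^2}(\mathcal P)\big).$$ -/

import Mathlib

open MeasureTheory ProbabilityTheory InformationTheory
open scoped ENNReal NNReal

noncomputable section

namespace PermMix

/-! ### Divergences and distances between probability measures -/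

section Divergences

variable {α : Type*} [MeasurableSpace α]

open scoped Classical in
/-- The `χ²` divergence `∫ (dP - dQ)² / dQ = ∫ (dP/dQ - 1)² dQ`, equal to `∞` unless `P ≪ Q`. -/
def chiSqDiv (P Q : Measure α) : ℝ≥0∞ :=
  if P ≪ Q then ∫⁻ x, ENNReal.ofReal (((P.rnDeriv Q x).toReal - 1) ^ 2) ∂Q else ∞

/-- The squared Hellinger distance `∫ (√dP - √dQ)²`, with the densities taken with respect to
the dominating measure `P + Q`. -/
def hellingerSq (P Q : Measure α) : ℝ≥0∞ :=
  ∫⁻ x, ENNReal.ofReal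
    ((Real.sqrt (P.rnDeriv (P + Q) x).toReal - Real.sqrt (Q.rnDeriv (P + Q) x).toReal) ^ 2)
    ∂(P + Q)

end Divergences

/-! ### Quantities attached to a family of probability measures -/

section Families

variable {α : Type*} [MeasurableSpace α]

/-- The mean `E_{P ∼ ρ}[P]` of a measure `ρ` on a family `𝓜` of measures; the family carries the
`σ`-algebra generated by the evaluations `P ↦ P A`. -/
def priorMean {𝓜 : Set (Measure α)} (ρ : Measure 𝓜) : Measure α :=
  Measure.join (ρ.map Subtype.val)

/-- The `χ²` channel capacity `sup_ρ E_{P ∼ ρ}[χ²(P ‖ E_{P' ∼ ρ}[P'])]`, over all probability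
measures `ρ` on `𝓜`. -/
def chiSqCapacity (𝓜 : Set (Measure α)) : ℝ≥0∞ :=
  ⨆ (ρ : Measure 𝓜) (_ : IsProbabilityMeasure ρ), ∫⁻ P, chiSqDiv P.1 (priorMean ρ) ∂ρ

/-- The `H²` diameter. -/
def hellingerDiam (𝓜 : Set (Measure α)) : ℝ≥0∞ :=
  ⨆ (P ∈ 𝓜) (Q ∈ 𝓜), hellingerSq P Q

/-- The maximum `H²` singularity `(1 - D / 2)⁻²`, where `D ≤ 2` is the `H²` diameter;
it equals `∞` when `D = 2`. -/
def hellingerSingularity (𝓜 : Set (Measure α)) : ℝ≥0∞ :=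
  ((1 - hellingerDiam 𝓜 / 2) ^ 2)⁻¹

/-- The convex hull of a family of measures, i.e. the set of its finite mixtures. -/
def mixtures (𝓜 : Set (Measure α)) : Set (Measure α) := convexHull ℝ≥0 𝓜

/-- The `ε`-covering number of a family under the Kullback-Leibler divergence: the least `m` with
`inf_{𝓜₀ ⊆ 𝓜, |𝓜₀| = m} sup_{P ∈ 𝓜} min_{P₀ ∈ 𝓜₀} KL(P ‖ P₀) ≤ ε²`, and `∞` if there is none. -/
def klCoveringNumber (𝓜 : Set (Measure α)) (ε : ℝ) : ℕ∞ :=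
  ⨅ (m : ℕ) (_ : (⨅ (𝓜₀ : Finset (Measure α)) (_ : (𝓜₀ : Set (Measure α)) ⊆ 𝓜)
      (_ : 𝓜₀.card = m), ⨆ P ∈ 𝓜, ⨅ P₀ ∈ 𝓜₀, klDiv P P₀) ≤ ENNReal.ofReal (ε ^ 2)), (m : ℕ∞)

end Families

/-! ### Mutual information of random variables -/

section MutualInformation

variable {Ω α β : Type*} [MeasurableSpace Ω] [MeasurableSpace α] [MeasurableSpace β]

/-- The mutual information `I(U; V) = KL(P_{U,V} ‖ P_U ⊗ P_V)`. -/
def mutualInfo (μ : Measure Ω) (U : Ω → α) (V : Ω → β) : ℝ≥0∞ :=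
  klDiv (μ.map fun ω ↦ (U ω, V ω)) ((μ.map U).prod (μ.map V))

/-- The `χ²` mutual information `I_{χ²}(U; V) = χ²(P_{U,V} ‖ P_U ⊗ P_V)`. -/
def chiSqInfo (μ : Measure Ω) (U : Ω → α) (V : Ω → β) : ℝ≥0∞ :=
  chiSqDiv (μ.map fun ω ↦ (U ω, V ω)) ((μ.map U).prod (μ.map V))

end MutualInformation

/-! ### The noisy permutation channel -/

section Channel

variable {T α Ω : Type*} [MeasurableSpace T] [MeasurableSpace α] [MeasurableSpace Ω]

/-- The finite group of permutations carries the discrete `σ`-algebra. -/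
instance permMeasurableSpace (n : ℕ) : MeasurableSpace (Equiv.Perm (Fin n)) := ⊤

/-- The kernel `(t₁, …, tₙ) ↦ P_{t₁} ⊗ ⋯ ⊗ P_{tₙ}`. -/
def productKernel (K : Kernel T α) [IsMarkovKernel K] (n : ℕ) :
    Kernel (Fin n → T) (Fin n → α) where
  toFun t := Measure.pi fun i ↦ K (t i)
  measurable' := by
    refine Measurable.measure_of_isPiSystem_of_isProbabilityMeasure generateFrom_pi.symm
      isPiSystem_pi ?_
    rintro _ ⟨s, hs, rfl⟩
    simp only [Measure.pi_pi]
    refine Finset.measurable_prod _ fun i _ ↦ ?_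
    exact (K.measurable_coe (hs i (Set.mem_univ i))).comp (measurable_pi_apply i)

instance isMarkovKernel_productKernel (K : Kernel T α) [IsMarkovKernel K] (n : ℕ) :
    IsMarkovKernel (productKernel K n) :=
  ⟨fun t ↦ inferInstanceAs (IsProbabilityMeasure (Measure.pi fun i ↦ K (t i)))⟩

/-- The permuted vector `ϑ`, with `ϑ_i = θ_{π(i)}`. -/
def permuted {n : ℕ} (θ : Ω → Fin n → T) (π : Ω → Equiv.Perm (Fin n)) : Ω → Fin n → T :=
  fun ω i ↦ θ ω (π ω i)

/-- On the probability space `(Ω, μ)`, `θ` is a random vector, `π` is a uniformly random permutation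
independent of `θ`, and, conditionally on `θ` and on the permuted vector `ϑ = (θ_{π(i)})_i`,
the coordinates `X_i ∼ P_{ϑ_i}` of `X` are independent. -/
structure IsNoisyPermutation (K : Kernel T α) [IsMarkovKernel K] (μ : Measure Ω) {n : ℕ}
    (θ : Ω → Fin n → T) (π : Ω → Equiv.Perm (Fin n)) (X : Ω → Fin n → α) : Prop where
  measurable_param : Measurable θ
  measurable_perm : Measurable π
  measurable_obs : Measurable X
  hasLaw_perm : HasLaw π (uniformOn Set.univ) μ
  indep : IndepFun θ π μ
  hasCondDistrib_obs : HasCondDistrib X (fun ω ↦ (θ ω, permuted θ π ω))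
    (Kernel.prodMkLeft (Fin n → T) (productKernel K n)) μ

end Channel

end PermMix

end

/-! Fix a deterministic `θ`, let `ν` be the average of the laws `K (θ j)` and `ρ j` the density of
`K (θ j)` with respect to `ν`. The law of `X` has density `q(x) = (1/n!) ∑_σ ∏ᵢ ρ_{σ i}(xᵢ)` with
respect to `ν^n`, and each of its marginals is `ν`. Comparing log-densities, `n I(ϑ₁;X₁) - I(ϑ;X)`
is exactly the divergence of the law of `X` from `ν^n`, that is `mixEntropy`
(`IsNoisyPermutation.mutualInfo_eq`). Everything reduces to bounding this entropy through `x =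
meanChiSq`, which equals `I_{χ²}(ϑ₁;X₁)`.

Power bound. The entropy is at most `∫ q² - 1`, and `∫ q²` is the permanent of `J + A` divided by
`n!`, where `A` is the Gram matrix of the functions `ρ j - 1`. Wick's formula writes the permanent
as a moment of Gaussian linear forms, and the arithmetic-geometric mean inequality bounds it by `n!
∑ xʲ` (`permanent_le`). The expansion in `A` has nonnegative coefficients and no first-order term,
and rescaling `A` turns this into a bound that starts at `x²` (`gramSum_one_le`).

Logarithmic bound. Coordinates are revealed one at a time. The entropy increment is at most the
second moment of the posterior mean of `ρ_{σ t}(x_t) - 1`. After `k` coordinates it is at most `x /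
(n - k + n / L)` (`integral_posteriorMean_sq_le`): sampling without replacement gives the term `n -
k`, and the noise of the observations gives `n / L`. The sum over `k` is at most `x log (1 + L)`,
and the Hellinger diameter allows `1 + L = 2 Δ`.

Random `θ`. Given `θ`, the divergence of the law of `X` from `Q^n` is `mixEntropy + n KL(ν ‖ Q)`,
where `ν` lies in the convex hull. Comparing with the uniform mixture of the `Q^n` over a covering
net costs the logarithm of the size of the net, and a uniform prior on the `K (θ j)` shows that `x`
is at most the `χ²` capacity. -/

noncomputable section

namespace PermMix

set_option linter.unusedSectionVars false

open scoped ComplexConjugate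

/-! ### Moments of the complex Gaussian -/

section ComplexGaussian

open Complex in
/-- There is a probability measure on `ℂ` with the mixed moments of a standard complex Gaussian. -/
lemma exists_complexGaussian : ∃ γ : Measure ℂ, IsProbabilityMeasure γ ∧
    (∀ a b : ℕ, Integrable (fun z : ℂ ↦ z ^ a * conj z ^ b) γ) ∧
    ∀ a b : ℕ, ∫ z : ℂ, z ^ a * conj z ^ b ∂γ = if a = b then (a.factorial : ℂ) else 0 := by
  -- Polar construction: `|z|²` is exponential, with moments `k!`, and the argument is independent
  -- and uniform on the circle, which kills every moment with `a ≠ b`.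
  let m₁ : Measure ℝ := (volume.restrict (Set.Ioi 0)).withDensity
    fun t ↦ ENNReal.ofReal (Real.exp (-t))
  let m₂ : Measure ℝ := volume.restrict (Set.Ioc 0 (2 * Real.pi))
  let m₃ : Measure ℝ := (ENNReal.ofReal (2 * Real.pi)⁻¹) • m₂
  let g : ℝ × ℝ → ℂ := fun p ↦ (Real.sqrt p.1 : ℂ) * cexp (p.2 * I)
  have hgm : Measurable g := by fun_prop
  have hpi : (0 : ℝ) < 2 * Real.pi := by positivity
  have hprod : ∀ (a b : ℕ) (p : ℝ × ℝ), g p ^ a * conj (g p) ^ b =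
      ((Real.sqrt p.1 ^ (a + b) : ℝ) : ℂ) * cexp ((((a : ℂ) - b) * I) * p.2) := by
    intro a b p
    have h1 : conj (g p) = (Real.sqrt p.1 : ℂ) * cexp (-(p.2 * I)) := by
      simp only [g, map_mul, conj_ofReal, ← exp_conj, conj_I]
      ring_nf
    rw [h1]
    simp only [g]
    rw [mul_pow, mul_pow, ← Complex.exp_nat_mul, ← Complex.exp_nat_mul]
    have h2 : cexp (((a : ℂ) - b) * I * p.2)
        = cexp (a * (p.2 * I)) * cexp (b * (-(p.2 * I))) := by
      rw [← Complex.exp_add]; congr 1; ring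
    rw [h2]; push_cast; ring
  have hint1 : ∀ k : ℕ, Integrable (fun t : ℝ ↦ Real.sqrt t ^ k) m₁ := by
    intro k
    have := Real.GammaIntegral_convergent (s := (k : ℝ) / 2 + 1) (by positivity)
    rw [integrable_withDensity_iff (by fun_prop) (by simp)]
    refine (integrableOn_congr_fun ?_ measurableSet_Ioi).mp this
    intro t ht
    have ht : 0 < t := ht
    simp only
    rw [ENNReal.toReal_ofReal (Real.exp_pos _).le, mul_comm, add_sub_cancel_right,
      Real.sqrt_eq_rpow, ← Real.rpow_natCast, ← Real.rpow_mul ht.le]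
    congr 2; ring
  have hval1 : ∀ k : ℕ, ∫ t, Real.sqrt t ^ (k + k) ∂m₁ = k.factorial := by
    intro k
    rw [integral_withDensity_eq_integral_toReal_smul (by fun_prop) (by simp),
      ← Real.Gamma_nat_eq_factorial, Real.Gamma_eq_integral (by positivity)]
    refine setIntegral_congr_fun measurableSet_Ioi ?_
    intro t ht
    have ht : 0 < t := ht
    simp only [smul_eq_mul]
    rw [ENNReal.toReal_ofReal (Real.exp_pos _).le, ← two_mul, pow_mul, Real.sq_sqrt ht.le,
      add_sub_cancel_right, Real.rpow_natCast]
  have hval2 : ∀ a b : ℕ, ∫ t : ℝ, cexp ((((a : ℂ) - b) * I) * t) ∂m₃ = if a = b then 1 else 0 := by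
    intro a b
    simp only [m₃, m₂]
    rw [integral_smul_measure, ← intervalIntegral.integral_of_le hpi.le]
    split_ifs with hab
    · subst hab
      simp [ENNReal.toReal_ofReal, Real.pi_pos.le]
      field_simp
    · have hc : ((a : ℂ) - b) * I ≠ 0 := by
        simp [sub_eq_zero, hab]
      rw [integral_exp_mul_complex hc]
      have : cexp (((a : ℂ) - b) * I * ((2 * Real.pi : ℝ) : ℂ)) = 1 := by
        rw [Complex.exp_eq_one_iff]
        exact ⟨(a : ℤ) - b, by push_cast; ring⟩
      rw [this]; simp
  have hfin2 : IsFiniteMeasure m₃ := by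
    constructor
    simp only [m₃, m₂, Measure.smul_apply, smul_eq_mul]
    exact ENNReal.mul_lt_top (by simp) (by simpa using ENNReal.mul_lt_top (by simp) (by simp))
  have hsf1 : SFinite m₁ := by infer_instance
  have hint2 : ∀ a b : ℕ, Integrable (fun t : ℝ ↦ cexp ((((a : ℂ) - b) * I) * t)) m₃ := by
    intro a b
    refine Integrable.of_bound (by fun_prop) 1 (Filter.Eventually.of_forall fun t ↦ ?_)
    have : (((a : ℂ) - b) * I) * t = (((a : ℝ) - b) * t : ℝ) * I := by push_cast; ring
    rw [this, Complex.norm_exp_ofReal_mul_I]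
  have hI : ∀ a b : ℕ, Integrable (fun p ↦ g p ^ a * conj (g p) ^ b) (m₁.prod m₃) := by
    intro a b
    simp_rw [hprod a b]
    exact Integrable.mul_prod (f := fun t : ℝ ↦ ((Real.sqrt t ^ (a + b) : ℝ) : ℂ))
      (hint1 (a + b)).ofReal (hint2 a b)
  have hV : ∀ a b : ℕ, ∫ p, g p ^ a * conj (g p) ^ b ∂(m₁.prod m₃) =
      if a = b then (a.factorial : ℂ) else 0 := by
    intro a b
    simp_rw [hprod a b]
    rw [integral_prod_mul (fun t : ℝ ↦ ((Real.sqrt t ^ (a + b) : ℝ) : ℂ))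
      (fun t : ℝ ↦ cexp ((((a : ℂ) - b) * I) * t)), hval2]
    split_ifs with hab
    · subst hab
      rw [integral_complex_ofReal, hval1]; simp
    · simp
  have hmz : ∀ a b : ℕ, Measurable (fun z : ℂ ↦ z ^ a * conj z ^ b) := fun a b ↦
    (measurable_id.pow_const a).mul ((Complex.continuous_conj.measurable).pow_const b)
  refine ⟨(m₁.prod m₃).map g, ?_, ?_, ?_⟩
  · have h00 := hV 0 0
    simp only [pow_zero, mul_one, integral_const, if_true, Nat.factorial_zero, Nat.cast_one] at h00
    have : (m₁.prod m₃).real Set.univ = 1 := by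
      have := congrArg Complex.re h00
      simpa using this
    have hp : IsProbabilityMeasure (m₁.prod m₃) := by
      constructor
      rw [Measure.real, ENNReal.toReal_eq_one_iff] at this
      exact this
    exact Measure.isProbabilityMeasure_map hgm.aemeasurable
  · intro a b
    rw [integrable_map_measure (hmz a b).aestronglyMeasurable hgm.aemeasurable]
    exact hI a b
  · intro a b
    rw [integral_map hgm.aemeasurable (hmz a b).aestronglyMeasurable]
    exact hV a b

end ComplexGaussian

/-! ### Wick's formula for permanents of Gram matrices -/

section Wick

/-- The probability measure `γ` on `ℂ` has the mixed moments of a standard complex Gaussian. -/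
structure HasGaussianMoments (γ : Measure ℂ) : Prop where
  integrable (a b : ℕ) : Integrable (fun z : ℂ ↦ z ^ a * conj z ^ b) γ
  integral (a b : ℕ) : ∫ z : ℂ, z ^ a * conj z ^ b ∂γ = if a = b then (a.factorial : ℂ) else 0

variable {ι d : Type*} [Fintype ι] [DecidableEq ι] [Fintype d] [DecidableEq d]

/-- The solutions `π` form a coset of the stabilizer of `m`, a product of symmetric groups of its
fibres, provided that the fibres of `κ` and `m` have equal sizes; otherwise there are none. The
right-hand side is the product over `k` of the Gaussian moments of `integral_prod`. -/
lemma card_perm_comp_eq (κ m : ι → d) :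
    (Finset.card {π : Equiv.Perm ι | m ∘ π = κ} : ℂ) =
      ∏ k, if Finset.card {i | κ i = k} = Finset.card {i | m i = k} then
        ((Finset.card {i | κ i = k}).factorial : ℂ) else 0 := by
  by_cases h : ∀ k, Finset.card {i | κ i = k} = Finset.card {i | m i = k}
  · simp only [h, if_true]
    have hex : ∃ π₀ : Equiv.Perm ι, m ∘ π₀ = κ := by
      have e : ∀ k, Nonempty ({i // κ i = k} ≃ {i // m i = k}) := fun k ↦ by
        rw [← Fintype.card_eq, Fintype.card_subtype, Fintype.card_subtype, h k]
      let E : ι ≃ ι := (Equiv.sigmaFiberEquiv κ).symm.trans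
        ((Equiv.sigmaCongrRight fun k ↦ (e k).some).trans (Equiv.sigmaFiberEquiv m))
      refine ⟨E, funext fun i ↦ ?_⟩
      exact ((e (κ i)).some ⟨i, rfl⟩).2
    obtain ⟨π₀, rfl⟩ := hex
    have h1 : Finset.card {π : Equiv.Perm ι | m ∘ π = m ∘ π₀} =
        Fintype.card {π : Equiv.Perm ι // m ∘ π = m} := by
      rw [Fintype.card_subtype]
      refine Finset.card_bij' (fun π _ ↦ π * π₀⁻¹) (fun π _ ↦ π * π₀) ?_ ?_ ?_ ?_
      · intro π hπ
        simp only [Finset.mem_filter, Finset.mem_univ, true_and] at hπ ⊢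
        funext i
        have := congrFun hπ (π₀⁻¹ i)
        simpa using this
      · intro π hπ
        simp only [Finset.mem_filter, Finset.mem_univ, true_and] at hπ ⊢
        funext i
        exact congrFun hπ (π₀ i)
      · intro π _; simp
      · intro π _; simp
    rw [h1, DomMulAct.stabilizer_card]
    push_cast
    refine Finset.prod_congr rfl fun k _ ↦ ?_
    rw [Fintype.card_subtype]
  · push Not at h
    obtain ⟨k, hk⟩ := h
    rw [Finset.prod_eq_zero (Finset.mem_univ k) (by rw [if_neg hk]), Nat.cast_eq_zero,
      Finset.card_eq_zero, Finset.filter_eq_empty_iff]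
    rintro π - rfl
    refine hk (Finset.card_bij (fun i _ ↦ π i) ?_ ?_ ?_)
    · intro i hi; simpa using hi
    · intro i _ j _ hij; exact π.injective hij
    · intro i hi; exact ⟨π.symm i, by simpa using hi, by simp⟩

variable {γ : Measure ℂ} [IsProbabilityMeasure γ]

lemma prod_eval_eq (κ m : ι → d) (g : d → ℂ) :
    (∏ i, g (κ i)) * ∏ i, conj (g (m i)) =
      ∏ k, (g k ^ Finset.card {i | κ i = k} * conj (g k) ^ Finset.card {i | m i = k}) := by
  rw [Finset.prod_mul_distrib]
  congr 1
  · rw [← Finset.prod_fiberwise Finset.univ κ]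
    refine Finset.prod_congr rfl fun k _ ↦ ?_
    rw [← Finset.prod_const]
    exact Finset.prod_congr rfl fun i hi ↦ by rw [(Finset.mem_filter.mp hi).2]
  · rw [← Finset.prod_fiberwise Finset.univ m]
    refine Finset.prod_congr rfl fun k _ ↦ ?_
    rw [← Finset.prod_const]
    exact Finset.prod_congr rfl fun i hi ↦ by rw [(Finset.mem_filter.mp hi).2]

lemma HasGaussianMoments.integrable_prod (hγ : HasGaussianMoments γ) (κ m : ι → d) :
    Integrable (fun g : d → ℂ ↦ (∏ i, g (κ i)) * ∏ i, conj (g (m i)))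
      (Measure.pi fun _ ↦ γ) := by
  simp_rw [prod_eval_eq κ m]
  exact Integrable.fintype_prod (f := fun k z ↦ z ^ Finset.card {i | κ i = k} *
    conj z ^ Finset.card {i | m i = k}) fun k ↦ hγ.integrable _ _

lemma HasGaussianMoments.integral_prod (hγ : HasGaussianMoments γ) (κ m : ι → d) :
    ∫ g : d → ℂ, (∏ i, g (κ i)) * ∏ i, conj (g (m i)) ∂(Measure.pi fun _ ↦ γ) =
      Finset.card {π : Equiv.Perm ι | m ∘ π = κ} := by
  simp_rw [prod_eval_eq κ m]
  rw [integral_fintype_prod_eq_prod (fun k z ↦ z ^ Finset.card {i | κ i = k} *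
    conj z ^ Finset.card {i | m i = k}), card_perm_comp_eq]
  exact Finset.prod_congr rfl fun k _ ↦ hγ.integral _ _

/-- The linear forms with real coefficients `W`. -/
def linForm (W : ι → d → ℝ) (g : d → ℂ) (i : ι) : ℂ := ∑ k, (W i k : ℂ) * g k

lemma prod_linForm_mul_conj (W : ι → d → ℝ) (g : d → ℂ) :
    (∏ i, linForm W g i) * ∏ i, conj (linForm W g i) = ∑ κ : ι → d, ∑ m : ι → d,
      ((∏ i, (W i (κ i) : ℂ)) * ∏ i, (W i (m i) : ℂ)) *
        ((∏ i, g (κ i)) * ∏ i, conj (g (m i))) := by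
  have h1 : ∏ i, linForm W g i = ∑ κ : ι → d, (∏ i, (W i (κ i) : ℂ)) * ∏ i, g (κ i) := by
    simp only [linForm]
    rw [Finset.prod_univ_sum, Fintype.piFinset_univ]
    simp_rw [Finset.prod_mul_distrib]
  have h2 : ∏ i, conj (linForm W g i) =
      ∑ m : ι → d, (∏ i, (W i (m i) : ℂ)) * ∏ i, conj (g (m i)) := by
    simp only [linForm, map_sum, map_mul, Complex.conj_ofReal]
    rw [Finset.prod_univ_sum, Fintype.piFinset_univ]
    simp_rw [Finset.prod_mul_distrib]
  rw [h1, h2, Finset.sum_mul_sum]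
  exact Finset.sum_congr rfl fun κ _ ↦ Finset.sum_congr rfl fun m _ ↦ by ring

/-- Writing the cardinality as a sum of indicators of `κ = m ∘ π` eliminates `κ`. Replacing `π` by
its inverse then makes the sum over `m` factor over the coordinates. -/
lemma sum_sum_perm_eq (W : ι → d → ℝ) :
    ∑ κ : ι → d, ∑ m : ι → d, ((∏ i, W i (κ i)) * ∏ i, W i (m i)) *
        (Finset.card {π : Equiv.Perm ι | m ∘ π = κ} : ℝ) =
      ∑ π : Equiv.Perm ι, ∏ i, ∑ k, W i k * W (π i) k := by
  have h1 : ∀ κ m : ι → d, (Finset.card {π : Equiv.Perm ι | m ∘ π = κ} : ℝ) =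
      ∑ π : Equiv.Perm ι, if κ = m ∘ π then 1 else 0 := fun κ m ↦ by
    simp [eq_comm]
  simp_rw [h1, Finset.mul_sum]
  rw [Finset.sum_comm]
  have h2 : ∀ m : ι → d, ∑ κ : ι → d, ∑ π : Equiv.Perm ι,
      ((∏ i, W i (κ i)) * ∏ i, W i (m i)) * (if κ = m ∘ π then 1 else 0) =
      ∑ π : Equiv.Perm ι, (∏ i, W i (m (π i))) * ∏ i, W i (m i) := fun m ↦ by
    rw [Finset.sum_comm]
    refine Finset.sum_congr rfl fun π _ ↦ ?_
    simp
  simp_rw [h2]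
  rw [Finset.sum_comm, ← Equiv.sum_comp (Equiv.inv (Equiv.Perm ι))]
  refine Finset.sum_congr rfl fun π _ ↦ ?_
  rw [Finset.prod_univ_sum, Fintype.piFinset_univ]
  refine Finset.sum_congr rfl fun m _ ↦ ?_
  rw [Finset.prod_mul_distrib, mul_comm, ← Equiv.prod_comp π (fun i ↦ W i (m ((Equiv.inv _ π) i)))]
  simp

lemma prod_normSq_eq (W : ι → d → ℝ) (g : d → ℂ) :
    ((∏ i, ‖linForm W g i‖ ^ 2 : ℝ) : ℂ) =
      (∏ i, linForm W g i) * ∏ i, conj (linForm W g i) := by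
  rw [← Finset.prod_mul_distrib]
  push_cast
  exact Finset.prod_congr rfl fun i _ ↦ (Complex.mul_conj' _).symm

lemma HasGaussianMoments.integrable_prod_linForm (hγ : HasGaussianMoments γ) (W : ι → d → ℝ) :
    Integrable (fun g ↦ ∏ i, ‖linForm W g i‖ ^ 2) (Measure.pi fun _ : d ↦ γ) := by
  have : Integrable (fun g ↦ ((∏ i, ‖linForm W g i‖ ^ 2 : ℝ) : ℂ)) (Measure.pi fun _ : d ↦ γ) := by
    simp_rw [prod_normSq_eq, prod_linForm_mul_conj]
    exact integrable_finsetSum _ fun κ _ ↦ integrable_finsetSum _ fun m _ ↦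
      (hγ.integrable_prod κ m).const_mul _
  exact (integrable_congr (Filter.Eventually.of_forall fun g ↦ Complex.ofReal_re _)).mp this.re

/-- **Wick's formula**: the mixed absolute second moment of complex Gaussian linear forms is the
permanent of their Gram matrix. -/
lemma HasGaussianMoments.integral_prod_linForm (hγ : HasGaussianMoments γ) (W : ι → d → ℝ) :
    ∫ g, ∏ i, ‖linForm W g i‖ ^ 2 ∂(Measure.pi fun _ : d ↦ γ) =
      ∑ π : Equiv.Perm ι, ∏ i, ∑ k, W i k * W (π i) k := by
  rw [← sum_sum_perm_eq]
  apply Complex.ofReal_injective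
  rw [← integral_complex_ofReal]
  simp_rw [prod_normSq_eq, prod_linForm_mul_conj]
  rw [integral_finsetSum _ fun κ _ ↦ integrable_finsetSum _ fun m _ ↦
      (hγ.integrable_prod κ m).const_mul _]
  push_cast
  refine Finset.sum_congr rfl fun κ _ ↦ ?_
  rw [integral_finsetSum _ fun m _ ↦ (hγ.integrable_prod κ m).const_mul _]
  refine Finset.sum_congr rfl fun m _ ↦ ?_
  rw [integral_const_mul, hγ.integral_prod]

end Wick

/-! ### The permanent of a perturbation of the all-ones matrix -/

section PermanentBound

lemma prod_le_mean_pow {ι : Type*} [Fintype ι] [Nonempty ι] (w : ι → ℝ) (hw : ∀ i, 0 ≤ w i) :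
    ∏ i, w i ≤ ((∑ i, w i) / Fintype.card ι) ^ Fintype.card ι := by
  have hn : (Fintype.card ι : ℝ) ≠ 0 := by simp
  have h := Real.geom_mean_le_arith_mean_weighted Finset.univ
    (fun _ : ι ↦ (Fintype.card ι : ℝ)⁻¹) w (by intros; positivity) (by simp) (fun i _ ↦ hw i)
  rw [← Finset.mul_sum, Real.finsetProd_rpow _ _ (fun i _ ↦ hw i)] at h
  have h0 : 0 ≤ ∏ i, w i := Finset.prod_nonneg fun i _ ↦ hw i
  calc ∏ i, w i = ((∏ i, w i) ^ (Fintype.card ι : ℝ)⁻¹) ^ Fintype.card ι := by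
        rw [← Real.rpow_natCast, ← Real.rpow_mul h0, inv_mul_cancel₀ hn, Real.rpow_one]
    _ ≤ _ := by
        rw [div_eq_inv_mul]
        exact pow_le_pow_left₀ (by positivity) h _

variable {γ : Measure ℂ} [IsProbabilityMeasure γ]

lemma HasGaussianMoments.integrable_norm_pow (hγ : HasGaussianMoments γ) (j : ℕ) :
    Integrable (fun z : ℂ ↦ (‖z‖ ^ 2) ^ j) γ := by
  have h := (hγ.integrable j j).re
  refine (integrable_congr (Filter.Eventually.of_forall fun z ↦ ?_)).mp h
  change (z ^ j * conj z ^ j).re = _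
  rw [← mul_pow, Complex.mul_conj']
  norm_cast

lemma HasGaussianMoments.integral_norm_pow (hγ : HasGaussianMoments γ) (j : ℕ) :
    ∫ z : ℂ, (‖z‖ ^ 2) ^ j ∂γ = j.factorial := by
  have h := hγ.integral j j
  simp only [if_true] at h
  apply Complex.ofReal_injective
  rw [← integral_complex_ofReal]
  push_cast
  rw [← h]
  refine integral_congr_ae (Filter.Eventually.of_forall fun z ↦ ?_)
  simp only
  rw [← mul_pow, Complex.mul_conj']

variable {n d : ℕ}

lemma HasGaussianMoments.integrable_sum_linForm_pow (hγ : HasGaussianMoments γ)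
    (V : Fin n → Fin d → ℝ) (j : ℕ) :
    Integrable (fun g ↦ (∑ i, ‖linForm V g i‖ ^ 2) ^ j) (Measure.pi fun _ : Fin d ↦ γ) := by
  simp_rw [Fintype.sum_pow]
  exact integrable_finsetSum _ fun p _ ↦ hγ.integrable_prod_linForm fun i ↦ V (p i)

/-- Each term of the expanded power is, by Wick's formula, a permanent with `j!` summands. By
Cauchy–Schwarz each summand is at most the product of the diagonal entries, since a permutation only
reorders the norms. -/
lemma HasGaussianMoments.integral_sum_linForm_pow_le (hγ : HasGaussianMoments γ)
    (V : Fin n → Fin d → ℝ) (j : ℕ) :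
    ∫ g, (∑ i, ‖linForm V g i‖ ^ 2) ^ j ∂(Measure.pi fun _ : Fin d ↦ γ) ≤
      j.factorial * (∑ i, ∑ k, V i k ^ 2) ^ j := by
  simp_rw [Fintype.sum_pow]
  rw [integral_finsetSum _ fun p _ ↦ hγ.integrable_prod_linForm fun i ↦ V (p i), Finset.mul_sum]
  refine Finset.sum_le_sum fun p _ ↦ ?_
  have hW := hγ.integral_prod_linForm fun i ↦ V (p i)
  change ∫ g, ∏ i, ‖linForm (fun i ↦ V (p i)) g i‖ ^ 2 ∂_ ≤ _
  rw [hW]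
  have key : ∀ π : Equiv.Perm (Fin j), ∏ i, ∑ k, V (p i) k * V (p (π i)) k ≤
      ∏ i, ∑ k, V (p i) k ^ 2 := fun π ↦ by
    have h0 : ∀ i, 0 ≤ ∑ k, V i k ^ 2 := fun i ↦ Finset.sum_nonneg fun k _ ↦ sq_nonneg _
    calc ∏ i, ∑ k, V (p i) k * V (p (π i)) k
        ≤ |∏ i, ∑ k, V (p i) k * V (p (π i)) k| := le_abs_self _
      _ = ∏ i, |∑ k, V (p i) k * V (p (π i)) k| := Finset.abs_prod _ _
      _ ≤ ∏ i, (Real.sqrt (∑ k, V (p i) k ^ 2) * Real.sqrt (∑ k, V (p (π i)) k ^ 2)) := by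
          refine Finset.prod_le_prod (fun i _ ↦ abs_nonneg _) fun i _ ↦ ?_
          rw [← Real.sqrt_mul (h0 _)]
          exact Real.abs_le_sqrt (Finset.sum_mul_sq_le_sq_mul_sq _ _ _)
      _ = ∏ i, ∑ k, V (p i) k ^ 2 := by
          rw [Finset.prod_mul_distrib,
            Equiv.prod_comp π (fun i ↦ Real.sqrt (∑ k, V (p i) k ^ 2)),
            ← Finset.prod_mul_distrib]
          exact Finset.prod_congr rfl fun i _ ↦ Real.mul_self_sqrt (h0 _)
  calc _ ≤ ∑ _π : Equiv.Perm (Fin j), ∏ i, ∑ k, V (p i) k ^ 2 :=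
        Finset.sum_le_sum fun π _ ↦ key π
    _ = _ := by simp [Fintype.card_perm]

lemma linForm_cons_one (V : Fin n → Fin d → ℝ) (g : Fin (d + 1) → ℂ) (i : Fin n) :
    linForm (fun i ↦ (Fin.cons 1 (V i) : Fin (d + 1) → ℝ)) g i =
      g 0 + linForm V (fun k ↦ g k.succ) i := by
  simp [linForm, Fin.sum_univ_succ]

/-- The cross terms cancel because the columns of `V` are centred; this separates the constant
direction from `V`. -/
lemma sum_norm_add_sq (V : Fin n → Fin d → ℝ) (hV : ∀ k, ∑ i, V i k = 0) (w : ℂ)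
    (g : Fin d → ℂ) :
    ∑ i, ‖w + linForm V g i‖ ^ 2 = n * ‖w‖ ^ 2 + ∑ i, ‖linForm V g i‖ ^ 2 := by
  have h0 : ∑ i, linForm V g i = 0 := by
    simp only [linForm]
    rw [Finset.sum_comm]
    refine Finset.sum_eq_zero fun k _ ↦ ?_
    rw [← Finset.sum_mul, ← Complex.ofReal_sum, hV k]; simp
  have h1 : ∀ z : ℂ, ‖w + z‖ ^ 2 = ‖w‖ ^ 2 + ‖z‖ ^ 2 + 2 * (w * conj z).re := fun z ↦ by
    rw [← Complex.normSq_eq_norm_sq, ← Complex.normSq_eq_norm_sq, ← Complex.normSq_eq_norm_sq,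
      Complex.normSq_add]
  simp_rw [h1]
  rw [Finset.sum_add_distrib, Finset.sum_add_distrib, ← Finset.mul_sum, ← Complex.re_sum,
    ← Finset.mul_sum, ← map_sum, h0]
  simp

/-- The permanent of `J + V Vᵀ`, where `J` is the all-ones matrix and the columns of `V` have mean
zero, is controlled by the trace of `V Vᵀ`. -/
theorem permanent_le [NeZero n] (V : Fin n → Fin d → ℝ) (hV : ∀ k, ∑ i, V i k = 0) :
    ∑ π : Equiv.Perm (Fin n), ∏ i, (1 + ∑ k, V i k * V (π i) k) ≤
      n.factorial * ∑ j ∈ Finset.range (n + 1), ((∑ i, ∑ k, V i k ^ 2) / n) ^ j := by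
  obtain ⟨γ, hγp, h1, h2⟩ := exists_complexGaussian
  have hγ : HasGaussianMoments γ := ⟨h1, h2⟩
  have hn : (n : ℝ) ≠ 0 := by simp [NeZero.ne n]
  -- Prepending `1` to every row adds the all-ones matrix to the Gram matrix.
  set W : Fin n → Fin (d + 1) → ℝ := fun i ↦ Fin.cons 1 (V i) with hW
  set τ := ∑ i, ∑ k, V i k ^ 2
  let Z : (Fin d → ℂ) → ℝ := fun g ↦ ∑ i, ‖linForm V g i‖ ^ 2
  have hGram : ∑ π : Equiv.Perm (Fin n), ∏ i, (1 + ∑ k, V i k * V (π i) k) =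
      ∫ g, ∏ i, ‖linForm W g i‖ ^ 2 ∂(Measure.pi fun _ : Fin (d + 1) ↦ γ) := by
    rw [hγ.integral_prod_linForm]
    simp [hW, Fin.sum_univ_succ]
  have hmp := measurePreserving_piFinSuccAbove (fun _ : Fin (d + 1) ↦ γ) 0
  let F : ℂ × (Fin d → ℂ) → ℝ := fun p ↦ (‖p.1‖ ^ 2 + Z p.2 / n) ^ n
  have hF : ∀ p, F p = ∑ m ∈ Finset.range (n + 1),
      (‖p.1‖ ^ 2) ^ m * (Z p.2 ^ (n - m) * (((n : ℝ) ^ (n - m))⁻¹ * n.choose m)) := fun p ↦ by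
    simp only [F]
    rw [add_pow]
    refine Finset.sum_congr rfl fun m _ ↦ ?_
    rw [div_pow]; ring
  have hint : ∀ m, Integrable (fun p : ℂ × (Fin d → ℂ) ↦
      (‖p.1‖ ^ 2) ^ m * (Z p.2 ^ (n - m) * (((n : ℝ) ^ (n - m))⁻¹ * n.choose m)))
      (γ.prod (Measure.pi fun _ : Fin d ↦ γ)) := fun m ↦
    Integrable.mul_prod (f := fun z : ℂ ↦ (‖z‖ ^ 2) ^ m)
      (g := fun g ↦ Z g ^ (n - m) * (((n : ℝ) ^ (n - m))⁻¹ * n.choose m))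
      (hγ.integrable_norm_pow m) ((hγ.integrable_sum_linForm_pow V (n - m)).mul_const _)
  have hFint : Integrable F (γ.prod (Measure.pi fun _ : Fin d ↦ γ)) := by
    rw [show F = _ from funext hF]
    exact integrable_finsetSum _ fun m _ ↦ hint m
  have hFe : ∀ g : Fin (d + 1) → ℂ, F (MeasurableEquiv.piFinSuccAbove (fun _ ↦ ℂ) 0 g) =
      (‖g 0‖ ^ 2 + Z (fun k ↦ g k.succ) / n) ^ n := fun g ↦ rfl
  -- The arithmetic-geometric mean inequality replaces the product by the `n`-th power of `‖g₀‖² + Z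
  -- / n`, whose two terms are independent.
  have hle : ∀ g : Fin (d + 1) → ℂ, ∏ i, ‖linForm W g i‖ ^ 2 ≤
      F (MeasurableEquiv.piFinSuccAbove (fun _ ↦ ℂ) 0 g) := fun g ↦ by
    refine (prod_le_mean_pow _ fun i ↦ by positivity).trans_eq ?_
    rw [hFe]
    simp only [hW, linForm_cons_one]
    rw [sum_norm_add_sq V hV, Fintype.card_fin, add_div, mul_div_cancel_left₀ _ hn]
  rw [hGram]
  calc _ ≤ ∫ g, F (MeasurableEquiv.piFinSuccAbove (fun _ ↦ ℂ) 0 g)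
        ∂(Measure.pi fun _ : Fin (d + 1) ↦ γ) :=
        integral_mono (hγ.integrable_prod_linForm W) (hmp.integrable_comp_of_integrable hFint) hle
    _ = ∫ p, F p ∂(γ.prod (Measure.pi fun _ : Fin d ↦ γ)) :=
        hmp.integral_comp (MeasurableEquiv.measurableEmbedding _) F
    _ = ∑ m ∈ Finset.range (n + 1), m.factorial *
          ((∫ g, Z g ^ (n - m) ∂(Measure.pi fun _ : Fin d ↦ γ)) *
            (((n : ℝ) ^ (n - m))⁻¹ * n.choose m)) := by
        simp_rw [hF]
        rw [integral_finsetSum _ fun m _ ↦ hint m]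
        refine Finset.sum_congr rfl fun m _ ↦ ?_
        rw [integral_prod_mul (fun z : ℂ ↦ (‖z‖ ^ 2) ^ m)
          (fun g ↦ Z g ^ (n - m) * (((n : ℝ) ^ (n - m))⁻¹ * n.choose m)), hγ.integral_norm_pow,
          integral_mul_const]
    _ ≤ ∑ m ∈ Finset.range (n + 1), m.factorial *
          (((n - m).factorial * τ ^ (n - m)) * (((n : ℝ) ^ (n - m))⁻¹ * n.choose m)) := by
        gcongr with m _
        exact hγ.integral_sum_linForm_pow_le V (n - m)
    _ = ∑ m ∈ Finset.range (n + 1), n.factorial * (τ / n) ^ (n - m) := by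
        -- The factorials from the two moments and the binomial coefficient combine to exactly `n!`,
        -- leaving a geometric sum.
        refine Finset.sum_congr rfl fun m hm ↦ ?_
        rw [← Nat.choose_mul_factorial_mul_factorial (Finset.mem_range_succ_iff.mp hm), div_pow]
        push_cast
        ring
    _ = _ := by
        rw [← Finset.mul_sum, ← Finset.sum_range_reflect]
        congr 1
        refine Finset.sum_congr rfl fun j hj ↦ ?_
        have := Finset.mem_range.mp hj
        congr 1; omega

end PermanentBound

/-! ### Removing the first-order term -/

section SecondOrder

variable {n d : ℕ}

/-- A uniform permutation sends `i` to a uniform point. The generality of an additive monoid covers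
both `ℝ` and `ℝ≥0∞`. -/
lemma nsmul_sum_perm_apply {M : Type*} [AddCommMonoid M] (f : Fin n → M) (i : Fin n) :
    n • ∑ σ : Equiv.Perm (Fin n), f (σ i) = n.factorial • ∑ j, f j := by
  have h : ∀ j, ∑ σ : Equiv.Perm (Fin n), f (σ j) = ∑ σ : Equiv.Perm (Fin n), f (σ i) := fun j ↦ by
    rw [← Equiv.sum_comp (Equiv.mulRight (Equiv.swap i j)) (fun σ ↦ f (σ i))]
    simp
  calc n • ∑ σ : Equiv.Perm (Fin n), f (σ i)
      = ∑ j, ∑ σ : Equiv.Perm (Fin n), f (σ j) := by simp [h]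
    _ = ∑ _σ : Equiv.Perm (Fin n), ∑ j, f j := by
        rw [Finset.sum_comm]
        exact Finset.sum_congr rfl fun σ _ ↦ Equiv.sum_comp σ f
    _ = _ := by simp [Fintype.card_perm]

lemma sum_perm_apply (f : Fin n → ℝ) (i : Fin n) :
    n * ∑ σ : Equiv.Perm (Fin n), f (σ i) = n.factorial * ∑ j, f j := by
  simpa only [nsmul_eq_mul] using nsmul_sum_perm_apply f i

lemma inv_factorial_mul_sum_perm_apply (f : Fin n → ℝ≥0∞) (i : Fin n) :
    (n.factorial : ℝ≥0∞)⁻¹ * ∑ σ : Equiv.Perm (Fin n), f (σ i) = (n : ℝ≥0∞)⁻¹ * ∑ j, f j := by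
  have hn : (n : ℝ≥0∞) ≠ 0 := Nat.cast_ne_zero.mpr (by rintro rfl; exact i.elim0)
  have hf : (n.factorial : ℝ≥0∞) ≠ 0 := Nat.cast_ne_zero.mpr n.factorial_ne_zero
  have h := nsmul_sum_perm_apply f i
  simp only [nsmul_eq_mul] at h
  rw [← ENNReal.mul_right_inj hn (by simp), mul_left_comm, h, ← mul_assoc, ← mul_assoc,
    ENNReal.inv_mul_cancel hf (by simp), ENNReal.mul_inv_cancel hn (by simp)]

/-- Expanding the inner products decouples `σ` from `τ` and leaves a sum of squares. -/
lemma sum_sum_prod_gram_nonneg (V : Fin n → Fin d → ℝ) (S : Finset (Fin n)) :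
    0 ≤ ∑ σ : Equiv.Perm (Fin n), ∑ τ : Equiv.Perm (Fin n),
      ∏ i ∈ S, ∑ k, V (σ i) k * V (τ i) k := by
  have h : ∀ σ τ : Equiv.Perm (Fin n), ∏ i ∈ S, ∑ k, V (σ i) k * V (τ i) k =
      ∑ m : S → Fin d, (∏ i : S, V (σ i) (m i)) * ∏ i : S, V (τ i) (m i) := fun σ τ ↦ by
    rw [← Finset.prod_coe_sort, Finset.prod_univ_sum, Fintype.piFinset_univ]
    simp_rw [Finset.prod_mul_distrib]
  have h2 : ∑ σ : Equiv.Perm (Fin n), ∑ τ : Equiv.Perm (Fin n),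
      ∏ i ∈ S, ∑ k, V (σ i) k * V (τ i) k =
      ∑ m : S → Fin d, (∑ σ : Equiv.Perm (Fin n), ∏ i : S, V (σ i) (m i)) ^ 2 := by
    simp_rw [h, sq, Finset.sum_mul_sum]
    rw [Finset.sum_comm' (t' := Finset.univ) (s' := fun _ ↦ Finset.univ) (by simp)]
    rw [Finset.sum_comm]
    simp_rw [Finset.sum_comm (s := (Finset.univ : Finset (Equiv.Perm (Fin n))))
      (t := (Finset.univ : Finset (S → Fin d)))]
  rw [h2]
  exact Finset.sum_nonneg fun m _ ↦ sq_nonneg _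

lemma sum_sum_gram_eq_zero (V : Fin n → Fin d → ℝ) (hV : ∀ k, ∑ i, V i k = 0) (i : Fin n) :
    ∑ σ : Equiv.Perm (Fin n), ∑ τ : Equiv.Perm (Fin n), ∑ k, V (σ i) k * V (τ i) k = 0 := by
  refine Finset.sum_eq_zero fun σ _ ↦ ?_
  rw [Finset.sum_comm]
  refine Finset.sum_eq_zero fun k _ ↦ ?_
  rw [← Finset.mul_sum]
  have h := sum_perm_apply (fun j ↦ V j k) i
  rw [hV k, mul_zero] at h
  have hn : (n : ℝ) ≠ 0 := Nat.cast_ne_zero.mpr (Nat.pos_of_ne_zero (by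
    rintro rfl; exact i.elim0)).ne'
  rw [(mul_eq_zero.mp h).resolve_left hn, mul_zero]

/-- The sum `∑ σ, τ, ∏ i, (1 + s A_{σ i, τ i})` for the Gram matrix `A = V Vᵀ`. -/
def gramSum (V : Fin n → Fin d → ℝ) (s : ℝ) : ℝ :=
  ∑ σ : Equiv.Perm (Fin n), ∑ τ : Equiv.Perm (Fin n),
    ∏ i, (1 + s * ∑ k, V (σ i) k * V (τ i) k)

lemma gramSum_eq_sum (V : Fin n → Fin d → ℝ) (s : ℝ) :
    gramSum V s = ∑ S : Finset (Fin n), s ^ S.card *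
      ∑ σ : Equiv.Perm (Fin n), ∑ τ : Equiv.Perm (Fin n),
        ∏ i ∈ S, ∑ k, V (σ i) k * V (τ i) k := by
  simp only [gramSum, Finset.prod_one_add, Finset.powerset_univ, Finset.prod_mul_distrib,
    Finset.prod_const]
  simp_rw [Finset.mul_sum (Finset.univ : Finset (Equiv.Perm (Fin n)))]
  symm
  refine Finset.sum_comm.trans (Finset.sum_congr rfl fun σ _ ↦ ?_)
  exact Finset.sum_comm

/-- In the expansion over subsets `S`, the coefficient of `s ^ S.card` is nonnegative, the empty set
gives `n!²`, and singletons vanish by centring. Every remaining term therefore gains a factor of at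
least `s²`. -/
lemma gramSum_second_order (V : Fin n → Fin d → ℝ) (hV : ∀ k, ∑ i, V i k = 0) {s : ℝ}
    (hs : 1 ≤ s) :
    s ^ 2 * (gramSum V 1 - n.factorial ^ 2) ≤ gramSum V s - n.factorial ^ 2 := by
  have h0 : ((n.factorial : ℝ)) ^ 2 = ∑ S : Finset (Fin n), if S = ∅ then
      ∑ σ : Equiv.Perm (Fin n), ∑ τ : Equiv.Perm (Fin n),
        ∏ i ∈ S, ∑ k, V (σ i) k * V (τ i) k else 0 := by
    rw [Finset.sum_ite_eq' Finset.univ]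
    simp [Fintype.card_perm, sq]
  rw [gramSum_eq_sum, gramSum_eq_sum, h0, ← Finset.sum_sub_distrib, ← Finset.sum_sub_distrib,
    Finset.mul_sum]
  refine Finset.sum_le_sum fun S _ ↦ ?_
  split_ifs with hS
  · subst hS; simp
  · have hnn := sum_sum_prod_gram_nonneg V S
    rcases Nat.lt_or_ge S.card 2 with h2 | h2
    · have h1 : S.card = 1 := by
        have := Finset.card_pos.mpr (Finset.nonempty_iff_ne_empty.mpr hS)
        omega
      obtain ⟨i, rfl⟩ := Finset.card_eq_one.mp h1
      simp only [Finset.prod_singleton, sum_sum_gram_eq_zero V hV i]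
      simp
    · rw [one_pow, one_mul, sub_zero, sub_zero]
      exact mul_le_mul_of_nonneg_right (pow_le_pow_right₀ hs h2) hnn

/-- The inner sum over `τ` does not depend on `σ`, so the double sum is `n!` times a permanent;
`permanent_le` applies to `V` scaled by `√s`. -/
lemma gramSum_le [NeZero n] (V : Fin n → Fin d → ℝ) (hV : ∀ k, ∑ i, V i k = 0) {s : ℝ}
    (hs : 0 ≤ s) :
    gramSum V s ≤ n.factorial ^ 2 *
      ∑ j ∈ Finset.range (n + 1), (s * ((∑ i, ∑ k, V i k ^ 2) / n)) ^ j := by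
  have h1 : gramSum V s = n.factorial * ∑ π : Equiv.Perm (Fin n),
      ∏ i, (1 + ∑ k, (Real.sqrt s * V i k) * (Real.sqrt s * V (π i) k)) := by
    have : ∀ σ : Equiv.Perm (Fin n), ∑ τ : Equiv.Perm (Fin n),
        ∏ i, (1 + s * ∑ k, V (σ i) k * V (τ i) k) = ∑ π : Equiv.Perm (Fin n),
        ∏ i, (1 + ∑ k, (Real.sqrt s * V i k) * (Real.sqrt s * V (π i) k)) := fun σ ↦ by
      rw [← Equiv.sum_comp (Equiv.mulRight σ)]
      refine Finset.sum_congr rfl fun π _ ↦ ?_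
      rw [← Equiv.prod_comp σ (fun i ↦ 1 + ∑ k, (Real.sqrt s * V i k) * (Real.sqrt s * V (π i) k))]
      refine Finset.prod_congr rfl fun i _ ↦ ?_
      rw [Finset.mul_sum]
      congr 1
      refine Finset.sum_congr rfl fun k _ ↦ ?_
      rw [mul_mul_mul_comm, Real.mul_self_sqrt hs]
      simp
    simp only [gramSum, this]
    simp [Fintype.card_perm]
  have h2 := permanent_le (fun i k ↦ Real.sqrt s * V i k) fun k ↦ by
    rw [← Finset.mul_sum, hV k, mul_zero]
  rw [h1, sq, mul_assoc]
  refine mul_le_mul_of_nonneg_left (h2.trans_eq ?_) (by positivity)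
  congr 2
  funext j
  simp_rw [mul_pow, Real.sq_sqrt hs, ← Finset.mul_sum]
  rw [mul_div_assoc, mul_pow]

/-- The permanent bound at `s = 1` still contains the linear term `x`. For small `x` it is removed
by applying the bound at a large `s` and returning to `s = 1` with the gain `s²`. -/
lemma gramSum_one_le [NeZero n] (V : Fin n → Fin d → ℝ) (hV : ∀ k, ∑ i, V i k = 0) {x : ℝ}
    (hx : x = (∑ i, ∑ k, V i k ^ 2) / n) :
    gramSum V 1 / n.factorial ^ 2 - 1 ≤ 4 * ∑ l ∈ Finset.Icc 2 n, x ^ l := by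
  have hfac : (0 : ℝ) < n.factorial ^ 2 := by positivity
  have hx0 : 0 ≤ x := by
    rw [hx]
    exact div_nonneg (Finset.sum_nonneg fun i _ ↦ Finset.sum_nonneg fun k _ ↦ sq_nonneg _)
      (Nat.cast_nonneg n)
  have hle : ∀ s : ℝ, 0 ≤ s → gramSum V s / n.factorial ^ 2 ≤
      ∑ j ∈ Finset.range (n + 1), (s * x) ^ j := fun s hs ↦ by
    rw [div_le_iff₀' hfac, hx]
    exact gramSum_le V hV hs
  have hsec : ∀ s : ℝ, 1 ≤ s → s ^ 2 * (gramSum V 1 / n.factorial ^ 2 - 1) ≤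
      gramSum V s / n.factorial ^ 2 - 1 := fun s hs ↦ by
    have h := gramSum_second_order V hV hs
    have e : ∀ t : ℝ, t / n.factorial ^ 2 - 1 = (t - n.factorial ^ 2) / n.factorial ^ 2 :=
      fun t ↦ by rw [sub_div, div_self hfac.ne']
    rw [e, e, ← mul_div_assoc]
    exact div_le_div_of_nonneg_right h hfac.le
  rcases hx0.eq_or_lt with h0 | h0
  · have := hle 1 zero_le_one
    have hz : ∑ j ∈ Finset.range (n + 1), (1 * x) ^ j = 1 := by
      rw [← h0, mul_zero, Finset.sum_range_succ']
      simp
    rw [hz] at this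
    have h3 : 0 ≤ 4 * ∑ l ∈ Finset.Icc 2 n, x ^ l := by positivity
    linarith
  -- For `n = 1` centring forces `V = 0`, against `0 < x`.
  have hn : 2 ≤ n := by
    by_contra hn
    have hn1 : n = 1 := by have := NeZero.ne n; omega
    subst hn1
    have hz : ∀ i k, V i k = 0 := fun i k ↦ by
      have := hV k
      rw [Fin.sum_univ_one] at this
      rwa [Subsingleton.elim i 0]
    rw [hx] at h0
    simp [hz] at h0
  have hsplit : ∑ j ∈ Finset.range (n + 1), x ^ j = 1 + x + ∑ l ∈ Finset.Icc 2 n, x ^ l := by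
    rw [Finset.range_eq_Ico, Finset.sum_eq_sum_Ico_succ_bot (by omega),
      Finset.sum_eq_sum_Ico_succ_bot (by omega)]
    simp only [pow_zero, zero_add, pow_one]
    rw [← add_assoc]
    rfl
  have hx2 : x ^ 2 ≤ ∑ l ∈ Finset.Icc 2 n, x ^ l :=
    Finset.single_le_sum (f := fun l ↦ x ^ l) (fun l _ ↦ by positivity)
      (Finset.mem_Icc.mpr ⟨le_rfl, hn⟩)
  rcases le_or_gt x (1 / 2) with hh | hh
  -- At `s = 1 / (2x)` the geometric sum has ratio `1/2`, so it is at most `2`, and dividing by `s²`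
  -- gives `4x²`.
  · have hs : 1 ≤ 1 / (2 * x) := by
      rw [le_div_iff₀ (by positivity)]; linarith
    have h1 := hsec _ hs
    have h2 := hle (1 / (2 * x)) (by positivity)
    have h3 : 1 / (2 * x) * x = 1 / 2 := by field_simp
    rw [h3] at h2
    have h4 : ∑ j ∈ Finset.range (n + 1), (1 / 2 : ℝ) ^ j ≤ 2 := by
      have := (hasSum_geometric_two).summable.sum_le_tsum (Finset.range (n + 1))
        (fun i _ ↦ by positivity)
      rwa [tsum_geometric_two] at this
    have h5 : (1 / (2 * x)) ^ 2 * (gramSum V 1 / n.factorial ^ 2 - 1) ≤ 1 := by linarith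
    have h6 : gramSum V 1 / n.factorial ^ 2 - 1 ≤ 4 * x ^ 2 := by
      rw [div_pow, one_pow, one_div, inv_mul_le_iff₀ (by positivity)] at h5
      linarith
    linarith
  -- For `x > 1/2` the linear term is absorbed, since `x ≤ 2x²`.
  · have h1 := hle 1 zero_le_one
    rw [one_mul, hsplit] at h1
    nlinarith

end SecondOrder

/-! ### Densities with respect to the mean, and the power bound -/

section DensityFamily

variable {α : Type*} [MeasurableSpace α] {n : ℕ}

/-- The functions `ρ j` are densities with respect to `ν` of probability measures whose average
is `ν`. -/
structure IsDensityFamily (ν : Measure α) (ρ : Fin n → α → ℝ) : Prop where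
  measurable (j : Fin n) : Measurable (ρ j)
  nonneg (j : Fin n) (x : α) : 0 ≤ ρ j x
  sum_eq (x : α) : ∑ j, ρ j x = n
  integral_eq_one (j : Fin n) : ∫ x, ρ j x ∂ν = 1

/-- The density of the coordinates in `S` of the permutation mixture. -/
def mixDensity (ρ : Fin n → α → ℝ) (S : Finset (Fin n)) (x : Fin n → α) : ℝ :=
  (n.factorial : ℝ)⁻¹ * ∑ σ : Equiv.Perm (Fin n), ∏ i ∈ S, ρ (σ i) (x i)

/-- The relative entropy of the coordinates in `S` of the permutation mixture with respect to
the product measure. -/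
def mixEntropy (ν : Measure α) (ρ : Fin n → α → ℝ) (S : Finset (Fin n)) : ℝ :=
  ∫ x, mixDensity ρ S x * Real.log (mixDensity ρ S x) ∂(Measure.pi fun _ : Fin n ↦ ν)

/-- The average `χ²` divergence between the members of the family and their mean. -/
def meanChiSq (ν : Measure α) (ρ : Fin n → α → ℝ) : ℝ :=
  (∑ j, ∫ x, (ρ j x - 1) ^ 2 ∂ν) / n

variable {ν : Measure α} [IsProbabilityMeasure ν] {ρ : Fin n → α → ℝ}

namespace IsDensityFamily

variable (h : IsDensityFamily ν ρ)
include h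

lemma le_card (j : Fin n) (x : α) : ρ j x ≤ n := by
  rw [← h.sum_eq x]
  exact Finset.single_le_sum (f := fun j ↦ ρ j x) (fun j _ ↦ h.nonneg j x) (Finset.mem_univ j)

lemma abs_sub_one_le (j : Fin n) (x : α) : |ρ j x - 1| ≤ n := by
  have h1 := h.le_card j x
  have h2 := h.nonneg j x
  have h3 : (1 : ℝ) ≤ n := by exact_mod_cast j.pos
  rw [abs_le]; constructor <;> linarith

lemma integrable (j : Fin n) : Integrable (ρ j) ν :=
  Integrable.of_bound (h.measurable j).aestronglyMeasurable n
    (Filter.Eventually.of_forall fun x ↦ by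
      rw [Real.norm_of_nonneg (h.nonneg j x)]; exact h.le_card j x)

lemma integrable_sub_one_mul (j k : Fin n) :
    Integrable (fun x ↦ (ρ j x - 1) * (ρ k x - 1)) ν :=
  Integrable.of_bound (((h.measurable j).sub_const 1).mul
    ((h.measurable k).sub_const 1)).aestronglyMeasurable (n * n)
    (Filter.Eventually.of_forall fun x ↦ by
      rw [norm_mul]
      exact mul_le_mul (h.abs_sub_one_le j x) (h.abs_sub_one_le k x) (norm_nonneg _)
        (Nat.cast_nonneg n))

lemma integral_mul (j k : Fin n) :
    ∫ x, ρ j x * ρ k x ∂ν = 1 + ∫ x, (ρ j x - 1) * (ρ k x - 1) ∂ν := by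
  have e : ∀ x, ρ j x * ρ k x = (ρ j x - 1) * (ρ k x - 1) + ((ρ j x + ρ k x) - 1) := fun x ↦ by
    ring
  have h2 : Integrable (fun x ↦ ρ j x + ρ k x) ν := (h.integrable j).add (h.integrable k)
  have h3 : Integrable (fun x ↦ (ρ j x + ρ k x) - 1) ν := h2.sub (integrable_const 1)
  simp_rw [e]
  rw [integral_add (h.integrable_sub_one_mul j k) h3, integral_sub h2 (integrable_const 1),
    integral_add (h.integrable j) (h.integrable k), h.integral_eq_one, h.integral_eq_one]
  simp; ring

lemma prod_le (S : Finset (Fin n)) (σ : Fin n → Fin n) (x : Fin n → α) :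
    ∏ i ∈ S, ρ (σ i) (x i) ≤ n ^ S.card := by
  rw [← Finset.prod_const]
  exact Finset.prod_le_prod (fun _ _ ↦ h.nonneg _ _) fun _ _ ↦ h.le_card _ _

lemma prod_nonneg (S : Finset (Fin n)) (σ : Fin n → Fin n) (x : Fin n → α) :
    0 ≤ ∏ i ∈ S, ρ (σ i) (x i) :=
  Finset.prod_nonneg fun _ _ ↦ h.nonneg _ _

lemma measurable_prod (S : Finset (Fin n)) (σ : Fin n → Fin n) :
    Measurable fun x : Fin n → α ↦ ∏ i ∈ S, ρ (σ i) (x i) :=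
  Finset.measurable_prod _ fun i _ ↦ (h.measurable _).comp (measurable_pi_apply i)

lemma mixDensity_nonneg (S : Finset (Fin n)) (x : Fin n → α) : 0 ≤ mixDensity ρ S x :=
  mul_nonneg (by positivity) (Finset.sum_nonneg fun σ _ ↦ h.prod_nonneg S σ x)

lemma mixDensity_le (S : Finset (Fin n)) (x : Fin n → α) :
    mixDensity ρ S x ≤ n ^ S.card := by
  rw [mixDensity, inv_mul_le_iff₀ (by positivity)]
  calc _ ≤ ∑ _σ : Equiv.Perm (Fin n), (n : ℝ) ^ S.card :=
        Finset.sum_le_sum fun σ _ ↦ h.prod_le S σ x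
    _ = _ := by simp [Fintype.card_perm]

lemma measurable_mixDensity (S : Finset (Fin n)) : Measurable (mixDensity ρ S) :=
  (Finset.measurable_sum _ fun (σ : Equiv.Perm (Fin n)) _ ↦ h.measurable_prod S σ).const_mul _

lemma prod_le_factorial_mul_mixDensity (S : Finset (Fin n)) (σ : Equiv.Perm (Fin n))
    (x : Fin n → α) : ∏ i ∈ S, ρ (σ i) (x i) ≤ n.factorial * mixDensity ρ S x := by
  rw [mixDensity, mul_inv_cancel_left₀ (by positivity)]
  exact Finset.single_le_sum (f := fun σ : Equiv.Perm (Fin n) ↦ ∏ i ∈ S, ρ (σ i) (x i))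
    (fun σ _ ↦ h.prod_nonneg S σ x) (Finset.mem_univ σ)

lemma integrable_comp_mixDensity (S : Finset (Fin n)) {φ : ℝ → ℝ} (hφ : Continuous φ) :
    Integrable (fun x ↦ φ (mixDensity ρ S x)) (Measure.pi fun _ : Fin n ↦ ν) := by
  obtain ⟨C, hC⟩ := isCompact_Icc.exists_bound_of_continuousOn
    (s := Set.Icc (0 : ℝ) (n ^ S.card)) hφ.continuousOn
  exact Integrable.of_bound
    (hφ.measurable.comp (h.measurable_mixDensity S)).aestronglyMeasurable C
    (Filter.Eventually.of_forall fun x ↦ hC _ ⟨h.mixDensity_nonneg S x, h.mixDensity_le S x⟩)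

lemma integrable_prod (S : Finset (Fin n)) (σ : Fin n → Fin n) :
    Integrable (fun x : Fin n → α ↦ ∏ i ∈ S, ρ (σ i) (x i)) (Measure.pi fun _ : Fin n ↦ ν) :=
  Integrable.of_bound (h.measurable_prod S σ).aestronglyMeasurable (n ^ S.card)
    (Filter.Eventually.of_forall fun x ↦ by
      rw [Real.norm_of_nonneg (h.prod_nonneg S σ x)]; exact h.prod_le S σ x)

lemma integral_prod (S : Finset (Fin n)) (σ : Fin n → Fin n) :
    ∫ x : Fin n → α, ∏ i ∈ S, ρ (σ i) (x i) ∂(Measure.pi fun _ : Fin n ↦ ν) = 1 := by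
  have e : ∀ x : Fin n → α, ∏ i ∈ S, ρ (σ i) (x i) =
      ∏ i, (fun i y ↦ if i ∈ S then ρ (σ i) y else 1) i (x i) := fun x ↦ by
    simp [Finset.prod_ite_mem]
  simp_rw [e]
  rw [integral_fintype_prod_eq_prod (fun i y ↦ if i ∈ S then ρ (σ i) y else 1)]
  refine Finset.prod_eq_one fun i _ ↦ ?_
  split_ifs
  · exact h.integral_eq_one _
  · simp

lemma integral_mixDensity (S : Finset (Fin n)) :
    ∫ x, mixDensity ρ S x ∂(Measure.pi fun _ : Fin n ↦ ν) = 1 := by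
  have hi : ∀ σ ∈ (Finset.univ : Finset (Equiv.Perm (Fin n))),
      Integrable (fun x : Fin n → α ↦ ∏ i ∈ S, ρ (σ i) (x i)) (Measure.pi fun _ : Fin n ↦ ν) :=
    fun σ _ ↦ h.integrable_prod S σ
  simp only [mixDensity]
  rw [integral_const_mul, integral_finsetSum _ hi,
    Finset.sum_congr rfl fun (σ : Equiv.Perm (Fin n)) _ ↦ h.integral_prod S σ]
  simp only [Finset.sum_const, Finset.card_univ, Fintype.card_perm, Fintype.card_fin,
    nsmul_eq_mul, mul_one]
  exact inv_mul_cancel₀ (by positivity)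

/-- The Gram matrix of the functions `ρ i - 1` in `L²(ν)` is positive semidefinite, hence factors
through a finite dimension. Its entries sum to `0` because the `ρ i - 1` do, and that total is the
sum of the squared column sums of `V`. -/
lemma exists_gram : ∃ (d : ℕ) (V : Fin n → Fin d → ℝ), (∀ k, ∑ i, V i k = 0) ∧
    ∀ i j, ∫ x, (ρ i x - 1) * (ρ j x - 1) ∂ν = ∑ k, V i k * V j k := by
  let A : Matrix (Fin n) (Fin n) ℝ := Matrix.of fun i j ↦ ∫ x, (ρ i x - 1) * (ρ j x - 1) ∂ν
  have hquad : ∀ c : Fin n → ℝ, ∑ i, c i * ∑ j, A i j * c j =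
      ∫ x, (∑ i, c i * (ρ i x - 1)) ^ 2 ∂ν := fun c ↦ by
    have e : ∀ x, (∑ i, c i * (ρ i x - 1)) ^ 2 =
        ∑ i, ∑ j, (c i * c j) * ((ρ i x - 1) * (ρ j x - 1)) := fun x ↦ by
      rw [sq, Finset.sum_mul_sum]
      exact Finset.sum_congr rfl fun i _ ↦ Finset.sum_congr rfl fun j _ ↦ by ring
    simp_rw [e]
    rw [integral_finsetSum _ fun i _ ↦ integrable_finsetSum _ fun j _ ↦
      (h.integrable_sub_one_mul i j).const_mul _]
    refine Finset.sum_congr rfl fun i _ ↦ ?_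
    rw [integral_finsetSum _ fun j _ ↦ (h.integrable_sub_one_mul i j).const_mul _, Finset.mul_sum]
    refine Finset.sum_congr rfl fun j _ ↦ ?_
    rw [integral_const_mul]
    simp only [A, Matrix.of_apply]; ring
  have hA : A.PosSemidef := by
    rw [Matrix.posSemidef_iff_dotProduct_mulVec]
    refine ⟨?_, fun c ↦ ?_⟩
    · ext i j
      simp [A, mul_comm]
    · have := hquad c
      simp only [dotProduct, Matrix.mulVec, star_trivial]
      rw [this]
      exact integral_nonneg fun x ↦ sq_nonneg _
  obtain ⟨d, v, hv⟩ := Matrix.posSemidef_iff_eq_sum_vecMulVec.mp hA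
  have hv' : ∀ i j, A i j = ∑ k, v k i * v k j := fun i j ↦ by
    rw [hv, Matrix.sum_apply]
    simp [Matrix.vecMulVec_apply]
  refine ⟨d, fun i k ↦ v k i, ?_, hv'⟩
  have h1 := hquad fun _ ↦ 1
  have h2 : ∀ x, ∑ i, 1 * (ρ i x - 1) = 0 := fun x ↦ by
    simp [Finset.sum_sub_distrib, h.sum_eq x]
  simp only [h2] at h1
  have h3 : ∑ k, (∑ i, v k i) ^ 2 = 0 := by
    calc ∑ k, (∑ i, v k i) ^ 2 = ∑ i, 1 * ∑ j, A i j * 1 := by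
          simp_rw [hv', sq, Finset.sum_mul_sum, one_mul, mul_one]
          rw [Finset.sum_comm]
          exact Finset.sum_congr rfl fun i _ ↦ Finset.sum_comm
      _ = 0 := by rw [h1]; simp
  intro k
  have := (Finset.sum_eq_zero_iff_of_nonneg fun k _ ↦ sq_nonneg _).mp h3 k (Finset.mem_univ k)
  exact pow_eq_zero_iff (two_ne_zero) |>.mp this

lemma mixEntropy_le_sub_one (S : Finset (Fin n)) :
    mixEntropy ν ρ S ≤ ∫ x, mixDensity ρ S x ^ 2 ∂(Measure.pi fun _ : Fin n ↦ ν) - 1 := by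
  have h1 : Integrable (mixDensity ρ S) (Measure.pi fun _ : Fin n ↦ ν) :=
    h.integrable_comp_mixDensity S continuous_id
  have h2 := h.integrable_comp_mixDensity S (φ := fun t ↦ t ^ 2) (by fun_prop)
  rw [mixEntropy, ← h.integral_mixDensity S, ← integral_sub h2 h1]
  refine integral_mono (h.integrable_comp_mixDensity S Real.continuous_mul_log)
    (h2.sub h1) fun x ↦ ?_
  simp only
  rcases (h.mixDensity_nonneg S x).eq_or_lt with h0 | h0
  · simp [← h0]
  · have := Real.log_le_sub_one_of_pos h0
    nlinarith

/-- The bound on the relative entropy of a permutation mixture by powers of the average `χ²`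
divergence. -/
theorem mixEntropy_le_sum_pow [NeZero n] :
    mixEntropy ν ρ Finset.univ ≤ 4 * ∑ l ∈ Finset.Icc 2 n, meanChiSq ν ρ ^ l := by
  obtain ⟨d, V, hV, hA⟩ := h.exists_gram
  refine (h.mixEntropy_le_sub_one _).trans ?_
  refine le_trans (le_of_eq ?_) (gramSum_one_le V hV (x := meanChiSq ν ρ) ?_)
  · congr 1
    -- Squaring the mixture gives a sum over pairs of permutations, and each coordinate integrates
    -- to `1` plus a Gram entry: the second moment is `gramSum V 1 / n!²`.
    have e : ∀ x : Fin n → α, mixDensity ρ Finset.univ x ^ 2 =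
        ((n.factorial : ℝ) ^ 2)⁻¹ * ∑ σ : Equiv.Perm (Fin n), ∑ τ : Equiv.Perm (Fin n),
          ∏ i, (fun i y ↦ ρ (σ i) y * ρ (τ i) y) i (x i) := fun x ↦ by
      simp only [mixDensity, mul_pow, inv_pow, Finset.prod_mul_distrib]
      rw [sq (Finset.sum _ _), Finset.sum_mul_sum]
    have hi : ∀ σ τ : Equiv.Perm (Fin n), Integrable (fun x : Fin n → α ↦
        ∏ i, (fun i y ↦ ρ (σ i) y * ρ (τ i) y) i (x i)) (Measure.pi fun _ : Fin n ↦ ν) :=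
      fun σ τ ↦ Integrable.fintype_prod fun i ↦
        (h.integrable (τ i)).bdd_mul (h.measurable (σ i)).aestronglyMeasurable
          (Filter.Eventually.of_forall fun x ↦ by
            rw [Real.norm_of_nonneg (h.nonneg _ x)]; exact h.le_card _ x)
    simp_rw [e]
    rw [integral_const_mul, integral_finsetSum _ fun σ _ ↦ integrable_finsetSum _ fun τ _ ↦ hi σ τ,
      gramSum, inv_mul_eq_div]
    congr 1
    refine Finset.sum_congr rfl fun σ _ ↦ ?_
    rw [integral_finsetSum _ fun τ _ ↦ hi σ τ]
    refine Finset.sum_congr rfl fun τ _ ↦ ?_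
    rw [integral_fintype_prod_eq_prod (fun i y ↦ ρ (σ i) y * ρ (τ i) y)]
    refine Finset.prod_congr rfl fun i _ ↦ ?_
    rw [h.integral_mul, hA, one_mul]
  · rw [meanChiSq]
    congr 1
    refine Finset.sum_congr rfl fun i _ ↦ ?_
    simp_rw [sq]
    exact hA i i

end IsDensityFamily

end DensityFamily

/-! ### Variance identities for sampling without replacement -/

section PermutationSums

variable {n : ℕ}

lemma sum_perm_mul_swap (F : Equiv.Perm (Fin n) → ℝ) (i j : Fin n) :
    ∑ σ, F (σ * Equiv.swap i j) = ∑ σ, F σ :=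
  Equiv.sum_comp (Equiv.mulRight (Equiv.swap i j)) F

/-- Two draws without replacement are negatively correlated, with correlation `-1 / (n - 1)`: the
total over all positions vanishes and all positions other than `i` contribute equally. -/
lemma sum_perm_mul_of_ne (g : Fin n → ℝ) (hg : ∑ j, g j = 0) {i j : Fin n} (hij : i ≠ j) :
    n * ((n - 1) * ∑ σ : Equiv.Perm (Fin n), g (σ i) * g (σ j)) =
      -(n.factorial * ∑ j, g j ^ 2) := by
  have h1 : ∀ l ∈ Finset.univ.erase i, ∑ σ : Equiv.Perm (Fin n), g (σ i) * g (σ l) =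
      ∑ σ : Equiv.Perm (Fin n), g (σ i) * g (σ j) := fun l hl ↦ by
    have hl : l ≠ i := (Finset.mem_erase.mp hl).1
    rw [← sum_perm_mul_swap _ l j]
    refine Finset.sum_congr rfl fun σ _ ↦ ?_
    simp [Equiv.swap_apply_of_ne_of_ne hl.symm hij]
  have h2 : ∑ l, ∑ σ : Equiv.Perm (Fin n), g (σ i) * g (σ l) = 0 := by
    rw [Finset.sum_comm]
    refine Finset.sum_eq_zero fun σ _ ↦ ?_
    rw [← Finset.mul_sum, Equiv.sum_comp σ, hg, mul_zero]
  rw [← Finset.add_sum_erase _ _ (Finset.mem_univ i), Finset.sum_congr rfl h1, Finset.sum_const,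
    Finset.card_erase_of_mem (Finset.mem_univ i), Finset.card_univ, Fintype.card_fin,
    nsmul_eq_mul, Nat.cast_sub (Nat.one_le_iff_ne_zero.mpr (by rintro rfl; exact i.elim0)),
    Nat.cast_one] at h2
  have h3 := sum_perm_apply (fun j ↦ g j ^ 2) i
  simp only [sq] at h3 ⊢
  linear_combination n * h2 - h3

variable {S : Finset (Fin n)} {t : Fin n} (ht : t ∉ S) (g : Fin n → ℝ) (hg : ∑ j, g j = 0)
  (b : Equiv.Perm (Fin n) → ℝ) (hb : ∀ s ∉ S, ∀ σ, b (σ * Equiv.swap s t) = b σ)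
include ht hg hb

/-- By the invariance of `b`, every position outside `S` plays the same role as `t`; since `g` is
centred, the sum over those positions is minus the sum over `S`. -/
lemma sub_card_mul_sum_eq :
    (n - S.card) * ∑ σ, b σ * g (σ t) = -∑ σ, b σ * ∑ i ∈ S, g (σ i) := by
  have h1 : ∀ s ∈ Sᶜ, ∑ σ, b σ * g (σ s) = ∑ σ, b σ * g (σ t) := fun s hs ↦ by
    rw [← sum_perm_mul_swap _ s t]
    refine Finset.sum_congr rfl fun σ _ ↦ ?_
    rw [hb s (Finset.mem_compl.mp hs)]
    simp
  have h2 := Finset.sum_congr rfl h1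
  rw [Finset.sum_const, Finset.card_compl, Fintype.card_fin, nsmul_eq_mul,
    Nat.cast_sub (by simpa using S.card_le_univ)] at h2
  rw [← h2, Finset.sum_comm, ← Finset.sum_neg_distrib]
  refine Finset.sum_congr rfl fun σ _ ↦ ?_
  rw [← Finset.mul_sum, ← mul_neg]
  congr 1
  have h3 := Finset.sum_compl_add_sum S fun i ↦ g (σ i)
  rw [Equiv.sum_comp σ, hg] at h3
  linarith

/-- Cauchy–Schwarz after `sub_card_mul_sum_eq`. The variance of the sum of `g` over `S`, drawn
without replacement, supplies the factor `k (n - k) / (n (n - 1))` with `k = S.card`. -/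
lemma sq_sum_le_mul_sum_sq :
    n * ((n - 1) * (n - S.card)) * (∑ σ, b σ * g (σ t)) ^ 2 ≤
      S.card * (n.factorial * ∑ j, g j ^ 2) * ∑ σ, b σ ^ 2 := by
  have hcard : S.card < n := by
    have := Finset.card_lt_univ_of_notMem ht
    simpa using this
  have hpos : (0 : ℝ) < n - S.card := by
    have : (S.card : ℝ) < n := by exact_mod_cast hcard
    linarith
  have h1 := sub_card_mul_sum_eq ht g hg b hb
  have h2 : (∑ σ, b σ * ∑ i ∈ S, g (σ i)) ^ 2 ≤
      (∑ σ, b σ ^ 2) * ∑ σ : Equiv.Perm (Fin n), (∑ i ∈ S, g (σ i)) ^ 2 :=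
    Finset.sum_mul_sq_le_sq_mul_sq _ _ _
  have h3 : n * ((n - 1) * ∑ σ : Equiv.Perm (Fin n), (∑ i ∈ S, g (σ i)) ^ 2) =
      S.card * (n - S.card) * (n.factorial * ∑ j, g j ^ 2) := by
    have e : ∑ σ : Equiv.Perm (Fin n), (∑ i ∈ S, g (σ i)) ^ 2 =
        ∑ i ∈ S, ∑ j ∈ S, ∑ σ : Equiv.Perm (Fin n), g (σ i) * g (σ j) := by
      simp_rw [sq, Finset.sum_mul_sum]
      rw [Finset.sum_comm]
      exact Finset.sum_congr rfl fun i _ ↦ Finset.sum_comm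
    have e2 : ∀ i ∈ S, n * ((n - 1) * ∑ j ∈ S, ∑ σ : Equiv.Perm (Fin n), g (σ i) * g (σ j)) =
        (n - S.card) * (n.factorial * ∑ j, g j ^ 2) := fun i hi ↦ by
      have h4 := sum_perm_apply (fun j ↦ g j ^ 2) i
      have h5 : n * ((n - 1) * ∑ j ∈ S.erase i, ∑ σ : Equiv.Perm (Fin n), g (σ i) * g (σ j)) =
          -((S.card - 1) * (n.factorial * ∑ j, g j ^ 2)) := by
        rw [Finset.mul_sum, Finset.mul_sum,
          Finset.sum_congr rfl fun j hj ↦ sum_perm_mul_of_ne g hg (Finset.mem_erase.mp hj).1.symm,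
          Finset.sum_const, Finset.card_erase_of_mem hi, nsmul_eq_mul,
          Nat.cast_sub (Finset.card_pos.mpr ⟨i, hi⟩)]
        push_cast
        ring
      rw [← Finset.add_sum_erase _ _ hi]
      simp only [sq] at h4 h5 ⊢
      linear_combination (n - 1) * h4 + h5
    rw [e, Finset.mul_sum, Finset.mul_sum, Finset.sum_congr rfl e2]
    simp [mul_assoc]
  have hn1 : (0 : ℝ) ≤ n - 1 := by
    have : (1 : ℝ) ≤ n := by exact_mod_cast (by omega : 1 ≤ n)
    linarith
  have h5 : (n - S.card : ℝ) * (n * ((n - 1) * (n - S.card)) * (∑ σ, b σ * g (σ t)) ^ 2) ≤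
      (n - S.card) * (S.card * (n.factorial * ∑ j, g j ^ 2) * ∑ σ, b σ ^ 2) := by
    calc _ = n * (n - 1) * ((n - S.card) * ∑ σ, b σ * g (σ t)) ^ 2 := by ring
      _ = n * (n - 1) * (∑ σ, b σ * ∑ i ∈ S, g (σ i)) ^ 2 := by rw [h1, neg_sq]
      _ ≤ n * (n - 1) * ((∑ σ, b σ ^ 2) *
          ∑ σ : Equiv.Perm (Fin n), (∑ i ∈ S, g (σ i)) ^ 2) :=
          mul_le_mul_of_nonneg_left h2 (by positivity)
      _ = (∑ σ, b σ ^ 2) *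
          (n * ((n - 1) * ∑ σ : Equiv.Perm (Fin n), (∑ i ∈ S, g (σ i)) ^ 2)) := by ring
      _ = _ := by rw [h3]; ring
  exact le_of_mul_le_mul_left h5 hpos

/-- Counterpart of `sq_sum_le_mul_sum_sq` with a Dirichlet form in place of the second moment:
antisymmetrizing along the transpositions of `i` and `t` represents `2 n Y` as a pairing of the
increments of `b` with those of `g`, and Cauchy–Schwarz follows. -/
lemma sq_sum_le_mul_sum_sq_sub_swap :
    2 * n * (n * (n - 1)) * (∑ σ, b σ * g (σ t)) ^ 2 ≤
      S.card * (n.factorial * ∑ j, g j ^ 2) *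
        ∑ i ∈ S, ∑ σ, (b σ - b (σ * Equiv.swap i t)) ^ 2 := by
  set Y := ∑ σ, b σ * g (σ t) with hY
  have h1 := sub_card_mul_sum_eq ht g hg b hb
  have h2 : ∑ i ∈ S, ∑ σ, (b σ - b (σ * Equiv.swap i t)) * (g (σ t) - g (σ i)) = 2 * n * Y := by
    have e : ∀ i ∈ S, ∑ σ, (b σ - b (σ * Equiv.swap i t)) * (g (σ t) - g (σ i)) =
        2 * Y - 2 * ∑ σ, b σ * g (σ i) := fun i _ ↦ by
      have e1 : ∑ σ, b (σ * Equiv.swap i t) * (g (σ t) - g (σ i)) =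
          ∑ σ, b σ * (g (σ i) - g (σ t)) := by
        rw [← sum_perm_mul_swap (fun σ ↦ b σ * (g (σ i) - g (σ t))) i t]
        exact Finset.sum_congr rfl fun σ _ ↦ by simp
      simp_rw [sub_mul]
      rw [Finset.sum_sub_distrib, e1]
      simp_rw [mul_sub]
      rw [Finset.sum_sub_distrib, Finset.sum_sub_distrib]
      ring
    rw [Finset.sum_congr rfl e, Finset.sum_sub_distrib, Finset.sum_const, nsmul_eq_mul,
      ← Finset.mul_sum, Finset.sum_comm]
    simp_rw [← Finset.mul_sum]
    linear_combination (-2) * h1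
  have h3 : (∑ i ∈ S, ∑ σ, (b σ - b (σ * Equiv.swap i t)) * (g (σ t) - g (σ i))) ^ 2 ≤
      (∑ i ∈ S, ∑ σ, (b σ - b (σ * Equiv.swap i t)) ^ 2) *
        ∑ i ∈ S, ∑ σ : Equiv.Perm (Fin n), (g (σ t) - g (σ i)) ^ 2 := by
    simp_rw [← Finset.sum_product']
    exact Finset.sum_mul_sq_le_sq_mul_sq _ _ _
  have h4 : n * (n - 1) * ∑ i ∈ S, ∑ σ : Equiv.Perm (Fin n), (g (σ t) - g (σ i)) ^ 2 =
      2 * n * (S.card * (n.factorial * ∑ j, g j ^ 2)) := by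
    rw [Finset.mul_sum]
    have e : ∀ i ∈ S, n * (n - 1) * ∑ σ : Equiv.Perm (Fin n), (g (σ t) - g (σ i)) ^ 2 =
        2 * n * (n.factorial * ∑ j, g j ^ 2) := fun i hi ↦ by
      have hne : i ≠ t := by rintro rfl; exact ht hi
      have e1 := sum_perm_mul_of_ne g hg hne
      have e2 := sum_perm_apply (fun j ↦ g j ^ 2) i
      have e3 := sum_perm_apply (fun j ↦ g j ^ 2) t
      have e4 : ∑ σ : Equiv.Perm (Fin n), (g (σ t) - g (σ i)) ^ 2 =
          ∑ σ : Equiv.Perm (Fin n), g (σ t) ^ 2 + ∑ σ : Equiv.Perm (Fin n), g (σ i) ^ 2 -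
            2 * ∑ σ : Equiv.Perm (Fin n), g (σ i) * g (σ t) := by
        rw [Finset.mul_sum, ← Finset.sum_add_distrib, ← Finset.sum_sub_distrib]
        exact Finset.sum_congr rfl fun σ _ ↦ by ring
      rw [e4]
      linear_combination (n - 1) * e2 + (n - 1) * e3 - 2 * e1
    rw [Finset.sum_congr rfl e, Finset.sum_const, nsmul_eq_mul]
    ring
  rw [h2] at h3
  have hn : 1 ≤ n := Nat.one_le_iff_ne_zero.mpr (by rintro rfl; exact t.elim0)
  have hn0 : (0 : ℝ) < n := by exact_mod_cast hn
  have hn1 : (0 : ℝ) ≤ n - 1 := by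
    have : (1 : ℝ) ≤ n := by exact_mod_cast hn
    linarith
  have h5 := mul_le_mul_of_nonneg_left h3 (mul_nonneg hn0.le hn1)
  refine le_of_mul_le_mul_left (a := 2 * (n : ℝ)) ?_ (by positivity)
  calc _ = n * (n - 1) * (2 * n * Y) ^ 2 := by ring
    _ ≤ _ := h5
    _ = _ := by rw [mul_left_comm, h4]; ring

end PermutationSums

/-! ### Product measures, resampling and Bessel's inequality -/

section ProductMeasures

variable {α : Type*} [MeasurableSpace α] {n : ℕ}

lemma lintegral_pi_prod (ν : Fin n → Measure α) [∀ i, IsProbabilityMeasure (ν i)]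
    (f : Fin n → α → ℝ≥0∞) (hf : ∀ i, Measurable (f i)) :
    ∫⁻ x, ∏ i, f i (x i) ∂(Measure.pi ν) = ∏ i, ∫⁻ y, f i y ∂(ν i) := by
  rw [lintegral_prod_eq_prod_lintegral_of_indepFun Finset.univ
    (fun i (x : Fin n → α) ↦ f i (x i)) (iIndepFun_pi fun i ↦ (hf i).aemeasurable)
    fun i ↦ (hf i).comp (measurable_pi_apply i)]
  exact Finset.prod_congr rfl fun i _ ↦ (measurePreserving_eval ν i).lintegral_comp (hf i)

lemma pi_withDensity (ν : Fin n → Measure α) [∀ i, IsProbabilityMeasure (ν i)]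
    (f : Fin n → α → ℝ≥0∞) (hf : ∀ i, Measurable (f i))
    [∀ i, SigmaFinite ((ν i).withDensity (f i))] :
    Measure.pi (fun i ↦ (ν i).withDensity (f i)) =
      (Measure.pi ν).withDensity fun x ↦ ∏ i, f i (x i) := by
  refine Measure.pi_eq fun s hs ↦ ?_
  rw [withDensity_apply _ (MeasurableSet.univ_pi hs),
    ← lintegral_indicator (MeasurableSet.univ_pi hs)]
  have e : ∀ x : Fin n → α, (Set.univ.pi s).indicator (fun x ↦ ∏ i, f i (x i)) x =
      ∏ i, (s i).indicator (f i) (x i) := fun x ↦ by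
    by_cases hx : x ∈ Set.univ.pi s
    · rw [Set.indicator_of_mem hx]
      exact Finset.prod_congr rfl fun i _ ↦ (Set.indicator_of_mem (hx i (Set.mem_univ i)) _).symm
    · rw [Set.indicator_of_notMem hx]
      simp only [Set.mem_pi, Set.mem_univ, true_imp_iff, not_forall] at hx
      obtain ⟨i, hi⟩ := hx
      exact (Finset.prod_eq_zero (Finset.mem_univ i) (Set.indicator_of_notMem hi _)).symm
  simp_rw [e]
  rw [lintegral_pi_prod ν (fun i ↦ (s i).indicator (f i)) fun i ↦ (hf i).indicator (hs i)]
  exact Finset.prod_congr rfl fun i _ ↦ by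
    rw [lintegral_indicator (hs i), withDensity_apply _ (hs i)]

lemma measurable_update_swap (i : Fin n) :
    Measurable (fun p : α × (Fin n → α) ↦ Function.update p.2 i p.1) := by
  rw [measurable_pi_iff]
  intro j
  by_cases hj : j = i
  · subst hj; simpa using measurable_fst
  · simp only [Function.update_of_ne hj]
    exact (measurable_pi_apply j).comp measurable_snd

/-- Resampling one coordinate of a product measure. -/
lemma measurePreserving_update (μ μ' : Fin n → Measure α) [∀ i, IsProbabilityMeasure (μ i)]
    [∀ i, IsProbabilityMeasure (μ' i)] (i : Fin n) (h : ∀ j, j ≠ i → μ j = μ' j) :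
    MeasurePreserving (fun p : α × (Fin n → α) ↦ Function.update p.2 i p.1)
      ((μ' i).prod (Measure.pi μ)) (Measure.pi μ') := by
  have hm := measurable_update_swap (α := α) i
  refine ⟨hm, (Measure.pi_eq fun s hs ↦ ?_).symm⟩
  rw [Measure.map_apply hm (MeasurableSet.univ_pi hs)]
  have e : (fun p : α × (Fin n → α) ↦ Function.update p.2 i p.1) ⁻¹' (Set.univ.pi s) =
      s i ×ˢ (Set.univ.pi (Function.update s i Set.univ)) := by
    ext p
    simp only [Set.mem_preimage, Set.mem_pi, Set.mem_univ, true_imp_iff, Set.mem_prod]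
    constructor
    · intro hp
      refine ⟨by simpa using hp i, fun j ↦ ?_⟩
      by_cases hj : j = i
      · subst hj; simp
      · simpa [Function.update_of_ne hj] using hp j
    · rintro ⟨h1, h2⟩ j
      by_cases hj : j = i
      · subst hj; simpa using h1
      · simpa [Function.update_of_ne hj] using h2 j
  rw [e, Measure.prod_prod, Measure.pi_pi, ← Finset.mul_prod_erase _ _ (Finset.mem_univ i),
    ← Finset.mul_prod_erase (a := i) Finset.univ (fun j ↦ μ' j (s j)) (Finset.mem_univ i)]
  simp only [Function.update_self, measure_univ, one_mul]
  congr 1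
  refine Finset.prod_congr rfl fun j hj ↦ ?_
  have hj := (Finset.mem_erase.mp hj).1
  rw [Function.update_of_ne hj, h j hj]

variable {F : (Fin n → α) → ℝ} {C : ℝ}

lemma integrable_of_abs_le {β : Type*} [MeasurableSpace β] {m : Measure β} [IsFiniteMeasure m]
    {F : β → ℝ} (hF : Measurable F) (hC : ∀ x, |F x| ≤ C) : Integrable F m :=
  Integrable.of_bound hF.aestronglyMeasurable C (Filter.Eventually.of_forall hC)

lemma abs_integral_le_of_abs_le {β : Type*} [MeasurableSpace β] {m : Measure β}
    [IsProbabilityMeasure m] {F : β → ℝ} (hC : ∀ x, |F x| ≤ C) : |∫ x, F x ∂m| ≤ C := by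
  simpa using norm_integral_le_of_norm_le_const (μ := m) (f := F) (Filter.Eventually.of_forall hC)

lemma integral_update (μ μ' : Fin n → Measure α) [∀ i, IsProbabilityMeasure (μ i)]
    [∀ i, IsProbabilityMeasure (μ' i)] (i : Fin n) (h : ∀ j, j ≠ i → μ j = μ' j)
    (hF : Measurable F) (hC : ∀ x, |F x| ≤ C) :
    ∫ x, F x ∂(Measure.pi μ') = ∫ y, ∫ x, F (Function.update x i y) ∂(Measure.pi μ) ∂(μ' i) := by
  have hmp := measurePreserving_update μ μ' i h
  rw [← hmp.map_eq, integral_map hmp.measurable.aemeasurable hF.aestronglyMeasurable,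
    integral_prod]
  exact integrable_of_abs_le (hF.comp hmp.measurable) fun p ↦ hC _

/-- The conditional expectation of `F` given the coordinate `i`, under a product measure. -/
def coordMean (μ : Fin n → Measure α) (F : (Fin n → α) → ℝ) (i : Fin n) (y : α) : ℝ :=
  ∫ x, F (Function.update x i y) ∂(Measure.pi μ)

lemma measurable_coordMean (μ : Fin n → Measure α) [∀ i, IsProbabilityMeasure (μ i)]
    (hF : Measurable F) (i : Fin n) : Measurable (coordMean μ F i) :=
  ((hF.comp (measurable_update_swap i)).stronglyMeasurable.integral_prod_right').measurable

lemma abs_coordMean_le (μ : Fin n → Measure α) [∀ i, IsProbabilityMeasure (μ i)]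
    (hC : ∀ x, |F x| ≤ C) (i : Fin n) (y : α) : |coordMean μ F i y| ≤ C :=
  abs_integral_le_of_abs_le fun _ ↦ hC _

/-- Fixing coordinate `i` makes its law irrelevant. Hence two arrangements that differ only at `i`
share the same conditional mean function. -/
lemma coordMean_congr (μ μ' : Fin n → Measure α) [∀ i, IsProbabilityMeasure (μ i)]
    [∀ i, IsProbabilityMeasure (μ' i)] (i : Fin n) (h : ∀ j, j ≠ i → μ j = μ' j)
    (hF : Measurable F) (hC : ∀ x, |F x| ≤ C) : coordMean μ' F i = coordMean μ F i := by
  funext y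
  rw [coordMean, integral_update μ μ' i h (F := fun x ↦ F (Function.update x i y))
    (hF.comp (measurable_update_left)) (C := C) fun _ ↦ hC _]
  simp [coordMean]

/-- **Bessel's inequality** for the first-order Hoeffding projections under a product measure. -/
lemma sum_integral_coordMean_sub_sq_le (μ : Fin n → Measure α)
    [∀ i, IsProbabilityMeasure (μ i)] (hF : Measurable F) (hC : ∀ x, |F x| ≤ C)
    (S : Finset (Fin n)) :
    ∑ i ∈ S, ∫ y, (coordMean μ F i y - ∫ x, F x ∂(Measure.pi μ)) ^ 2 ∂(μ i) ≤
      ∫ x, (F x - ∫ x, F x ∂(Measure.pi μ)) ^ 2 ∂(Measure.pi μ) := by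
  set b := ∫ x, F x ∂(Measure.pi μ) with hb
  have hbC : |b| ≤ C := abs_integral_le_of_abs_le hC
  set v : Fin n → α → ℝ := fun i y ↦ coordMean μ F i y - b with hv
  have hvm : ∀ i, Measurable (v i) := fun i ↦ (measurable_coordMean μ hF i).sub_const b
  have hvC : ∀ i y, |v i y| ≤ C + C := fun i y ↦
    (abs_sub _ _).trans (add_le_add (abs_coordMean_le μ hC i y) hbC)
  have hvm' : ∀ i, Measurable fun x : Fin n → α ↦ v i (x i) := fun i ↦
    (hvm i).comp (measurable_pi_apply i)
  have hGm : Measurable fun x ↦ F x - b := hF.sub_const b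
  have hGC : ∀ x, |F x - b| ≤ C + C := fun x ↦ (abs_sub _ _).trans (add_le_add (hC x) hbC)
  have hmulC : ∀ {s t : ℝ}, |s| ≤ C + C → |t| ≤ C + C → |s * t| ≤ (C + C) * (C + C) :=
    fun hs ht ↦ by
      rw [abs_mul]
      exact mul_le_mul hs ht (abs_nonneg _) ((abs_nonneg _).trans hs)
  have hv0 : ∀ i, ∫ y, v i y ∂(μ i) = 0 := fun i ↦ by
    have := integral_update μ μ i (fun _ _ ↦ rfl) hF hC
    simp only [hv]
    rw [integral_sub (integrable_of_abs_le (measurable_coordMean μ hF i)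
      (abs_coordMean_le μ hC i)) (integrable_const b)]
    simp only [coordMean, ← this]
    simp [hb]
  have hGv : ∀ i, ∫ x, (F x - b) * v i (x i) ∂(Measure.pi μ) = ∫ y, v i y ^ 2 ∂(μ i) := fun i ↦ by
    rw [integral_update μ μ i (fun _ _ ↦ rfl)
      (F := fun x ↦ (F x - b) * v i (x i)) (hGm.mul (hvm' i)) fun x ↦ hmulC (hGC x) (hvC i _)]
    refine integral_congr_ae (Filter.Eventually.of_forall fun y ↦ ?_)
    simp only [Function.update_self]
    have hi : Integrable (fun x ↦ F (Function.update x i y)) (Measure.pi μ) :=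
      integrable_of_abs_le (hF.comp measurable_update_left) fun _ ↦ hC _
    rw [integral_mul_const, integral_sub hi (integrable_const b)]
    simp [hv, coordMean, sq]
  have hvv : ∀ i j, ∫ x, v i (x i) * v j (x j) ∂(Measure.pi μ) =
      if i = j then ∫ y, v i y ^ 2 ∂(μ i) else 0 := fun i j ↦ by
    rw [integral_update μ μ i (fun _ _ ↦ rfl)
      (F := fun x ↦ v i (x i) * v j (x j)) ((hvm' i).mul (hvm' j))
      fun x ↦ hmulC (hvC i _) (hvC j _)]
    split_ifs with hij
    · subst hij
      simp [sq]
    · simp only [Function.update_self, Function.update_of_ne (Ne.symm hij)]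
      simp_rw [integral_const_mul]
      rw [integral_mul_const, hv0, zero_mul]
  have hi1 : Integrable (fun x ↦ (F x - b) ^ 2) (Measure.pi μ) := by
    simp_rw [sq]
    exact integrable_of_abs_le (hGm.mul hGm) fun x ↦ hmulC (hGC x) (hGC x)
  have hi2 : ∀ i, Integrable (fun x ↦ (F x - b) * v i (x i)) (Measure.pi μ) := fun i ↦
    integrable_of_abs_le (hGm.mul (hvm' i)) fun x ↦ hmulC (hGC x) (hvC i _)
  have hi3 : ∀ i j, Integrable (fun x : Fin n → α ↦ v i (x i) * v j (x j)) (Measure.pi μ) :=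
    fun i j ↦ integrable_of_abs_le ((hvm' i).mul (hvm' j)) fun x ↦ hmulC (hvC i _) (hvC j _)
  -- The functions `v i (x i)` are centred and mutually orthogonal, and `v i` is the projection of
  -- `F - b`. Expanding the squared residual gives Bessel's inequality.
  have h0 : 0 ≤ ∫ x, (F x - b - ∑ i ∈ S, v i (x i)) ^ 2 ∂(Measure.pi μ) :=
    integral_nonneg fun x ↦ sq_nonneg _
  have e : ∀ x : Fin n → α, (F x - b - ∑ i ∈ S, v i (x i)) ^ 2 =
      (F x - b) ^ 2 - 2 * ∑ i ∈ S, (F x - b) * v i (x i) +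
        ∑ i ∈ S, ∑ j ∈ S, v i (x i) * v j (x j) := fun x ↦ by
    rw [← Finset.sum_mul_sum, ← Finset.mul_sum]; ring
  have hi2' : Integrable (fun x ↦ 2 * ∑ i ∈ S, (F x - b) * v i (x i)) (Measure.pi μ) :=
    (integrable_finsetSum _ fun i _ ↦ hi2 i).const_mul 2
  have hi3' : Integrable (fun x : Fin n → α ↦ ∑ i ∈ S, ∑ j ∈ S, v i (x i) * v j (x j))
      (Measure.pi μ) := integrable_finsetSum _ fun i _ ↦ integrable_finsetSum _ fun j _ ↦ hi3 i j
  have hi12 : Integrable (fun x ↦ (F x - b) ^ 2 - 2 * ∑ i ∈ S, (F x - b) * v i (x i))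
      (Measure.pi μ) := hi1.sub hi2'
  simp_rw [e] at h0
  rw [integral_add hi12 hi3', integral_sub hi1 hi2', integral_const_mul,
    integral_finsetSum _ fun i _ ↦ hi2 i,
    integral_finsetSum _ fun i _ ↦ integrable_finsetSum _ fun j _ ↦ hi3 i j,
    Finset.sum_congr rfl fun i _ ↦ hGv i,
    Finset.sum_congr rfl fun i _ ↦ (integral_finsetSum S fun j _ ↦ hi3 i j)] at h0
  simp_rw [hvv] at h0
  have e2 : ∑ i ∈ S, ∑ j ∈ S, (if i = j then ∫ y, v i y ^ 2 ∂(μ i) else 0) =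
      ∑ i ∈ S, ∫ y, v i y ^ 2 ∂(μ i) := Finset.sum_congr rfl fun i hi ↦ by simp [hi]
  rw [e2] at h0
  change ∑ i ∈ S, ∫ y, v i y ^ 2 ∂(μ i) ≤ _
  linarith

end ProductMeasures

/-! ### Second moment of the posterior mean -/

section EntropyIncrement

variable {α : Type*} [MeasurableSpace α] {n : ℕ}

/-- The probability measure with density `ρ j`. -/
def memberLaw (ν : Measure α) (ρ : Fin n → α → ℝ) (j : Fin n) : Measure α :=
  ν.withDensity fun y ↦ ENNReal.ofReal (ρ j y)

/-- The `i`-th factor of the product law in which the coordinates in `S` are distributed according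
to the arrangement `σ` of the family and the other ones according to the mean. -/
def coordLaw (ν : Measure α) (ρ : Fin n → α → ℝ) (S : Finset (Fin n)) (σ : Fin n → Fin n)
    (i : Fin n) : Measure α :=
  if i ∈ S then memberLaw ν ρ (σ i) else ν

/-- The posterior mean of `g (σ t)` given the coordinates in `S`. -/
def posteriorMean (ρ : Fin n → α → ℝ) (S : Finset (Fin n)) (t : Fin n) (g : Fin n → ℝ)
    (x : Fin n → α) : ℝ :=
  (∑ σ : Equiv.Perm (Fin n), g (σ t) * ∏ i ∈ S, ρ (σ i) (x i)) /
    ∑ σ : Equiv.Perm (Fin n), ∏ i ∈ S, ρ (σ i) (x i)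

/-- The difference of the means of a bounded function under two members of the family is controlled
by its variances under these members. -/
def HasVarianceBound (ν : Measure α) (ρ : Fin n → α → ℝ) (L : ℝ) : Prop :=
  ∀ (j k : Fin n) (u : α → ℝ) (C : ℝ), Measurable u → (∀ y, |u y| ≤ C) →
    (∫ y, u y ∂(memberLaw ν ρ j) - ∫ y, u y ∂(memberLaw ν ρ k)) ^ 2 ≤
      L * (∫ y, (u y - ∫ z, u z ∂(memberLaw ν ρ j)) ^ 2 ∂(memberLaw ν ρ j) +
        ∫ y, (u y - ∫ z, u z ∂(memberLaw ν ρ k)) ^ 2 ∂(memberLaw ν ρ k))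

variable {ν : Measure α} [IsProbabilityMeasure ν] {ρ : Fin n → α → ℝ}

namespace IsDensityFamily

variable (h : IsDensityFamily ν ρ)
include h

lemma isProbabilityMeasure_memberLaw (j : Fin n) : IsProbabilityMeasure (memberLaw ν ρ j) := by
  constructor
  rw [memberLaw, withDensity_apply _ MeasurableSet.univ, Measure.restrict_univ,
    ← ofReal_integral_eq_lintegral_ofReal (h.integrable j)
      (Filter.Eventually.of_forall (h.nonneg j)), h.integral_eq_one, ENNReal.ofReal_one]

lemma isProbabilityMeasure_coordLaw (S : Finset (Fin n)) (σ : Fin n → Fin n) (i : Fin n) :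
    IsProbabilityMeasure (coordLaw ν ρ S σ i) := by
  unfold coordLaw
  split_ifs
  · exact h.isProbabilityMeasure_memberLaw _
  · infer_instance

lemma pi_coordLaw (S : Finset (Fin n)) (σ : Fin n → Fin n) :
    Measure.pi (coordLaw ν ρ S σ) = (Measure.pi fun _ : Fin n ↦ ν).withDensity
      fun x ↦ ENNReal.ofReal (∏ i ∈ S, ρ (σ i) (x i)) := by
  have := h.isProbabilityMeasure_coordLaw S σ
  have e : coordLaw ν ρ S σ = fun i ↦ ν.withDensity
      ((fun i y ↦ if i ∈ S then ENNReal.ofReal (ρ (σ i) y) else 1) i) := by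
    funext i
    simp only [coordLaw, memberLaw]
    split_ifs
    · rfl
    · exact withDensity_one.symm
  have hprob : ∀ i, IsProbabilityMeasure (ν.withDensity
      ((fun i y ↦ if i ∈ S then ENNReal.ofReal (ρ (σ i) y) else 1) i)) := fun i ↦ by
    rw [← congrFun e i]; infer_instance
  rw [e, pi_withDensity (fun _ ↦ ν) _ fun i ↦ ?_]
  · congr 1
    funext x
    rw [ENNReal.ofReal_prod_of_nonneg fun i _ ↦ h.nonneg _ _]
    simp [Finset.prod_ite_mem]
  · split_ifs
    · exact (h.measurable _).ennreal_ofReal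
    · exact measurable_const

lemma integral_coordLaw (S : Finset (Fin n)) (σ : Fin n → Fin n) (F : (Fin n → α) → ℝ) :
    ∫ x, F x ∂(Measure.pi (coordLaw ν ρ S σ)) =
      ∫ x, F x * ∏ i ∈ S, ρ (σ i) (x i) ∂(Measure.pi fun _ : Fin n ↦ ν) := by
  rw [h.pi_coordLaw, integral_withDensity_eq_integral_toReal_smul
    (h.measurable_prod S σ).ennreal_ofReal (by simp)]
  refine integral_congr_ae (Filter.Eventually.of_forall fun x ↦ ?_)
  simp only [smul_eq_mul]
  rw [ENNReal.toReal_ofReal (h.prod_nonneg S σ x), mul_comm]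

section Posterior

variable (S : Finset (Fin n)) (t : Fin n) (g : Fin n → ℝ)

/-- When the denominator is zero, division returns `0`; the identity survives because nonnegative
terms with zero sum vanish individually, so the right-hand side is zero too. -/
lemma posteriorMean_mul_sum (x : Fin n → α) :
    posteriorMean ρ S t g x * ∑ σ : Equiv.Perm (Fin n), ∏ i ∈ S, ρ (σ i) (x i) =
      ∑ σ : Equiv.Perm (Fin n), g (σ t) * ∏ i ∈ S, ρ (σ i) (x i) := by
  by_cases h0 : ∑ σ : Equiv.Perm (Fin n), ∏ i ∈ S, ρ (σ i) (x i) = 0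
  · rw [h0, mul_zero]
    have h1 := (Finset.sum_eq_zero_iff_of_nonneg
      fun (σ : Equiv.Perm (Fin n)) _ ↦ h.prod_nonneg S σ x).mp h0
    exact (Finset.sum_eq_zero fun σ hσ ↦ by rw [h1 σ hσ, mul_zero]).symm
  · exact div_mul_cancel₀ _ h0

lemma posteriorMean_mul_mixDensity (x : Fin n → α) :
    posteriorMean ρ S t g x * mixDensity ρ S x =
      (n.factorial : ℝ)⁻¹ * ∑ σ : Equiv.Perm (Fin n), g (σ t) * ∏ i ∈ S, ρ (σ i) (x i) := by
  rw [mixDensity, mul_left_comm, h.posteriorMean_mul_sum]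

lemma measurable_posteriorMean : Measurable (posteriorMean ρ S t g) :=
  (Finset.measurable_sum _ fun (σ : Equiv.Perm (Fin n)) _ ↦
    (h.measurable_prod S σ).const_mul _).div
      (Finset.measurable_sum _ fun (σ : Equiv.Perm (Fin n)) _ ↦ h.measurable_prod S σ)

lemma abs_posteriorMean_le {C : ℝ} (hC : ∀ j, |g j| ≤ C) (x : Fin n → α) :
    |posteriorMean ρ S t g x| ≤ C := by
  have h0 : 0 ≤ ∑ σ : Equiv.Perm (Fin n), ∏ i ∈ S, ρ (σ i) (x i) :=
    Finset.sum_nonneg fun σ _ ↦ h.prod_nonneg S σ x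
  rw [posteriorMean, abs_div, abs_of_nonneg h0]
  refine div_le_of_le_mul₀ h0 ((abs_nonneg _).trans (hC t)) ?_
  rw [Finset.mul_sum]
  refine (Finset.abs_sum_le_sum_abs _ _).trans (Finset.sum_le_sum fun σ _ ↦ ?_)
  rw [abs_mul, abs_of_nonneg (h.prod_nonneg S σ x)]
  exact mul_le_mul_of_nonneg_right (hC _) (h.prod_nonneg S σ x)

/-- The second moment of the posterior mean of a centred function of a further index. -/
theorem integral_posteriorMean_sq_le {S t} (ht : t ∉ S) {g} (hg : ∑ j, g j = 0) {L : ℝ}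
    (hL : 0 < L) (hvar : HasVarianceBound ν ρ L) :
    n * (n - S.card + n / L) *
      ∫ x, posteriorMean ρ S t g x ^ 2 * mixDensity ρ S x ∂(Measure.pi fun _ : Fin n ↦ ν) ≤
      ∑ j, g j ^ 2 := by
  set f := posteriorMean ρ S t g with hf
  have hfm : Measurable f := h.measurable_posteriorMean S t g
  obtain ⟨C, hC⟩ : ∃ C, ∀ j, |g j| ≤ C :=
    ⟨∑ j, |g j|, fun j ↦ Finset.single_le_sum (f := fun j ↦ |g j|) (fun _ _ ↦ abs_nonneg _)
      (Finset.mem_univ j)⟩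
  have hfC : ∀ x, |f x| ≤ C := h.abs_posteriorMean_le S t g hC
  have hprob := fun σ : Equiv.Perm (Fin n) ↦ h.isProbabilityMeasure_coordLaw S σ
  have hPprob := h.isProbabilityMeasure_memberLaw
  let M : Equiv.Perm (Fin n) → Fin n → Measure α := fun σ ↦ coordLaw ν ρ S σ
  let b : Equiv.Perm (Fin n) → ℝ := fun σ ↦ ∫ x, f x ∂(Measure.pi (M σ))
  set H := ∑ σ : Equiv.Perm (Fin n), ∫ x, f x ^ 2 ∂(Measure.pi (M σ)) with hH
  have hfac : (0 : ℝ) < n.factorial := by positivity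
  have hwi : ∀ (σ : Equiv.Perm (Fin n)) (F : (Fin n → α) → ℝ) (C : ℝ), Measurable F →
      (∀ x, |F x| ≤ C) → Integrable (fun x ↦ F x * ∏ i ∈ S, ρ (σ i) (x i))
        (Measure.pi fun _ : Fin n ↦ ν) := fun σ F C hF hFC ↦
    (h.integrable_prod S σ).bdd_mul hF.aestronglyMeasurable (c := C)
      (Filter.Eventually.of_forall hFC)
  have hf2C : ∀ x, |f x ^ 2| ≤ C ^ 2 := fun x ↦ by
    rw [abs_pow]; exact pow_le_pow_left₀ (abs_nonneg _) (hfC x) 2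
  have hH1 : H = n.factorial *
      ∫ x, f x ^ 2 * mixDensity ρ S x ∂(Measure.pi fun _ : Fin n ↦ ν) := by
    rw [hH]
    simp_rw [M, h.integral_coordLaw]
    rw [← integral_finsetSum _ fun σ _ ↦ hwi σ _ _ (hfm.pow_const 2) hf2C, ← integral_const_mul]
    refine integral_congr_ae (Filter.Eventually.of_forall fun x ↦ ?_)
    simp only [mixDensity, ← Finset.mul_sum]
    field_simp
  -- The tower property: pairing the posterior mean `f` with `g (σ t)` gives the same result as
  -- pairing it with itself. This makes `H` accessible to both Cauchy–Schwarz bounds.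
  have hH2 : ∑ σ, b σ * g (σ t) = H := by
    rw [hH]
    simp_rw [b, M, h.integral_coordLaw, ← integral_mul_const]
    rw [← integral_finsetSum _ fun σ _ ↦ (hwi σ _ _ hfm hfC).mul_const _,
      ← integral_finsetSum _ fun σ _ ↦ hwi σ _ _ (hfm.pow_const 2) hf2C]
    refine integral_congr_ae (Filter.Eventually.of_forall fun x ↦ ?_)
    simp only [← Finset.mul_sum]
    rw [sq, mul_assoc, h.posteriorMean_mul_sum, Finset.mul_sum]
    exact Finset.sum_congr rfl fun σ _ ↦ by ring
  have hswap : ∀ i ∈ S, ∀ (σ : Equiv.Perm (Fin n)) (j : Fin n), j ≠ i →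
      M σ j = M (σ * Equiv.swap i t) j := fun i hi σ j hj ↦ by
    simp only [M, coordLaw]
    split_ifs with hjS
    · have hjt : j ≠ t := by rintro rfl; exact ht hjS
      simp [Equiv.swap_apply_of_ne_of_ne hj hjt]
    · rfl
  have hb : ∀ s ∉ S, ∀ σ, b (σ * Equiv.swap s t) = b σ := fun s hs σ ↦ by
    have : M (σ * Equiv.swap s t) = M σ := by
      funext j
      simp only [M, coordLaw]
      split_ifs with hjS
      · have hjt : j ≠ t := by rintro rfl; exact ht hjS
        have hjs : j ≠ s := by rintro rfl; exact hs hjS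
        simp [Equiv.swap_apply_of_ne_of_ne hjs hjt]
      · rfl
    simp only [b, this]
  have hMi : ∀ i ∈ S, ∀ σ : Equiv.Perm (Fin n), M σ i = memberLaw ν ρ (σ i) := fun i hi σ ↦ by
    simp [M, coordLaw, hi]
  have hMi' : ∀ i ∈ S, ∀ σ : Equiv.Perm (Fin n),
      M (σ * Equiv.swap i t) i = memberLaw ν ρ (σ t) := fun i hi σ ↦ by
    rw [hMi i hi]; simp
  let W : Fin n → Equiv.Perm (Fin n) → ℝ := fun i σ ↦
    ∫ y, (coordMean (M σ) f i y - b σ) ^ 2 ∂(M σ i)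
  have hbm : ∀ i σ, b σ = ∫ y, coordMean (M σ) f i y ∂(M σ i) := fun i σ ↦
    integral_update (M σ) (M σ) i (fun _ _ ↦ rfl) hfm hfC
  -- The swap of `i` and `t` changes the product law only at coordinate `i`, as `t ∉ S`. So both
  -- values of `b` are means of one function, under two members of the family, and `hvar` applies.
  have hWpair : ∀ i ∈ S, ∀ σ : Equiv.Perm (Fin n),
      (b σ - b (σ * Equiv.swap i t)) ^ 2 ≤ L * (W i σ + W i (σ * Equiv.swap i t)) :=
    fun i hi σ ↦ by
      have hc := coordMean_congr (M σ) (M (σ * Equiv.swap i t)) i (hswap i hi σ) hfm hfC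
      have h1 := hbm i σ
      have h2 := hbm i (σ * Equiv.swap i t)
      have h3 := hvar (σ i) (σ t) (coordMean (M σ) f i) C (measurable_coordMean _ hfm i)
        (abs_coordMean_le _ hfC i)
      rw [hMi i hi] at h1
      rw [hc, hMi' i hi] at h2
      simp only [W]
      rw [hc, hMi i hi, hMi' i hi, h1, h2]
      exact h3
  have hWsum : ∀ i ∈ S, ∑ σ, (b σ - b (σ * Equiv.swap i t)) ^ 2 ≤ 2 * L * ∑ σ, W i σ :=
    fun i hi ↦ by
      calc _ ≤ ∑ σ, L * (W i σ + W i (σ * Equiv.swap i t)) :=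
            Finset.sum_le_sum fun σ _ ↦ hWpair i hi σ
        _ = _ := by
            rw [← Finset.mul_sum, Finset.sum_add_distrib, sum_perm_mul_swap]; ring
  -- The second moment of `f` dominates its squared mean plus the variances of its first-order
  -- projections. Thus the quantities in the two Cauchy–Schwarz bounds share a single budget `H`.
  have hBessel : ∑ σ, b σ ^ 2 + ∑ i ∈ S, ∑ σ, W i σ ≤ H := by
    rw [hH, Finset.sum_comm, ← Finset.sum_add_distrib]
    refine Finset.sum_le_sum fun σ _ ↦ ?_
    have h1 := sum_integral_coordMean_sub_sq_le (M σ) hfm hfC S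
    have hi : Integrable f (Measure.pi (M σ)) := integrable_of_abs_le hfm hfC
    have hi2 : Integrable (fun x ↦ f x ^ 2) (Measure.pi (M σ)) :=
      integrable_of_abs_le (hfm.pow_const 2) hf2C
    have h2 : ∫ x, (f x - b σ) ^ 2 ∂(Measure.pi (M σ)) =
        ∫ x, f x ^ 2 ∂(Measure.pi (M σ)) - b σ ^ 2 := by
      have e : ∀ x, (f x - b σ) ^ 2 = f x ^ 2 - (2 * b σ * f x - b σ ^ 2) := fun x ↦ by ring
      have hi3 : Integrable (fun x ↦ 2 * b σ * f x) (Measure.pi (M σ)) := hi.const_mul _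
      have hi4 : Integrable (fun x ↦ 2 * b σ * f x - b σ ^ 2) (Measure.pi (M σ)) :=
        hi3.sub (integrable_const _)
      simp_rw [e]
      rw [integral_sub hi2 hi4, integral_sub hi3 (integrable_const _), integral_const_mul]
      simp only [b, integral_const, probReal_univ, one_smul]
      ring
    change ∑ i ∈ S, W i σ ≤ ∫ x, (f x - b σ) ^ 2 ∂(Measure.pi (M σ)) at h1
    linarith
  set k : ℝ := (S.card : ℝ) with hk
  set G := ∑ j, g j ^ 2 with hG
  have hG0 : 0 ≤ G := Finset.sum_nonneg fun j _ ↦ sq_nonneg _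
  have hL1 := sq_sum_le_mul_sum_sq ht g hg b hb
  have hL2 := sq_sum_le_mul_sum_sq_sub_swap ht g hg b hb
  rw [hH2] at hL1 hL2
  have hD : ∑ i ∈ S, ∑ σ, (b σ - b (σ * Equiv.swap i t)) ^ 2 ≤
      2 * L * ∑ i ∈ S, ∑ σ, W i σ := by
    rw [Finset.mul_sum]
    exact Finset.sum_le_sum hWsum
  have hcard : S.card < n := by simpa using Finset.card_lt_univ_of_notMem ht
  have hkn : k + 1 ≤ n := by rw [hk]; exact_mod_cast hcard
  have hk0 : 0 ≤ k := Nat.cast_nonneg _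
  have hn0 : (0 : ℝ) < n := by linarith
  -- The bounds control `H²`, and dividing by `H` requires `H > 0`. The division by `n - 1` requires
  -- `n ≥ 2`; for `n = 1`, centring gives `g = 0`.
  have hmain : H ≤ 0 ∨ n * (n - k + n / L) * H ≤ n.factorial * G := by
    rcases le_or_gt H 0 with h0 | h0
    · exact Or.inl h0
    right
    have hn2 : 2 ≤ n := by
      by_contra hn2
      have hn1 : n = 1 := by omega
      subst hn1
      have : g 0 = 0 := by simpa using hg
      have hz : H = 0 := by
        rw [← hH2]
        refine Finset.sum_eq_zero fun σ _ ↦ ?_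
        rw [Subsingleton.elim (σ t) 0, this, mul_zero]
      linarith
    have hn2' : (2 : ℝ) ≤ n := by exact_mod_cast hn2
    have hkG : 0 ≤ k * (n.factorial * G) := by positivity
    have s1 : 2 * n * (n * (n - 1)) * H ^ 2 ≤
        2 * L * (k * (n.factorial * G) * ∑ i ∈ S, ∑ σ, W i σ) := by
      refine hL2.trans ((mul_le_mul_of_nonneg_left hD hkG).trans_eq (by ring))
    have s2 : n / L * (n * (n - 1)) * H ^ 2 ≤
        k * (n.factorial * G) * ∑ i ∈ S, ∑ σ, W i σ := by
      have : n / L * (n * (n - 1)) * H ^ 2 = (2 * n * (n * (n - 1)) * H ^ 2) / (2 * L) := by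
        field_simp
      rw [this, div_le_iff₀ (by positivity)]
      linarith
    -- The coefficients of the two bounds add up to `n - k + n / L`, while their right-hand sides
    -- add up to at most a multiple of `H`.
    have s3 : n * (n - 1) * (n - k + n / L) * H ^ 2 ≤ k * (n.factorial * G) * H := by
      calc _ = n * ((n - 1) * (n - k)) * H ^ 2 + n / L * (n * (n - 1)) * H ^ 2 := by ring
        _ ≤ k * (n.factorial * G) * ∑ σ, b σ ^ 2 +
            k * (n.factorial * G) * ∑ i ∈ S, ∑ σ, W i σ := add_le_add hL1 s2
        _ = k * (n.factorial * G) * (∑ σ, b σ ^ 2 + ∑ i ∈ S, ∑ σ, W i σ) := by ring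
        _ ≤ _ := mul_le_mul_of_nonneg_left hBessel hkG
    have s4 : (n - 1) * (n * (n - k + n / L) * H) ≤ k * (n.factorial * G) := by
      refine le_of_mul_le_mul_right (a := H) ?_ h0
      linarith [s3]
    have s5 : k * (n.factorial * G) ≤ (n - 1) * (n.factorial * G) :=
      mul_le_mul_of_nonneg_right (by linarith) (by positivity)
    exact le_of_mul_le_mul_left (s4.trans s5) (by linarith)
  have hc : 0 ≤ n * (n - k + n / L) := by
    have : 0 ≤ n / L := by positivity
    have : 0 ≤ n - k := by linarith
    positivity
  have hfin : n * (n - k + n / L) * H ≤ n.factorial * G := by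
    rcases hmain with h0 | h0
    · exact (mul_nonpos_of_nonneg_of_nonpos hc h0).trans (by positivity)
    · exact h0
  rw [hH1] at hfin
  refine le_of_mul_le_mul_left (a := (n.factorial : ℝ)) ?_ hfac
  calc _ = n * (n - k + n / L) * (n.factorial *
        ∫ x, f x ^ 2 * mixDensity ρ S x ∂(Measure.pi fun _ : Fin n ↦ ν)) := by ring
    _ ≤ _ := hfin

end Posterior

end IsDensityFamily

end EntropyIncrement

/-! ### Entropy increments and the logarithmic bound -/

section EntropyBound

variable {α : Type*} [MeasurableSpace α] {n : ℕ}
variable {ν : Measure α} [IsProbabilityMeasure ν] {ρ : Fin n → α → ℝ}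

/-- With `a = n - k + n / L`, the inequality `log (1 - 1/a) ≤ -1/a` bounds each term by `log a - log
(a - 1)`, and the sum telescopes from `n + n / L` down to `n / L`. -/
lemma sum_inv_le_log {L : ℝ} (hL : 0 < L) (hn : 0 < n) :
    ∑ k ∈ Finset.range n, (n - k + n / L : ℝ)⁻¹ ≤ Real.log (1 + L) := by
  have hn' : (0 : ℝ) < n := by exact_mod_cast hn
  have hc : 0 < n / L := by positivity
  have h1 : ∀ k ∈ Finset.range n, (n - k + n / L : ℝ)⁻¹ ≤
      Real.log (n - k + n / L) - Real.log (n - (k + 1 : ℕ) + n / L) := fun k hk ↦ by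
    have hk : (k : ℝ) + 1 ≤ n := by exact_mod_cast Finset.mem_range.mp hk
    have h2 : 0 < n - k + n / L := by linarith
    have h3 : 0 < n - (k + 1 : ℕ) + n / L := by push_cast; linarith
    have h4 := Real.log_le_sub_one_of_pos (div_pos h3 h2)
    rw [Real.log_div h3.ne' h2.ne'] at h4
    have h5 : (n - (k + 1 : ℕ) + n / L) / (n - k + n / L) - 1 = -(n - k + n / L : ℝ)⁻¹ := by
      rw [div_sub_one h2.ne', ← one_div, ← neg_div]
      congr 1
      push_cast
      ring
    linarith
  refine (Finset.sum_le_sum h1).trans_eq ?_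
  rw [Finset.sum_range_sub' (fun k : ℕ ↦ Real.log (n - k + n / L))]
  simp only [Nat.cast_zero, sub_zero, sub_self, zero_add]
  rw [← Real.log_div (by positivity) hc.ne']
  congr 1
  field_simp
  ring

namespace IsDensityFamily

variable (h : IsDensityFamily ν ρ)
include h

lemma integral_sub_one (j : Fin n) : ∫ y, (ρ j y - 1) ∂ν = 0 := by
  rw [integral_sub (h.integrable j) (integrable_const 1), h.integral_eq_one]
  simp

lemma sum_sub_one (y : α) : ∑ j, (ρ j y - 1) = 0 := by
  simp [Finset.sum_sub_distrib, h.sum_eq y]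

/-- The relative increment of the mixture density when a coordinate is added. -/
lemma mixDensity_insert {S : Finset (Fin n)} {t : Fin n} (ht : t ∉ S) (x : Fin n → α) :
    mixDensity ρ (insert t S) x = mixDensity ρ S x +
      posteriorMean ρ S t (fun j ↦ ρ j (x t) - 1) x * mixDensity ρ S x := by
  rw [h.posteriorMean_mul_mixDensity]
  simp only [mixDensity, Finset.prod_insert ht]
  rw [← mul_add, ← Finset.sum_add_distrib]
  congr 1
  exact Finset.sum_congr rfl fun σ _ ↦ by ring

lemma measurable_posteriorMean_eval (S : Finset (Fin n)) (t : Fin n) :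
    Measurable fun x : Fin n → α ↦ posteriorMean ρ S t (fun j ↦ ρ j (x t) - 1) x :=
  (Finset.measurable_sum _ fun (σ : Equiv.Perm (Fin n)) _ ↦
    (((h.measurable _).comp (measurable_pi_apply t)).sub_const 1).mul (h.measurable_prod S σ)).div
      (Finset.measurable_sum _ fun (σ : Equiv.Perm (Fin n)) _ ↦ h.measurable_prod S σ)

lemma mixDensity_update {S : Finset (Fin n)} {t : Fin n} (ht : t ∉ S) (x : Fin n → α) (y : α) :
    mixDensity ρ S (Function.update x t y) = mixDensity ρ S x := by
  have e : ∀ i ∈ S, Function.update x t y i = x i := fun i hi ↦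
    Function.update_of_ne (by rintro rfl; exact ht hi) _ _
  simp only [mixDensity]
  congr 1
  exact Finset.sum_congr rfl fun σ _ ↦ Finset.prod_congr rfl fun i hi ↦ by rw [e i hi]

lemma posteriorMean_update {S : Finset (Fin n)} {t : Fin n} (ht : t ∉ S) (g : Fin n → ℝ)
    (x : Fin n → α) (y : α) :
    posteriorMean ρ S t g (Function.update x t y) = posteriorMean ρ S t g x := by
  have e : ∀ i ∈ S, Function.update x t y i = x i := fun i hi ↦
    Function.update_of_ne (by rintro rfl; exact ht hi) _ _
  simp only [posteriorMean]
  congr 1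
  · exact Finset.sum_congr rfl fun σ _ ↦ by
      rw [Finset.prod_congr rfl fun i hi ↦ by rw [e i hi]]
  · exact Finset.sum_congr rfl fun σ _ ↦ Finset.prod_congr rfl fun i hi ↦ by rw [e i hi]

/-- The factor with the logarithm does not involve `x_t`, and the posterior mean is linear in the
values `ρ j (x_t) - 1`, each of which has zero integral over `x_t`. -/
lemma integral_posteriorMean_mul_log {S : Finset (Fin n)} {t : Fin n} (ht : t ∉ S) :
    ∫ x, posteriorMean ρ S t (fun j ↦ ρ j (x t) - 1) x *
      (mixDensity ρ S x * Real.log (mixDensity ρ S x)) ∂(Measure.pi fun _ : Fin n ↦ ν) = 0 := by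
  obtain ⟨C, hC⟩ := isCompact_Icc.exists_bound_of_continuousOn
    (s := Set.Icc (0 : ℝ) (n ^ S.card)) Real.continuous_mul_log.continuousOn
  have hqC : ∀ x, |mixDensity ρ S x * Real.log (mixDensity ρ S x)| ≤ C := fun x ↦
    hC _ ⟨h.mixDensity_nonneg S x, h.mixDensity_le S x⟩
  have hqm : Measurable fun x ↦ mixDensity ρ S x * Real.log (mixDensity ρ S x) :=
    (h.measurable_mixDensity S).mul (h.measurable_mixDensity S).log
  have hpC : ∀ y x, |posteriorMean ρ S t (fun j ↦ ρ j y - 1) x| ≤ n := fun y x ↦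
    h.abs_posteriorMean_le S t _ (fun j ↦ h.abs_sub_one_le j y) x
  -- Each product of densities is at most `n!` times the mixture, so its product with the logarithm
  -- is dominated by the bounded function `q |log q|`.
  let c : Equiv.Perm (Fin n) → ℝ := fun σ ↦ ∫ x, (n.factorial : ℝ)⁻¹ *
    ((∏ i ∈ S, ρ (σ i) (x i)) * Real.log (mixDensity ρ S x)) ∂(Measure.pi fun _ : Fin n ↦ ν)
  have hci : ∀ σ : Equiv.Perm (Fin n), Integrable (fun x ↦ (n.factorial : ℝ)⁻¹ *
      ((∏ i ∈ S, ρ (σ i) (x i)) * Real.log (mixDensity ρ S x)))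
      (Measure.pi fun _ : Fin n ↦ ν) := fun σ ↦ by
    refine integrable_of_abs_le (C := C)
      (((h.measurable_prod S σ).mul (h.measurable_mixDensity S).log).const_mul _) fun x ↦ ?_
    refine le_trans ?_ (hqC x)
    rw [abs_mul, abs_mul, abs_mul, ← mul_assoc, abs_of_pos (by positivity),
      abs_of_nonneg (h.prod_nonneg S σ x), abs_of_nonneg (h.mixDensity_nonneg S x)]
    refine mul_le_mul_of_nonneg_right ?_ (abs_nonneg _)
    rw [inv_mul_le_iff₀ (by positivity)]
    exact h.prod_le_factorial_mul_mixDensity S σ x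
  rw [integral_update (fun _ ↦ ν) (fun _ ↦ ν) t (fun _ _ ↦ rfl)
    (F := fun x ↦ posteriorMean ρ S t (fun j ↦ ρ j (x t) - 1) x *
      (mixDensity ρ S x * Real.log (mixDensity ρ S x))) (C := n * C)
    ((h.measurable_posteriorMean_eval S t).mul hqm) fun x ↦ by
      rw [abs_mul]
      exact mul_le_mul (hpC _ _) (hqC x) (abs_nonneg _) (Nat.cast_nonneg n)]
  simp only [Function.update_self, h.mixDensity_update ht, h.posteriorMean_update ht]
  have e : ∀ y, ∫ x, posteriorMean ρ S t (fun j ↦ ρ j y - 1) x *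
      (mixDensity ρ S x * Real.log (mixDensity ρ S x)) ∂(Measure.pi fun _ : Fin n ↦ ν) =
      ∑ σ : Equiv.Perm (Fin n), (ρ (σ t) y - 1) * c σ := fun y ↦ by
    simp only [c, ← integral_const_mul]
    rw [← integral_finsetSum _ fun σ _ ↦ (hci σ).const_mul _]
    refine integral_congr_ae (Filter.Eventually.of_forall fun x ↦ ?_)
    simp only
    rw [← mul_assoc, h.posteriorMean_mul_mixDensity, mul_assoc, Finset.sum_mul, Finset.mul_sum]
    exact Finset.sum_congr rfl fun σ _ ↦ by ring
  simp_rw [e]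
  rw [integral_finsetSum _ fun σ _ ↦ ((h.integrable (σ t)).sub (integrable_const 1)).mul_const _]
  refine Finset.sum_eq_zero fun σ _ ↦ ?_
  rw [integral_mul_const, h.integral_sub_one, zero_mul]

/-- For each fixed value `y` of the new coordinate, `integral_posteriorMean_sq_le` applies to the
centred function `j ↦ ρ j y - 1`; integrating over `y` produces `meanChiSq`. -/
lemma integral_posteriorMean_eval_sq_le {S : Finset (Fin n)} {t : Fin n} (ht : t ∉ S) {L : ℝ}
    (hL : 0 < L) (hvar : HasVarianceBound ν ρ L) :
    ∫ x, posteriorMean ρ S t (fun j ↦ ρ j (x t) - 1) x ^ 2 * mixDensity ρ S x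
      ∂(Measure.pi fun _ : Fin n ↦ ν) ≤ meanChiSq ν ρ * (n - S.card + n / L : ℝ)⁻¹ := by
  have hpC : ∀ y x, |posteriorMean ρ S t (fun j ↦ ρ j y - 1) x| ≤ n := fun y x ↦
    h.abs_posteriorMean_le S t _ (fun j ↦ h.abs_sub_one_le j y) x
  have hcard : S.card < n := by simpa using Finset.card_lt_univ_of_notMem ht
  have hkn : (S.card : ℝ) + 1 ≤ n := by exact_mod_cast hcard
  have hn0 : (0 : ℝ) < n := by
    have : (0 : ℝ) ≤ S.card := Nat.cast_nonneg _
    linarith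
  have hpos : 0 < (n - S.card + n / L : ℝ) := by
    have : 0 < n / L := by positivity
    linarith
  have hFm : Measurable fun x : Fin n → α ↦
      posteriorMean ρ S t (fun j ↦ ρ j (x t) - 1) x ^ 2 * mixDensity ρ S x :=
    ((h.measurable_posteriorMean_eval S t).pow_const 2).mul (h.measurable_mixDensity S)
  have hFC : ∀ x : Fin n → α, |posteriorMean ρ S t (fun j ↦ ρ j (x t) - 1) x ^ 2 *
      mixDensity ρ S x| ≤ n ^ 2 * n ^ S.card := fun x ↦ by
    rw [abs_mul, abs_pow, abs_of_nonneg (h.mixDensity_nonneg S x)]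
    exact mul_le_mul (pow_le_pow_left₀ (abs_nonneg _) (hpC _ _) 2) (h.mixDensity_le S x)
      (h.mixDensity_nonneg S x) (by positivity)
  rw [integral_update (fun _ ↦ ν) (fun _ ↦ ν) t (fun _ _ ↦ rfl) hFm hFC]
  have hi : ∀ j, Integrable (fun y ↦ (ρ j y - 1) ^ 2) ν := fun j ↦ by
    simp_rw [sq]; exact h.integrable_sub_one_mul j j
  calc _ ≤ ∫ y, (∑ j, (ρ j y - 1) ^ 2) * (n * (n - S.card + n / L) : ℝ)⁻¹ ∂ν := by
        refine integral_mono
          (integrable_of_abs_le (measurable_coordMean (fun _ ↦ ν) hFm t)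
            (abs_coordMean_le (fun _ ↦ ν) hFC t))
          ((integrable_finsetSum _ fun j _ ↦ hi j).mul_const _) fun y ↦ ?_
        simp only [Function.update_self, h.mixDensity_update ht, h.posteriorMean_update ht]
        rw [← div_eq_mul_inv, le_div_iff₀ (by positivity), mul_comm]
        exact h.integral_posteriorMean_sq_le ht (h.sum_sub_one y) hL hvar
    _ = _ := by
        rw [integral_mul_const, integral_finsetSum _ fun j _ ↦ hi j, meanChiSq]
        field_simp

/-- The density gets multiplied by `1 + p`, and `(1 + p) log (1 + p) ≤ p + p²`. The terms linear in
`p` integrate to zero, so only the second moment of `p` remains. -/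
lemma mixEntropy_insert_le {S : Finset (Fin n)} {t : Fin n} (ht : t ∉ S) {L : ℝ}
    (hL : 0 < L) (hvar : HasVarianceBound ν ρ L) :
    mixEntropy ν ρ (insert t S) ≤ mixEntropy ν ρ S +
      meanChiSq ν ρ * (n - S.card + n / L : ℝ)⁻¹ := by
  refine le_trans ?_ (add_le_add_right (h.integral_posteriorMean_eval_sq_le ht hL hvar) _)
  have hpC : ∀ y x, |posteriorMean ρ S t (fun j ↦ ρ j y - 1) x| ≤ n := fun y x ↦
    h.abs_posteriorMean_le S t _ (fun j ↦ h.abs_sub_one_le j y) x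
  set p : (Fin n → α) → ℝ := fun x ↦ posteriorMean ρ S t (fun j ↦ ρ j (x t) - 1) x with hp
  have hpm : Measurable p := h.measurable_posteriorMean_eval S t
  have hpn : ∀ x, |p x| ≤ n := fun x ↦ hpC _ x
  have hi0 : Integrable (mixDensity ρ S) (Measure.pi fun _ : Fin n ↦ ν) :=
    h.integrable_comp_mixDensity S continuous_id
  have hi1 := h.integrable_comp_mixDensity S Real.continuous_mul_log
  have hi2 : Integrable (fun x ↦ p x * (mixDensity ρ S x * Real.log (mixDensity ρ S x)))
      (Measure.pi fun _ : Fin n ↦ ν) :=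
    hi1.bdd_mul hpm.aestronglyMeasurable (c := n) (Filter.Eventually.of_forall hpn)
  have hi3 : Integrable (fun x ↦ p x * mixDensity ρ S x) (Measure.pi fun _ : Fin n ↦ ν) :=
    hi0.bdd_mul hpm.aestronglyMeasurable (c := n) (Filter.Eventually.of_forall hpn)
  have hi4 : Integrable (fun x ↦ p x ^ 2 * mixDensity ρ S x) (Measure.pi fun _ : Fin n ↦ ν) :=
    hi0.bdd_mul (hpm.pow_const 2).aestronglyMeasurable (c := n ^ 2)
      (Filter.Eventually.of_forall fun x ↦ by
        rw [norm_pow]; exact pow_le_pow_left₀ (norm_nonneg _) (hpn x) 2)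
  have hz : ∫ x, p x * mixDensity ρ S x ∂(Measure.pi fun _ : Fin n ↦ ν) = 0 := by
    have h1 := h.integral_mixDensity (insert t S)
    have e : ∀ x, mixDensity ρ (insert t S) x = mixDensity ρ S x + p x * mixDensity ρ S x :=
      h.mixDensity_insert ht
    simp_rw [e] at h1
    rw [integral_add hi0 hi3, h.integral_mixDensity] at h1
    linarith
  calc mixEntropy ν ρ (insert t S)
      ≤ ∫ x, ((mixDensity ρ S x * Real.log (mixDensity ρ S x) +
          p x * (mixDensity ρ S x * Real.log (mixDensity ρ S x))) +
          (p x * mixDensity ρ S x + p x ^ 2 * mixDensity ρ S x))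
          ∂(Measure.pi fun _ : Fin n ↦ ν) := by
        refine integral_mono (h.integrable_comp_mixDensity _ Real.continuous_mul_log)
          ((hi1.add hi2).add (hi3.add hi4)) fun x ↦ ?_
        have hq' : mixDensity ρ (insert t S) x = mixDensity ρ S x + p x * mixDensity ρ S x :=
          h.mixDensity_insert ht x
        have hq0 := h.mixDensity_nonneg (insert t S) x
        have hq := h.mixDensity_nonneg S x
        simp only
        rw [hq'] at hq0 ⊢
        rcases hq.eq_or_lt with h0 | h0
        · simp [← h0]
        -- The enlarged density `(1 + p) q` is nonnegative and `q > 0`. When `1 + p = 0` it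
        -- vanishes, and `0 * log 0 = 0`.
        · have h1 : 0 ≤ 1 + p x := by
            refine nonneg_of_mul_nonneg_left (b := mixDensity ρ S x) ?_ h0
            linarith
          rcases h1.eq_or_lt with h2 | h2
          · have h3 : p x = -1 := by linarith
            rw [h3]; simp
          · have h3 : mixDensity ρ S x + p x * mixDensity ρ S x =
                (1 + p x) * mixDensity ρ S x := by ring
            rw [h3, Real.log_mul h2.ne' h0.ne']
            have h4 := Real.log_le_sub_one_of_pos h2
            have h5 := mul_le_mul_of_nonneg_left h4 (mul_nonneg h1 h0.le)
            linarith [h5]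
    _ = mixEntropy ν ρ S + ∫ x, p x ^ 2 * mixDensity ρ S x ∂(Measure.pi fun _ : Fin n ↦ ν) := by
        have hi12 : Integrable (fun x ↦ mixDensity ρ S x * Real.log (mixDensity ρ S x) +
          p x * (mixDensity ρ S x * Real.log (mixDensity ρ S x)))
          (Measure.pi fun _ : Fin n ↦ ν) := hi1.add hi2
        have hi34 : Integrable (fun x ↦ p x * mixDensity ρ S x + p x ^ 2 * mixDensity ρ S x)
          (Measure.pi fun _ : Fin n ↦ ν) := hi3.add hi4
        rw [integral_add hi12 hi34, integral_add hi1 hi2, integral_add hi3 hi4, hz,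
          h.integral_posteriorMean_mul_log ht, mixEntropy]
        ring

/-- The bound on the relative entropy of a permutation mixture in terms of a variance bound for the
members of the family. -/
theorem mixEntropy_le_log {L : ℝ} (hL : 0 < L) (hn : 0 < n) (hvar : HasVarianceBound ν ρ L) :
    mixEntropy ν ρ Finset.univ ≤ meanChiSq ν ρ * Real.log (1 + L) := by
  have hx : 0 ≤ meanChiSq ν ρ :=
    div_nonneg (Finset.sum_nonneg fun j _ ↦ integral_nonneg fun y ↦ sq_nonneg _) (Nat.cast_nonneg n)
  have key : ∀ S : Finset (Fin n), mixEntropy ν ρ S ≤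
      meanChiSq ν ρ * ∑ k ∈ Finset.range S.card, (n - k + n / L : ℝ)⁻¹ := fun S ↦ by
    induction S using Finset.induction_on with
    | empty =>
      have hfac : (n.factorial : ℝ)⁻¹ * n.factorial = 1 := inv_mul_cancel₀ (by positivity)
      simp [mixEntropy, mixDensity, Fintype.card_perm, hfac]
    | insert t S ht ih =>
      rw [Finset.card_insert_of_notMem ht, Finset.sum_range_succ, mul_add]
      exact (h.mixEntropy_insert_le ht hL hvar).trans (by linarith)
  refine (key _).trans (mul_le_mul_of_nonneg_left ?_ hx)
  simpa using sum_inv_le_log hL hn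

end IsDensityFamily

end EntropyBound

/-! ### From Hellinger distance to the variance bound -/

section Hellinger

variable {α : Type*} [MeasurableSpace α]

lemma sq_integral_mul_le {m : Measure α} {f g : α → ℝ} (hf : Integrable (fun x ↦ f x ^ 2) m)
    (hg : Integrable (fun x ↦ g x ^ 2) m) (hfg : Integrable (fun x ↦ f x * g x) m) :
    (∫ x, f x * g x ∂m) ^ 2 ≤ (∫ x, f x ^ 2 ∂m) * ∫ x, g x ^ 2 ∂m := by
  have key : ∀ s : ℝ, 0 ≤ (∫ x, g x ^ 2 ∂m) * (s * s) + (2 * ∫ x, f x * g x ∂m) * s +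
      ∫ x, f x ^ 2 ∂m := fun s ↦ by
    have h0 : 0 ≤ ∫ x, (f x + s * g x) ^ 2 ∂m := integral_nonneg fun x ↦ sq_nonneg _
    have e : ∀ x, (f x + s * g x) ^ 2 = (s * s) * g x ^ 2 + ((2 * s) * (f x * g x) + f x ^ 2) :=
      fun x ↦ by ring
    have hi : Integrable (fun x ↦ (2 * s) * (f x * g x) + f x ^ 2) m := (hfg.const_mul _).add hf
    simp_rw [e] at h0
    rw [integral_add (hg.const_mul _) hi, integral_add (hfg.const_mul _) hf, integral_const_mul,
      integral_const_mul] at h0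
    linarith
  have := discrim_le_zero key
  rw [discrim] at this
  nlinarith

variable {P Q : Measure α} [IsProbabilityMeasure P] [IsProbabilityMeasure Q]

lemma rnDeriv_add_toReal_ae :
    ∀ᵐ x ∂(P + Q), 0 ≤ (P.rnDeriv (P + Q) x).toReal ∧ 0 ≤ (Q.rnDeriv (P + Q) x).toReal ∧
      (P.rnDeriv (P + Q) x).toReal + (Q.rnDeriv (P + Q) x).toReal = 1 := by
  filter_upwards [Measure.rnDeriv_add' P Q (P + Q), Measure.rnDeriv_self (P + Q),
    Measure.rnDeriv_lt_top P (P + Q), Measure.rnDeriv_lt_top Q (P + Q)] with x h1 h2 h3 h4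
  refine ⟨ENNReal.toReal_nonneg, ENNReal.toReal_nonneg, ?_⟩
  rw [← ENNReal.toReal_add h3.ne h4.ne]
  rw [Pi.add_apply, h2] at h1
  rw [← h1, ENNReal.toReal_one]

/-- Measures at Hellinger distance bounded away from the maximum satisfy a variance bound. -/
lemma sq_sub_le_of_hellingerSq_le {δ : ℝ} (hδ : 0 < δ) (hδ1 : δ ≤ 1)
    (hH : hellingerSq P Q ≤ ENNReal.ofReal (2 - 2 * δ)) {u : α → ℝ} {C : ℝ} (hu : Measurable u)
    (hC : ∀ y, |u y| ≤ C) :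
    (∫ y, u y ∂P - ∫ y, u y ∂Q) ^ 2 ≤ (2 * (δ ^ 2)⁻¹ - 1) *
      (∫ y, (u y - ∫ z, u z ∂P) ^ 2 ∂P + ∫ y, (u y - ∫ z, u z ∂Q) ^ 2 ∂Q) := by
  set m := P + Q with hm
  set a : α → ℝ := fun x ↦ (P.rnDeriv m x).toReal with ha
  set b : α → ℝ := fun x ↦ (Q.rnDeriv m x).toReal with hb
  have hPm : P ≪ m := Measure.absolutelyContinuous_of_le (Measure.le_add_right le_rfl)
  have hQm : Q ≪ m := Measure.absolutelyContinuous_of_le (Measure.le_add_left le_rfl)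
  have ham : Measurable a := (Measure.measurable_rnDeriv P m).ennreal_toReal
  have hbm : Measurable b := (Measure.measurable_rnDeriv Q m).ennreal_toReal
  have hab : ∀ᵐ x ∂m, 0 ≤ a x ∧ 0 ≤ b x ∧ a x + b x = 1 := rnDeriv_add_toReal_ae
  have hbdd : ∀ f : α → ℝ, Measurable f → ∀ c : ℝ, (∀ᵐ x ∂m, |f x| ≤ c) → Integrable f m :=
    fun f hf c hc ↦ Integrable.of_bound hf.aestronglyMeasurable c hc
  have hP : ∀ f : α → ℝ, ∫ x, f x ∂P = ∫ x, a x * f x ∂m := fun f ↦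
    (integral_rnDeriv_smul hPm).symm
  have hQ : ∀ f : α → ℝ, ∫ x, f x ∂Q = ∫ x, b x * f x ∂m := fun f ↦
    (integral_rnDeriv_smul hQm).symm
  have ha1 : ∀ᵐ x ∂m, |a x| ≤ 1 := hab.mono fun x ⟨h1, h2, h3⟩ ↦ by
    rw [abs_of_nonneg h1]; linarith
  have hb1 : ∀ᵐ x ∂m, |b x| ≤ 1 := hab.mono fun x ⟨h1, h2, h3⟩ ↦ by
    rw [abs_of_nonneg h2]; linarith
  have hia : Integrable a m := hbdd a ham 1 ha1
  have hib : Integrable b m := hbdd b hbm 1 hb1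
  have hIa : ∫ x, a x ∂m = 1 := by simpa using (hP fun _ ↦ 1).symm
  have hIb : ∫ x, b x ∂m = 1 := by simpa using (hQ fun _ ↦ 1).symm
  have hiab : Integrable (fun x ↦ a x * b x) m := hib.bdd_mul ham.aestronglyMeasurable ha1
  have hsab : Integrable (fun x ↦ Real.sqrt (a x * b x)) m :=
    hbdd _ (ham.mul hbm).sqrt 1 (hab.mono fun x ⟨h1, h2, h3⟩ ↦ by
      rw [abs_of_nonneg (Real.sqrt_nonneg _), Real.sqrt_le_left zero_le_one]
      nlinarith)
  have hHeq : hellingerSq P Q = ENNReal.ofReal (2 - 2 * ∫ x, Real.sqrt (a x * b x) ∂m) := by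
    have e : ∀ᵐ x ∂m, (Real.sqrt (a x) - Real.sqrt (b x)) ^ 2 =
        (a x + b x) - 2 * Real.sqrt (a x * b x) := hab.mono fun x ⟨h1, h2, h3⟩ ↦ by
      rw [sub_sq, Real.sq_sqrt h1, Real.sq_sqrt h2, Real.sqrt_mul h1]; ring
    have hi : Integrable (fun x ↦ (a x + b x) - 2 * Real.sqrt (a x * b x)) m :=
      (hia.add hib).sub (hsab.const_mul 2)
    rw [hellingerSq, ← ofReal_integral_eq_lintegral_ofReal (hi.congr (e.mono fun x hx ↦ hx.symm))
      (Filter.Eventually.of_forall fun x ↦ sq_nonneg _), integral_congr_ae e]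
    have hiab' : Integrable (fun x ↦ a x + b x) m := hia.add hib
    rw [integral_sub hiab' (hsab.const_mul 2), integral_add hia hib, hIa, hIb, integral_const_mul]
    norm_num
  have hmu : m.real Set.univ = 2 := by
    simp [hm, Measure.real, ENNReal.toReal_add]
    norm_num
  set κ := ∫ x, a x * b x ∂m with hκ
  -- Cauchy–Schwarz against the constant `1`; the factor `2` is the total mass of `P + Q`.
  have haff2 : (∫ x, Real.sqrt (a x * b x) ∂m) ^ 2 ≤ 2 * κ := by
    have h1 := sq_integral_mul_le (m := m) (f := fun _ ↦ 1) (g := fun x ↦ Real.sqrt (a x * b x))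
      (integrable_const _) ?_ (by simpa using hsab)
    · simp only [one_mul, one_pow, integral_const, hmu, smul_eq_mul, mul_one] at h1
      refine h1.trans_eq ?_
      congr 1
      exact integral_congr_ae (hab.mono fun x ⟨h1, h2, h3⟩ ↦ Real.sq_sqrt (mul_nonneg h1 h2))
    · exact hiab.congr (hab.mono fun x ⟨h1, h2, h3⟩ ↦ (Real.sq_sqrt (mul_nonneg h1 h2)).symm)
  have haff : δ ≤ ∫ x, Real.sqrt (a x * b x) ∂m := by
    rw [hHeq, ENNReal.ofReal_le_ofReal_iff (by linarith)] at hH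
    linarith
  have hκδ : δ ^ 2 ≤ 2 * κ := (pow_le_pow_left₀ hδ.le haff 2).trans haff2
  set p := ∫ y, u y ∂P with hp
  set q := ∫ y, u y ∂Q with hq
  set c := (p + q) / 2 with hc
  set V := ∫ y, (u y - p) ^ 2 ∂P + ∫ y, (u y - q) ^ 2 ∂Q with hV
  have hiu : ∀ (ξ : Measure α) [IsProbabilityMeasure ξ], Integrable u ξ := fun ξ _ ↦
    integrable_of_abs_le hu hC
  have hiu2 : ∀ (ξ : Measure α) [IsFiniteMeasure ξ] (s : ℝ),
      Integrable (fun y ↦ (u y - s) ^ 2) ξ := fun ξ _ s ↦ by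
    refine integrable_of_abs_le (C := (C + |s|) ^ 2) ((hu.sub_const s).pow_const 2) fun y ↦ ?_
    rw [abs_pow]
    exact pow_le_pow_left₀ (abs_nonneg _) ((abs_sub _ _).trans (add_le_add_left (hC y) _)) 2
  have hshift : ∀ (ξ : Measure α) [IsProbabilityMeasure ξ],
      ∫ y, (u y - c) ^ 2 ∂ξ = ∫ y, (u y - ∫ z, u z ∂ξ) ^ 2 ∂ξ + (∫ z, u z ∂ξ - c) ^ 2 := by
    intro ξ _
    set r := ∫ z, u z ∂ξ with hr
    have e : ∀ y, (u y - c) ^ 2 = (u y - r) ^ 2 + ((2 * (r - c)) * (u y - r) + (r - c) ^ 2) :=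
      fun y ↦ by ring
    have hi1 : Integrable (fun y ↦ u y - r) ξ := (hiu ξ).sub (integrable_const r)
    have hi2 : Integrable (fun y ↦ (2 * (r - c)) * (u y - r) + (r - c) ^ 2) ξ :=
      (hi1.const_mul _).add (integrable_const _)
    simp_rw [e]
    rw [integral_add (hiu2 ξ r) hi2, integral_add (hi1.const_mul _) (integrable_const _),
      integral_const_mul, integral_sub (hiu ξ) (integrable_const r)]
    simp [← hr]
  -- Centring at the midpoint `c` of the two means contributes the explicit term `(p - q)² / 2`,
  -- which is moved to the left-hand side after Cauchy–Schwarz.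
  have hW : ∫ y, (u y - c) ^ 2 ∂m = V + (p - q) ^ 2 / 2 := by
    rw [hm, integral_add_measure (hiu2 P c) (hiu2 Q c), hshift P, hshift Q]
    simp only [hV, hc, ← hp, ← hq]
    ring
  have hiuc : ∀ (ξ : Measure α) [IsFiniteMeasure ξ], Integrable (fun y ↦ u y - c) ξ := fun ξ _ ↦
    (integrable_of_abs_le hu hC).sub (integrable_const c)
  have hD : ∫ y, (u y - c) * (a y - b y) ∂m = p - q := by
    have e : ∀ y, (u y - c) * (a y - b y) = a y * (u y - c) - b y * (u y - c) := fun y ↦ by ring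
    simp_rw [e]
    rw [integral_sub ((hiuc m).bdd_mul ham.aestronglyMeasurable ha1)
      ((hiuc m).bdd_mul hbm.aestronglyMeasurable hb1), ← hP fun y ↦ u y - c,
      ← hQ fun y ↦ u y - c, integral_sub (hiu P) (integrable_const c),
      integral_sub (hiu Q) (integrable_const c)]
    simp [hp, hq]
  have hae : ∀ᵐ x ∂m, (a x - b x) ^ 2 = 1 - 4 * (a x * b x) := hab.mono fun x ⟨h1, h2, h3⟩ ↦ by
    have : b x = 1 - a x := by linarith
    rw [this]; ring
  have hi1 : Integrable (fun x ↦ 1 - 4 * (a x * b x)) m :=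
    (integrable_const 1).sub (hiab.const_mul 4)
  have hτ : ∫ x, (a x - b x) ^ 2 ∂m = 2 - 4 * κ := by
    rw [integral_congr_ae hae, integral_sub (integrable_const 1) (hiab.const_mul 4),
      integral_const_mul]
    simp [hmu, hκ]
  have hCS := sq_integral_mul_le (hiu2 m c) (hi1.congr (hae.mono fun x hx ↦ hx.symm)) (by
    have := ((hiuc m).bdd_mul ham.aestronglyMeasurable ha1).sub
      ((hiuc m).bdd_mul hbm.aestronglyMeasurable hb1)
    exact this.congr (Filter.Eventually.of_forall fun y ↦ by simp only [Pi.sub_apply]; ring))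
  rw [hD, hW, hτ] at hCS
  have hV0 : 0 ≤ V := add_nonneg (integral_nonneg fun y ↦ sq_nonneg _)
    (integral_nonneg fun y ↦ sq_nonneg _)
  have hδ2 : 0 < δ ^ 2 := by positivity
  -- Cauchy–Schwarz reads `(p - q)² ≤ (V + (p - q)² / 2) (2 - 4κ)`, hence `2κ (p - q)² ≤ (2 - 4κ)
  -- V`, where `2κ ≥ δ²`. This would even allow `2 - 2δ²`; the weaker `2 - δ²` keeps the constant
  -- `L` positive at `δ = 1` and makes `1 + L = 2 / δ²`.
  have h1 : (p - q) ^ 2 * δ ^ 2 ≤ (2 - δ ^ 2) * V := by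
    nlinarith [sq_nonneg (p - q), mul_le_mul_of_nonneg_left hκδ (sq_nonneg (p - q)),
      mul_le_mul_of_nonneg_left hκδ hV0]
  have h2 : 2 * (δ ^ 2)⁻¹ - 1 = (2 - δ ^ 2) / δ ^ 2 := by field_simp
  rw [h2, div_mul_eq_mul_div, le_div_iff₀ hδ2]
  exact h1

end Hellinger

/-! ### Variational bounds for the Kullback-Leibler divergence -/

section KullbackLeibler

variable {α : Type*} [MeasurableSpace α]

lemma toReal_rnDeriv_withDensity_ofReal_ae (Q : Measure α) [IsFiniteMeasure Q] {d : α → ℝ}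
    (hd : Measurable d) (hd0 : ∀ x, 0 ≤ d x) :
    ∀ᵐ x ∂Q, ((Q.withDensity fun x ↦ ENNReal.ofReal (d x)).rnDeriv Q x).toReal = d x := by
  filter_upwards [Measure.rnDeriv_withDensity Q hd.ennreal_ofReal] with x hx
  rw [hx, ENNReal.toReal_ofReal (hd0 x)]

/-- The Kullback-Leibler divergence of a probability measure with a given density. -/
lemma klDiv_withDensity (Q : Measure α) [IsProbabilityMeasure Q] {d : α → ℝ} (hd : Measurable d)
    (hd0 : ∀ x, 0 ≤ d x) {P : Measure α} [IsProbabilityMeasure P]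
    (hP : P = Q.withDensity fun x ↦ ENNReal.ofReal (d x))
    (hi : Integrable (fun x ↦ Real.log (d x)) P) :
    klDiv P Q ≠ ∞ ∧ (klDiv P Q).toReal = ∫ x, Real.log (d x) ∂P := by
  have hac : P ≪ Q := hP ▸ withDensity_absolutelyContinuous _ _
  have hae : ∀ᵐ x ∂P, llr P Q x = Real.log (d x) := by
    refine hac.ae_le ?_
    have h := toReal_rnDeriv_withDensity_ofReal_ae Q hd hd0
    rw [← hP] at h
    filter_upwards [h] with x hx
    rw [llr, hx]
  refine ⟨klDiv_ne_top hac (hi.congr (hae.mono fun x hx ↦ hx.symm)), ?_⟩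
  rw [toReal_klDiv_of_measure_eq hac (by simp), integral_congr_ae hae]

variable {P Q : Measure α} [IsProbabilityMeasure P] [IsProbabilityMeasure Q]

/-- Fenchel–Young inequality: `klFun` is the convex conjugate of `s ↦ exp s - 1` on the nonnegative
half-line. -/
lemma mul_sub_exp_le_klFun {x : ℝ} (hx : 0 ≤ x) (s : ℝ) : x * s - Real.exp s + 1 ≤ klFun x := by
  rw [klFun_apply]
  rcases hx.eq_or_lt with rfl | hx
  · simp [(Real.exp_pos s).le]
  · have h := Real.add_one_le_exp (s - Real.log x)
    rw [Real.exp_sub, Real.exp_log hx, le_div_iff₀ hx] at h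
    linarith

/-- The variational lower bound for the Kullback-Leibler divergence. -/
lemma integral_sub_integral_exp_le_klDiv {φ : α → ℝ} {C : ℝ} (hφ : Measurable φ)
    (hC : ∀ x, |φ x| ≤ C) (hfin : klDiv P Q ≠ ∞) :
    ∫ x, φ x ∂P - ∫ x, Real.exp (φ x) ∂Q + 1 ≤ (klDiv P Q).toReal := by
  obtain ⟨hac, hint⟩ := klDiv_ne_top_iff.mp hfin
  rw [toReal_klDiv_eq_integral_klFun hac]
  have hexp : Integrable (fun x ↦ Real.exp (φ x)) Q :=
    integrable_of_abs_le hφ.exp (C := Real.exp C) fun x ↦ by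
      rw [Real.abs_exp, Real.exp_le_exp]; exact (le_abs_self _).trans (hC x)
  have hi : Integrable (fun x ↦ (P.rnDeriv Q x).toReal * φ x) Q :=
    Measure.integrable_toReal_rnDeriv.mul_bdd hφ.aestronglyMeasurable (c := C)
      (Filter.Eventually.of_forall hC)
  have e : ∫ x, φ x ∂P = ∫ x, (P.rnDeriv Q x).toReal * φ x ∂Q := (integral_rnDeriv_smul hac).symm
  have h1 : (1 : ℝ) = ∫ _x, (1 : ℝ) ∂Q := by simp
  have hi2 : Integrable (fun x ↦ (P.rnDeriv Q x).toReal * φ x - Real.exp (φ x)) Q := hi.sub hexp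
  rw [e, h1, ← integral_sub hi hexp, ← integral_add hi2 (integrable_const 1)]
  exact integral_mono (hi2.add (integrable_const 1)) ((integrable_klFun_rnDeriv_iff hac).mpr hint)
    fun x ↦ mul_sub_exp_le_klFun ENNReal.toReal_nonneg _

/-- Truncation of a nonnegative number to the interval `[exp (-m), exp m]`. -/
def expClip (m : ℕ) (x : ℝ) : ℝ := max (Real.exp (-m)) (min (Real.exp m) x)

lemma measurable_expClip (m : ℕ) : Measurable (expClip m) :=
  measurable_const.max (measurable_const.min measurable_id)

lemma expClip_pos (m : ℕ) (x : ℝ) : 0 < expClip m x := lt_max_of_lt_left (Real.exp_pos _)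

lemma abs_log_expClip_le (m : ℕ) (x : ℝ) : |Real.log (expClip m x)| ≤ m := by
  rw [abs_le]
  constructor
  · rw [Real.le_log_iff_exp_le (expClip_pos m x)]
    exact le_max_left _ _
  · rw [Real.log_le_iff_le_exp (expClip_pos m x)]
    exact max_le (Real.exp_le_exp.mpr (by
      have : (0 : ℝ) ≤ m := Nat.cast_nonneg m
      linarith)) (min_le_left _ _)

/-- With `y` the clipped value, the expression is `klFun y + (x - y) log y`. Where clipping is
active, `x - y` and `log y` do not have opposite signs. The nonnegativity is what Fatou's lemma
needs. -/
lemma expClip_integrand_nonneg (m : ℕ) (x : ℝ) :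
    0 ≤ x * Real.log (expClip m x) - expClip m x + 1 := by
  have h0 := klFun_nonneg (expClip_pos m x).le
  rw [klFun_apply] at h0
  have hm : (0 : ℝ) ≤ m := Nat.cast_nonneg m
  suffices 0 ≤ (x - expClip m x) * Real.log (expClip m x) by linarith
  rcases lt_trichotomy x (expClip m x) with h | h | h
  · have h1 : expClip m x = Real.exp (-m) := by
      by_contra hne
      rcases max_choice (Real.exp (-m)) (min (Real.exp m) x) with h2 | h2
      · exact hne h2
      · rw [expClip, h2] at h
        exact absurd (min_le_right _ _) (not_le.mpr h)
    rw [h1] at h ⊢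
    rw [Real.log_exp]
    nlinarith
  · rw [← h]; simp
  · have h1 : expClip m x = Real.exp m := by
      have h3 : min (Real.exp m) x ≤ expClip m x := le_max_right _ _
      rcases min_choice (Real.exp m) x with h2 | h2
      · rw [h2] at h3
        refine le_antisymm (max_le (Real.exp_le_exp.mpr (by linarith)) (min_le_left _ _)) h3
      · rw [h2] at h3; exact absurd h3 (not_le.mpr h)
    rw [h1] at h ⊢
    rw [Real.log_exp]
    nlinarith

lemma tendsto_expClip_integrand {x : ℝ} (hx : 0 ≤ x) :
    Filter.Tendsto (fun m : ℕ ↦ x * Real.log (expClip m x) - expClip m x + 1) Filter.atTop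
      (nhds (klFun x)) := by
  have hexp : Filter.Tendsto (fun m : ℕ ↦ Real.exp (-(m : ℝ))) Filter.atTop (nhds 0) :=
    Real.tendsto_exp_neg_atTop_nhds_zero.comp tendsto_natCast_atTop_atTop
  rcases hx.eq_or_lt with rfl | hx
  · have e : ∀ m : ℕ, 0 * Real.log (expClip m 0) - expClip m 0 + 1 = 1 - Real.exp (-m) := fun m ↦ by
      rw [expClip, min_eq_right (Real.exp_pos _).le, max_eq_left (Real.exp_pos _).le]
      ring
    simp_rw [e]
    rw [klFun_zero]
    simpa using hexp.const_sub 1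
  · refine tendsto_const_nhds.congr' ?_
    have h1 : ∀ᶠ m : ℕ in Filter.atTop, Real.exp (-(m : ℝ)) < x := hexp.eventually_lt_const hx
    have h2 : ∀ᶠ m : ℕ in Filter.atTop, x ≤ Real.exp (m : ℝ) :=
      (Real.tendsto_exp_atTop.comp tendsto_natCast_atTop_atTop).eventually_ge_atTop x
    filter_upwards [h1, h2] with m h1 h2
    rw [expClip, min_eq_right h2, max_eq_right h1.le, klFun_apply]
    ring

/-- The variational characterization of upper bounds for the Kullback-Leibler divergence. -/
lemma klDiv_le_of_forall {B : ℝ} (hB : ∀ (φ : α → ℝ) (C : ℝ), Measurable φ → (∀ x, |φ x| ≤ C) →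
    ∫ x, φ x ∂P - ∫ x, Real.exp (φ x) ∂Q + 1 ≤ B) : klDiv P Q ≤ ENNReal.ofReal B := by
  -- Testing with `m` times the indicator of a `Q`-null set keeps the exponential integral equal to
  -- `1`, so a positive `P`-mass would violate the bound for large `m`.
  have hac : P ≪ Q := by
    refine Measure.AbsolutelyContinuous.mk fun s hs hQs ↦ ?_
    have key : ∀ m : ℕ, m * P.real s ≤ B := fun m ↦ by
      have h := hB (s.indicator fun _ ↦ (m : ℝ)) m (measurable_const.indicator hs) fun x ↦ by
        by_cases hx : x ∈ s <;> simp [hx]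
      have h1 : ∫ x, Real.exp (s.indicator (fun _ ↦ (m : ℝ)) x) ∂Q = 1 := by
        have hae : ∀ᵐ x ∂Q, x ∉ s := measure_eq_zero_iff_ae_notMem.mp hQs
        rw [integral_congr_ae (g := fun _ ↦ 1) (hae.mono fun x hx ↦ by simp [hx])]
        simp
      rw [h1, integral_indicator hs] at h
      simp only [integral_const, smul_eq_mul, measureReal_restrict_apply_univ] at h
      linarith
    by_contra hne
    have hpos : 0 < P.real s := ENNReal.toReal_pos hne (measure_ne_top _ _)
    obtain ⟨m, hm⟩ := exists_nat_gt (B / P.real s)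
    rw [div_lt_iff₀ hpos] at hm
    linarith [key m]
  rw [klDiv_eq_lintegral_klFun_of_ac hac]
  set D : α → ℝ := fun x ↦ (P.rnDeriv Q x).toReal with hD
  have hDm : Measurable D := (Measure.measurable_rnDeriv P Q).ennreal_toReal
  let f : ℕ → α → ℝ := fun m x ↦ D x * Real.log (expClip m (D x)) - expClip m (D x) + 1
  have hcm : ∀ m, Measurable fun x ↦ expClip m (D x) := fun m ↦ (measurable_expClip m).comp hDm
  have hfm : ∀ m, Measurable (f m) := fun m ↦
    ((hDm.mul (hcm m).log).sub (hcm m)).add_const 1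
  have hle : ∀ m, ∫⁻ x, ENNReal.ofReal (f m x) ∂Q ≤ ENNReal.ofReal B := fun m ↦ by
    have hb := hB (fun x ↦ Real.log (expClip m (D x))) m (hcm m).log
      fun x ↦ abs_log_expClip_le m _
    simp_rw [Real.exp_log (expClip_pos m _)] at hb
    have hi1 : Integrable (fun x ↦ D x * Real.log (expClip m (D x))) Q :=
      Measure.integrable_toReal_rnDeriv.mul_bdd (hcm m).log.aestronglyMeasurable (c := m)
        (Filter.Eventually.of_forall fun x ↦ abs_log_expClip_le m _)
    have hi2 : Integrable (fun x ↦ expClip m (D x)) Q :=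
      integrable_of_abs_le (hcm m) (C := Real.exp m) fun x ↦ by
        rw [abs_of_pos (expClip_pos m _), ← Real.log_le_iff_le_exp (expClip_pos m _)]
        exact (le_abs_self _).trans (abs_log_expClip_le m _)
    have hi3 : Integrable (fun x ↦ D x * Real.log (expClip m (D x)) - expClip m (D x)) Q :=
      hi1.sub hi2
    have hi4 : Integrable (f m) Q := hi3.add (integrable_const 1)
    rw [← ofReal_integral_eq_lintegral_ofReal hi4
      (Filter.Eventually.of_forall fun x ↦ expClip_integrand_nonneg m _)]
    refine ENNReal.ofReal_le_ofReal ?_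
    have e : ∫ x, Real.log (expClip m (D x)) ∂P = ∫ x, D x * Real.log (expClip m (D x)) ∂Q :=
      (integral_rnDeriv_smul hac).symm
    rw [e] at hb
    refine le_trans (le_of_eq ?_) hb
    simp only [f]
    rw [integral_add hi3 (integrable_const 1), integral_sub hi1 hi2]
    simp
  -- The optimal test function `log D` may be unbounded; its truncations are admissible, and Fatou's
  -- lemma passes to the limit.
  calc ∫⁻ x, ENNReal.ofReal (klFun (D x)) ∂Q
      = ∫⁻ x, Filter.liminf (fun m ↦ ENNReal.ofReal (f m x)) Filter.atTop ∂Q := by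
        refine lintegral_congr fun x ↦ ?_
        exact ((ENNReal.continuous_ofReal.tendsto _).comp
          (tendsto_expClip_integrand ENNReal.toReal_nonneg)).liminf_eq.symm
    _ ≤ Filter.liminf (fun m ↦ ∫⁻ x, ENNReal.ofReal (f m x) ∂Q) Filter.atTop :=
        lintegral_liminf_le fun m ↦ (hfm m).ennreal_ofReal
    _ ≤ Filter.liminf (fun _ : ℕ ↦ ENNReal.ofReal B) Filter.atTop :=
        Filter.liminf_le_liminf (Filter.Eventually.of_forall hle)
    _ = _ := Filter.liminf_const _

/-- The Kullback-Leibler divergence with respect to a mixture which contains `ξ` with weight at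
least `1 / N`. -/
lemma klDiv_le_add_log {ξ : Measure α} [IsProbabilityMeasure ξ] {N : ℕ} (hN : 0 < N)
    (hQ : ξ ≤ (N : ℝ≥0∞) • Q) (hfin : klDiv P ξ ≠ ∞) :
    klDiv P Q ≤ ENNReal.ofReal (Real.log N + (klDiv P ξ).toReal) := by
  refine klDiv_le_of_forall fun φ C hφ hC ↦ ?_
  have hN' : (0 : ℝ) < N := by exact_mod_cast hN
  -- Shifting the test function by `log N` compensates the factor `N` in the domination of `ξ` by
  -- `Q`.
  have h := integral_sub_integral_exp_le_klDiv (P := P) (Q := ξ) (φ := fun x ↦ φ x - Real.log N)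
    (C := C + |Real.log N|) (hφ.sub_const _)
    (fun x ↦ (abs_sub _ _).trans (add_le_add_left (hC x) _)) hfin
  rw [integral_sub (integrable_of_abs_le hφ hC) (integrable_const _)] at h
  have hexpC : ∀ x, |Real.exp (φ x)| ≤ Real.exp C := fun x ↦ by
    rw [Real.abs_exp, Real.exp_le_exp]; exact (le_abs_self _).trans (hC x)
  have h1 : ∫ x, Real.exp (φ x - Real.log N) ∂ξ ≤ ∫ x, Real.exp (φ x) ∂Q := by
    have e : ∀ x, Real.exp (φ x - Real.log N) = Real.exp (φ x) / N := fun x ↦ by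
      rw [Real.exp_sub, Real.exp_log hN']
    simp_rw [e]
    rw [integral_div, div_le_iff₀ hN', mul_comm]
    have hfm : IsFiniteMeasure ((N : ℝ≥0∞) • Q) := Measure.smul_finite _ (by simp)
    calc _ ≤ ∫ x, Real.exp (φ x) ∂((N : ℝ≥0∞) • Q) :=
          integral_mono_measure hQ (Filter.Eventually.of_forall fun x ↦ (Real.exp_pos _).le)
            (integrable_of_abs_le hφ.exp hexpC)
      _ = _ := by rw [integral_smul_measure]; simp
  simp only [integral_const, probReal_univ, one_smul] at h
  linarith

/-- A bound for the divergences between a kernel and a fixed measure bounds the mutual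
information. -/
lemma klDiv_compProd_prod_le {β Ω : Type*} [MeasurableSpace β] [MeasurableSpace Ω] {μ : Measure Ω}
    [IsProbabilityMeasure μ] {θ : Ω → β} (hθ : Measurable θ) (κ : Kernel β α) [IsMarkovKernel κ]
    (ξ : Measure α) [IsProbabilityMeasure ξ] {B : ℝ}
    (hB : ∀ᵐ ω ∂μ, klDiv (κ (θ ω)) ξ ≤ ENNReal.ofReal B) (hB0 : 0 ≤ B) :
    klDiv (μ.map θ ⊗ₘ κ) ((μ.map θ).prod (μ.map θ ⊗ₘ κ).snd) ≤ ENNReal.ofReal B := by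
  set m := μ.map θ with hm
  have hmprob : IsProbabilityMeasure m := Measure.isProbabilityMeasure_map hθ.aemeasurable
  refine klDiv_le_of_forall fun φ C hφ hC ↦ ?_
  have hexpC : ∀ p, |Real.exp (φ p)| ≤ Real.exp C := fun p ↦ by
    rw [Real.abs_exp, Real.exp_le_exp]; exact (le_abs_self _).trans (hC p)
  -- Subtracting `log Z` normalizes the test function: `ψ = φ - log Z` has exponential integral `1`
  -- under `m.prod ξ`, whatever `ξ` is. This allows `ξ` to be exchanged for the true output law.
  let Z : α → ℝ := fun x ↦ ∫ t, Real.exp (φ (t, x)) ∂m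
  have hφx : ∀ x, Measurable fun t ↦ φ (t, x) := fun x ↦ hφ.comp measurable_prodMk_right
  have hφt : ∀ t, Measurable fun x ↦ φ (t, x) := fun t ↦ hφ.comp measurable_prodMk_left
  have hZm : Measurable Z :=
    (StronglyMeasurable.integral_prod_right' (f := fun p : α × β ↦ Real.exp (φ (p.2, p.1)))
      (hφ.exp.comp measurable_swap).stronglyMeasurable).measurable
  have hZle : ∀ x, Z x ≤ Real.exp C := fun x ↦
    (le_abs_self _).trans (abs_integral_le_of_abs_le fun t ↦ hexpC (t, x))
  have hZge : ∀ x, Real.exp (-C) ≤ Z x := fun x ↦ by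
    have : ∫ _t : β, Real.exp (-C) ∂m ≤ Z x :=
      integral_mono (integrable_const _) (integrable_of_abs_le (hφx x).exp fun t ↦ hexpC (t, x))
        fun t ↦ Real.exp_le_exp.mpr (neg_le_of_abs_le (hC (t, x)))
    simpa using this
  have hZpos : ∀ x, 0 < Z x := fun x ↦ (Real.exp_pos _).trans_le (hZge x)
  have hlogC : ∀ x, |Real.log (Z x)| ≤ C := fun x ↦ by
    rw [abs_le, Real.le_log_iff_exp_le (hZpos x), Real.log_le_iff_le_exp (hZpos x)]
    exact ⟨hZge x, hZle x⟩
  let ψ : β × α → ℝ := fun p ↦ φ p - Real.log (Z p.2)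
  have hψm : Measurable ψ := hφ.sub (hZm.comp measurable_snd).log
  have hψC : ∀ p, |ψ p| ≤ C + C := fun p ↦ (abs_sub _ _).trans (add_le_add (hC p) (hlogC _))
  have hexpψ : ∀ p, |Real.exp (ψ p)| ≤ Real.exp (C + C) := fun p ↦ by
    rw [Real.abs_exp, Real.exp_le_exp]; exact (le_abs_self _).trans (hψC p)
  have h1 : ∫ p, Real.exp (ψ p) ∂(m.prod ξ) = 1 := by
    rw [integral_prod_symm _ (integrable_of_abs_le hψm.exp hexpψ)]
    have e : ∀ x, ∫ t, Real.exp (ψ (t, x)) ∂m = 1 := fun x ↦ by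
      simp only [ψ, Real.exp_sub, Real.exp_log (hZpos x)]
      rw [integral_div]
      exact div_self (hZpos x).ne'
    simp [e]
  have h2 : ∫ p, ψ p ∂(m ⊗ₘ κ) - ∫ p, Real.exp (ψ p) ∂(m.prod ξ) + 1 ≤ B := by
    have hi1 : Integrable ψ (m ⊗ₘ κ) := integrable_of_abs_le hψm hψC
    have hi2 : Integrable (fun p ↦ Real.exp (ψ p)) (m.prod ξ) :=
      integrable_of_abs_le hψm.exp hexpψ
    rw [Measure.integral_compProd hi1, integral_prod _ hi2]
    have hκm : Measurable fun t ↦ ∫ x, ψ (t, x) ∂(κ t) :=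
      (StronglyMeasurable.integral_kernel_prod_right' (κ := κ) hψm.stronglyMeasurable).measurable
    have hξm : Measurable fun t ↦ ∫ x, Real.exp (ψ (t, x)) ∂ξ :=
      hψm.exp.stronglyMeasurable.integral_prod_right'.measurable
    have hi3 : Integrable (fun t ↦ ∫ x, ψ (t, x) ∂(κ t)) m :=
      integrable_of_abs_le hκm fun t ↦ abs_integral_le_of_abs_le fun x ↦ hψC (t, x)
    have hi4 : Integrable (fun t ↦ ∫ x, Real.exp (ψ (t, x)) ∂ξ) m := hi2.integral_prod_left
    have e1 : (1 : ℝ) = ∫ _t : β, (1 : ℝ) ∂m := by simp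
    have hi34 : Integrable (fun t ↦ ∫ x, ψ (t, x) ∂(κ t) - ∫ x, Real.exp (ψ (t, x)) ∂ξ) m :=
      hi3.sub hi4
    rw [e1, ← integral_sub hi3 hi4, ← integral_add hi34 (integrable_const 1)]
    have : ∫ _t : β, B ∂m = B := by simp
    rw [← this]
    refine integral_mono_ae (hi34.add (integrable_const 1)) (integrable_const B) ?_
    refine (ae_map_iff hθ.aemeasurable
      (measurableSet_le ((hκm.sub hξm).add_const 1) measurable_const)).mpr ?_
    filter_upwards [hB] with ω ht
    refine (integral_sub_integral_exp_le_klDiv (P := κ (θ ω)) (Q := ξ)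
      (φ := fun x ↦ ψ (θ ω, x))
      (C := C + C) (hψm.comp measurable_prodMk_left) (fun x ↦ hψC _)
      (ne_top_of_le_ne_top ENNReal.ofReal_ne_top ht)).trans ?_
    exact ENNReal.toReal_le_of_le_ofReal hB0 ht
  have hφi : Integrable φ (m ⊗ₘ κ) := integrable_of_abs_le hφ hC
  have hlogi : Integrable (fun p : β × α ↦ Real.log (Z p.2)) (m ⊗ₘ κ) :=
    integrable_of_abs_le (hZm.comp measurable_snd).log fun p ↦ hlogC _
  have h3 : ∫ p, ψ p ∂(m ⊗ₘ κ) = ∫ p, φ p ∂(m ⊗ₘ κ) - ∫ x, Real.log (Z x) ∂(m ⊗ₘ κ).snd := by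
    simp only [ψ]
    rw [integral_sub hφi hlogi, Measure.snd, integral_map measurable_snd.aemeasurable
      hZm.log.aestronglyMeasurable]
  -- The inequality `log Z ≤ Z - 1` under the true output law restores the exponential integral of
  -- `φ`.
  have h4 : ∫ x, Real.log (Z x) ∂(m ⊗ₘ κ).snd ≤ ∫ x, Z x ∂(m ⊗ₘ κ).snd - 1 := by
    have hZi : Integrable Z (m ⊗ₘ κ).snd := integrable_of_abs_le hZm (C := Real.exp C) fun x ↦ by
      rw [abs_of_pos (hZpos x)]; exact hZle x
    have e1 : (1 : ℝ) = ∫ _x : α, (1 : ℝ) ∂(m ⊗ₘ κ).snd := by simp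
    rw [e1, ← integral_sub hZi (integrable_const 1)]
    exact integral_mono (integrable_of_abs_le hZm.log hlogC) (hZi.sub (integrable_const 1))
      fun x ↦ Real.log_le_sub_one_of_pos (hZpos x)
  have h5 : ∫ p, Real.exp (φ p) ∂(m.prod (m ⊗ₘ κ).snd) = ∫ x, Z x ∂(m ⊗ₘ κ).snd :=
    integral_prod_symm _ (integrable_of_abs_le hφ.exp hexpC)
  rw [h5]
  rw [h1, h3] at h2
  linarith

end KullbackLeibler

/-! ### Uniform mixtures of finitely many measures -/

section UniformMixture

variable {α β ι : Type*} [MeasurableSpace α] [MeasurableSpace β] [Fintype ι]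

/-- The uniform mixture of a finite family of measures. -/
def uniformMixture (P : ι → Measure α) : Measure α := (Fintype.card ι : ℝ≥0∞)⁻¹ • ∑ s, P s

lemma uniformMixture_apply (P : ι → Measure α) (A : Set α) :
    uniformMixture P A = (Fintype.card ι : ℝ≥0∞)⁻¹ * ∑ s, P s A := by
  simp [uniformMixture]

lemma lintegral_uniformMixture (P : ι → Measure α) (f : α → ℝ≥0∞) :
    ∫⁻ x, f x ∂(uniformMixture P) = (Fintype.card ι : ℝ≥0∞)⁻¹ * ∑ s, ∫⁻ x, f x ∂(P s) := by
  simp [uniformMixture, lintegral_smul_measure, lintegral_finsetSum_measure]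

lemma integral_uniformMixture (P : ι → Measure α) {f : α → ℝ} (hf : ∀ s, Integrable f (P s)) :
    ∫ x, f x ∂(uniformMixture P) = (Fintype.card ι : ℝ)⁻¹ * ∑ s, ∫ x, f x ∂(P s) := by
  rw [uniformMixture, integral_smul_measure, integral_finsetSum_measure fun s _ ↦ hf s]
  simp

lemma map_uniformMixture (P : ι → Measure α) {g : α → β} (hg : Measurable g) :
    (uniformMixture P).map g = uniformMixture fun s ↦ (P s).map g := by
  ext A hA
  simp [Measure.map_apply hg hA, uniformMixture_apply]

lemma withDensity_uniformMixture (P : ι → Measure α) (f : α → ℝ≥0∞) :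
    (uniformMixture P).withDensity f = uniformMixture fun s ↦ (P s).withDensity f := by
  ext A hA
  simp_rw [withDensity_apply _ hA, uniformMixture_apply, withDensity_apply _ hA]
  rw [← lintegral_indicator hA, lintegral_uniformMixture]
  simp_rw [lintegral_indicator hA]

lemma uniformMixture_withDensity (ν : Measure α) {f : ι → α → ℝ≥0∞} (hf : ∀ s, Measurable (f s)) :
    (uniformMixture fun s ↦ ν.withDensity (f s)) =
      ν.withDensity fun x ↦ (Fintype.card ι : ℝ≥0∞)⁻¹ * ∑ s, f s x := by
  ext A hA
  simp_rw [uniformMixture_apply, withDensity_apply _ hA]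
  rw [lintegral_const_mul _ (Finset.measurable_sum _ fun s _ ↦ hf s),
    lintegral_finsetSum _ fun s _ ↦ hf s]

lemma uniformMixture_perm_apply {n : ℕ} (P : Fin n → Measure α) (i : Fin n) :
    (uniformMixture fun σ : Equiv.Perm (Fin n) ↦ P (σ i)) = uniformMixture P := by
  ext A _
  rw [uniformMixture_apply, uniformMixture_apply, Fintype.card_perm, Fintype.card_fin]
  exact inv_factorial_mul_sum_perm_apply (fun j ↦ P j A) i

variable [Nonempty ι]

lemma card_ne_zero : (Fintype.card ι : ℝ≥0∞) ≠ 0 := by simp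

instance isProbabilityMeasure_uniformMixture (P : ι → Measure α)
    [∀ s, IsProbabilityMeasure (P s)] : IsProbabilityMeasure (uniformMixture P) := by
  constructor
  rw [uniformMixture_apply]
  simp [ENNReal.inv_mul_cancel (card_ne_zero (ι := ι))]

lemma le_card_smul_uniformMixture (P : ι → Measure α) (s : ι) :
    P s ≤ (Fintype.card ι : ℝ≥0∞) • uniformMixture P := by
  refine Measure.le_intro fun A hA _ ↦ ?_
  rw [Measure.smul_apply, uniformMixture_apply, smul_eq_mul, ← mul_assoc,
    ENNReal.mul_inv_cancel card_ne_zero (by simp), one_mul]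
  exact Finset.single_le_sum (f := fun s ↦ P s A) (fun _ _ ↦ zero_le) (Finset.mem_univ s)

lemma absolutelyContinuous_uniformMixture (P : ι → Measure α) (s : ι) :
    P s ≪ uniformMixture P :=
  (le_card_smul_uniformMixture P s).absolutelyContinuous.trans
    Measure.smul_absolutelyContinuous

end UniformMixture

/-! ### The permutation mixture as a measure -/

section DensityFamily

variable {α : Type*} [MeasurableSpace α] {n : ℕ}

/-- The densities of finitely many probability measures with respect to their average. -/
lemma exists_isDensityFamily [NeZero n] (P : Fin n → Measure α) [∀ i, IsProbabilityMeasure (P i)] :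
    ∃ ρ : Fin n → α → ℝ, IsDensityFamily (uniformMixture P) ρ ∧
      (∀ j, memberLaw (uniformMixture P) ρ j = P j) ∧ ∀ i j, P i = P j → ρ i = ρ j := by
  classical
  set ν := uniformMixture P with hν
  let g : Measure α → α → ℝ := fun R x ↦ (R.rnDeriv ν x).toReal
  have hg : ∀ R, Measurable (g R) := fun R ↦ (Measure.measurable_rnDeriv R ν).ennreal_toReal
  have hac : ∀ j, P j ≪ ν := fun j ↦ absolutelyContinuous_uniformMixture P j
  -- The Radon–Nikodym derivatives sum to `n` only almost everywhere. On the exceptional null set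
  -- they are all replaced by `1`, so that the sum is `n` at every point.
  let N : Set α := {x | ∑ j, g (P j) x ≠ n}
  have hN : MeasurableSet N :=
    ((measurableSet_eq_fun (Finset.measurable_sum _ fun j _ ↦ hg (P j)) measurable_const)).compl
  have hn : (n : ℝ≥0∞) ≠ 0 := by simp [NeZero.ne n]
  have hsum : ν.withDensity (fun x ↦ (n : ℝ≥0∞)⁻¹ * ∑ j, (P j).rnDeriv ν x) =
      ν.withDensity fun _ ↦ 1 := by
    have h1 := uniformMixture_withDensity (ι := Fin n) ν
      (f := fun j ↦ (P j).rnDeriv ν) fun j ↦ Measure.measurable_rnDeriv _ _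
    rw [Fintype.card_fin] at h1
    rw [← h1]
    simp_rw [Measure.withDensity_rnDeriv_eq _ _ (hac _)]
    exact withDensity_one.symm
  have hsum' := (withDensity_eq_iff_of_sigmaFinite
    ((Finset.measurable_sum _ fun j _ ↦ Measure.measurable_rnDeriv _ _).const_mul _).aemeasurable
    aemeasurable_const).mp hsum
  have hlt : ∀ᵐ x ∂ν, ∀ j, (P j).rnDeriv ν x < ∞ :=
    ae_all_iff.mpr fun j ↦ Measure.rnDeriv_lt_top _ _
  have hnull : ∀ᵐ x ∂ν, x ∉ N := by
    filter_upwards [hsum', hlt] with x hx hxlt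
    simp only [N, Set.mem_ofPred_eq, not_not, g]
    rw [← ENNReal.toReal_sum fun j _ ↦ (hxlt j).ne]
    have : ∑ j, (P j).rnDeriv ν x = n := by
      rw [← ENNReal.mul_right_inj (ENNReal.inv_ne_zero.mpr (by simp : (n : ℝ≥0∞) ≠ ∞))
        (ENNReal.inv_ne_top.mpr hn), hx, ENNReal.inv_mul_cancel hn (by simp)]
    rw [this, ENNReal.toReal_natCast]
  -- The modified density depends on the measure and not on the index, so equal measures get
  -- identical densities.
  let G : Measure α → α → ℝ := fun R ↦ N.piecewise (fun _ ↦ 1) (g R)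
  have hG : ∀ R, G R =ᵐ[ν] g R := fun R ↦ by
    filter_upwards [hnull] with x hx
    exact Set.piecewise_eq_of_notMem _ _ _ hx
  refine ⟨fun j ↦ G (P j), ⟨fun j ↦ ?_, fun j x ↦ ?_, fun x ↦ ?_, fun j ↦ ?_⟩, fun j ↦ ?_,
    fun i j hij ↦ by simp only [hij]⟩
  · exact measurable_const.piecewise hN (hg _)
  · by_cases hx : x ∈ N
    · simp [G, hx]
    · simp [G, hx, g]
  · by_cases hx : x ∈ N
    · simp [G, hx]
    · simp only [G, Set.piecewise_eq_of_notMem _ _ _ hx]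
      simpa [N] using hx
  · rw [integral_congr_ae (hG _), Measure.integral_toReal_rnDeriv (hac j)]
    simp
  · refine Eq.trans ?_ (Measure.withDensity_rnDeriv_eq _ _ (hac j))
    refine withDensity_congr_ae ?_
    filter_upwards [hG (P j), hlt] with x hx hxlt
    rw [hx, ENNReal.ofReal_toReal (hxlt j).ne]

/-- The law of the permutation mixture. -/
def mixLaw (ν : Measure α) (ρ : Fin n → α → ℝ) : Measure (Fin n → α) :=
  (Measure.pi fun _ ↦ ν).withDensity fun x ↦ ENNReal.ofReal (mixDensity ρ Finset.univ x)

variable {ν : Measure α} [IsProbabilityMeasure ν] {ρ : Fin n → α → ℝ}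

namespace IsDensityFamily

variable (h : IsDensityFamily ν ρ)
include h

lemma isProbabilityMeasure_mixLaw : IsProbabilityMeasure (mixLaw ν ρ) := by
  constructor
  rw [mixLaw, withDensity_apply _ MeasurableSet.univ, Measure.restrict_univ,
    ← ofReal_integral_eq_lintegral_ofReal (f := mixDensity ρ Finset.univ)
      (h.integrable_comp_mixDensity Finset.univ continuous_id)
      (Filter.Eventually.of_forall (h.mixDensity_nonneg Finset.univ)),
    h.integral_mixDensity, ENNReal.ofReal_one]

lemma pi_memberLaw (σ : Fin n → Fin n) :
    Measure.pi (fun i ↦ memberLaw ν ρ (σ i)) = (Measure.pi fun _ : Fin n ↦ ν).withDensity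
      fun x ↦ ENNReal.ofReal (∏ i, ρ (σ i) (x i)) := by
  have := h.pi_coordLaw Finset.univ σ
  rw [← this]
  congr 1
  funext i
  simp [coordLaw]

lemma uniformMixture_pi_memberLaw :
    (uniformMixture fun σ : Equiv.Perm (Fin n) ↦ Measure.pi fun i ↦ memberLaw ν ρ (σ i)) =
      mixLaw ν ρ := by
  simp_rw [h.pi_memberLaw]
  rw [uniformMixture_withDensity _ fun (σ : Equiv.Perm (Fin n)) ↦
    (h.measurable_prod Finset.univ σ).ennreal_ofReal, mixLaw]
  congr 1
  funext x
  rw [mixDensity, ENNReal.ofReal_mul (by positivity), ENNReal.ofReal_inv_of_pos (by positivity),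
    ENNReal.ofReal_natCast, Fintype.card_perm, Fintype.card_fin,
    ENNReal.ofReal_sum_of_nonneg fun σ _ ↦ h.prod_nonneg _ _ _]

lemma uniformMixture_memberLaw [NeZero n] : uniformMixture (memberLaw ν ρ) = ν := by
  have h1 := uniformMixture_withDensity (ι := Fin n) ν
    (f := fun j y ↦ ENNReal.ofReal (ρ j y)) fun j ↦ (h.measurable j).ennreal_ofReal
  change uniformMixture (memberLaw ν ρ) = _ at h1
  rw [h1, ← withDensity_one (μ := ν)]
  conv_lhs => rw [withDensity_one (μ := ν)]
  congr 1
  funext x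
  rw [← ENNReal.ofReal_sum_of_nonneg fun j _ ↦ h.nonneg j x, h.sum_eq, ENNReal.ofReal_natCast,
    Fintype.card_fin, Pi.one_apply]
  exact ENNReal.inv_mul_cancel (by simp [NeZero.ne n]) (by simp)

lemma measurePreserving_eval_mixLaw [NeZero n] (i : Fin n) :
    MeasurePreserving (Function.eval i) (mixLaw ν ρ) ν := by
  refine ⟨measurable_pi_apply i, ?_⟩
  have := h.isProbabilityMeasure_memberLaw
  rw [← h.uniformMixture_pi_memberLaw, map_uniformMixture _ (measurable_pi_apply i)]
  have e : ∀ σ : Equiv.Perm (Fin n), (Measure.pi fun i ↦ memberLaw ν ρ (σ i)).map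
      (Function.eval i) = memberLaw ν ρ (σ i) := fun σ ↦
    (measurePreserving_eval (fun i ↦ memberLaw ν ρ (σ i)) i).map_eq
  simp_rw [e]
  rw [uniformMixture_perm_apply, h.uniformMixture_memberLaw]

lemma mixDensity_ne_zero_ae : ∀ᵐ x ∂(mixLaw ν ρ), mixDensity ρ Finset.univ x ≠ 0 := by
  rw [mixLaw, ae_withDensity_iff (h.measurable_mixDensity _).ennreal_ofReal]
  refine Filter.Eventually.of_forall fun x hx h0 ↦ hx ?_
  rw [h0, ENNReal.ofReal_zero]

lemma integrable_log_mixDensity :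
    Integrable (fun x ↦ Real.log (mixDensity ρ Finset.univ x)) (mixLaw ν ρ) := by
  rw [mixLaw, integrable_withDensity_iff_integrable_smul'
    (h.measurable_mixDensity _).ennreal_ofReal (by simp)]
  refine (h.integrable_comp_mixDensity Finset.univ Real.continuous_mul_log).congr
    (Filter.Eventually.of_forall fun x ↦ ?_)
  simp [ENNReal.toReal_ofReal (h.mixDensity_nonneg _ x)]

lemma integral_log_mixDensity :
    ∫ x, Real.log (mixDensity ρ Finset.univ x) ∂(mixLaw ν ρ) = mixEntropy ν ρ Finset.univ := by
  rw [mixLaw, integral_withDensity_eq_integral_toReal_smul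
    (h.measurable_mixDensity _).ennreal_ofReal (by simp)]
  refine integral_congr_ae (Filter.Eventually.of_forall fun x ↦ ?_)
  simp [ENNReal.toReal_ofReal (h.mixDensity_nonneg _ x)]

lemma mixEntropy_nonneg : 0 ≤ mixEntropy ν ρ Finset.univ := by
  have := h.isProbabilityMeasure_mixLaw
  have h1 := (klDiv_withDensity (Measure.pi fun _ : Fin n ↦ ν) (h.measurable_mixDensity _)
    (h.mixDensity_nonneg _) (P := mixLaw ν ρ) rfl h.integrable_log_mixDensity).2
  rw [h.integral_log_mixDensity] at h1
  rw [← h1]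
  exact ENNReal.toReal_nonneg

/-- The log-density splits as the sum of the `log (D (x i))` plus the logarithm of `q`, and since
all marginals are `ν`, each summand integrates to `KL(ν ‖ Q)`. -/
lemma klDiv_mixLaw_le [NeZero n] (Q : Measure α) [IsProbabilityMeasure Q]
    (hQ : klDiv ν Q ≠ ∞) :
    klDiv (mixLaw ν ρ) (Measure.pi fun _ ↦ Q) ≠ ∞ ∧
      (klDiv (mixLaw ν ρ) (Measure.pi fun _ ↦ Q)).toReal =
        mixEntropy ν ρ Finset.univ + n * (klDiv ν Q).toReal := by
  have hprob := h.isProbabilityMeasure_mixLaw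
  obtain ⟨hac, hint⟩ := klDiv_ne_top_iff.mp hQ
  let D : α → ℝ := fun y ↦ (ν.rnDeriv Q y).toReal
  have hD : Measurable D := (Measure.measurable_rnDeriv ν Q).ennreal_toReal
  have hD0 : ∀ y, 0 ≤ D y := fun y ↦ ENNReal.toReal_nonneg
  have hνD : ν = Q.withDensity fun y ↦ ENNReal.ofReal (D y) := by
    conv_lhs => rw [← Measure.withDensity_rnDeriv_eq ν Q hac]
    refine withDensity_congr_ae ?_
    filter_upwards [Measure.rnDeriv_lt_top ν Q] with y hy
    rw [ENNReal.ofReal_toReal hy.ne]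
  have hpi : (Measure.pi fun _ : Fin n ↦ ν) = (Measure.pi fun _ : Fin n ↦ Q).withDensity
      fun x ↦ ENNReal.ofReal (∏ i, D (x i)) := by
    have : SigmaFinite (Q.withDensity fun y ↦ ENNReal.ofReal (D y)) := by
      rw [← hνD]; infer_instance
    conv_lhs => rw [hνD]
    rw [pi_withDensity (fun _ : Fin n ↦ Q) (fun _ y ↦ ENNReal.ofReal (D y))
      fun _ ↦ hD.ennreal_ofReal]
    congr 1
    funext x
    rw [ENNReal.ofReal_prod_of_nonneg fun i _ ↦ hD0 _]
  have hprodm : Measurable fun x : Fin n → α ↦ ∏ i, D (x i) :=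
    Finset.measurable_prod _ fun i _ ↦ hD.comp (measurable_pi_apply i)
  have hmix : mixLaw ν ρ = (Measure.pi fun _ : Fin n ↦ Q).withDensity
      fun x ↦ ENNReal.ofReal ((∏ i, D (x i)) * mixDensity ρ Finset.univ x) := by
    rw [mixLaw, hpi, ← withDensity_mul _ hprodm.ennreal_ofReal
      (h.measurable_mixDensity _).ennreal_ofReal]
    congr 1
    funext x
    rw [Pi.mul_apply, ENNReal.ofReal_mul (Finset.prod_nonneg fun i _ ↦ hD0 _)]
  have hDpos : ∀ᵐ y ∂ν, D y ≠ 0 := by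
    suffices ∀ᵐ y ∂(Q.withDensity fun y ↦ ENNReal.ofReal (D y)), D y ≠ 0 by rwa [← hνD] at this
    rw [ae_withDensity_iff hD.ennreal_ofReal]
    refine Filter.Eventually.of_forall fun x hx h0 ↦ hx ?_
    rw [h0, ENNReal.ofReal_zero]
  have hDpos' : ∀ᵐ x ∂(mixLaw ν ρ), ∀ i, D (x i) ≠ 0 := ae_all_iff.mpr fun i ↦
    (h.measurePreserving_eval_mixLaw i).quasiMeasurePreserving.ae hDpos
  have hlog : (fun x ↦ Real.log ((∏ i, D (x i)) * mixDensity ρ Finset.univ x)) =ᵐ[mixLaw ν ρ]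
      fun x ↦ ∑ i, Real.log (D (x i)) + Real.log (mixDensity ρ Finset.univ x) := by
    filter_upwards [hDpos', h.mixDensity_ne_zero_ae] with x h1 h2
    rw [Real.log_mul (Finset.prod_ne_zero_iff.mpr fun i _ ↦ h1 i) h2,
      Real.log_prod fun i _ ↦ h1 i]
  have hint' : Integrable (fun y ↦ Real.log (D y)) ν := hint
  have hi : ∀ i, Integrable (fun x : Fin n → α ↦ Real.log (D (x i))) (mixLaw ν ρ) := fun i ↦
    ((h.measurePreserving_eval_mixLaw i).integrable_comp hint'.aestronglyMeasurable).mpr hint'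
  have hi' : Integrable (fun x : Fin n → α ↦ ∑ i, Real.log (D (x i))) (mixLaw ν ρ) :=
    integrable_finsetSum _ fun i _ ↦ hi i
  obtain ⟨h1, h2⟩ := klDiv_withDensity (Measure.pi fun _ : Fin n ↦ Q)
    (d := fun x ↦ (∏ i, D (x i)) * mixDensity ρ Finset.univ x)
    (hprodm.mul (h.measurable_mixDensity _))
    (fun x ↦ mul_nonneg (Finset.prod_nonneg fun i _ ↦ hD0 _) (h.mixDensity_nonneg _ x)) hmix
    ((hi'.add h.integrable_log_mixDensity).congr hlog.symm)
  refine ⟨h1, ?_⟩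
  rw [h2, integral_congr_ae hlog, integral_add hi' h.integrable_log_mixDensity,
    h.integral_log_mixDensity, integral_finsetSum _ fun i _ ↦ hi i]
  have e : ∀ i : Fin n, ∫ x, Real.log (D (x i)) ∂(mixLaw ν ρ) = (klDiv ν Q).toReal := fun i ↦ by
    rw [toReal_klDiv_of_measure_eq hac (by simp)]
    have hm := h.measurePreserving_eval_mixLaw i
    have h3 := integral_map (μ := mixLaw ν ρ) hm.measurable.aemeasurable
      (f := fun y ↦ Real.log (D y)) (by rw [hm.map_eq]; exact hint'.aestronglyMeasurable)
    rw [hm.map_eq] at h3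
    exact h3.symm
  simp [e]
  ring

end IsDensityFamily

end DensityFamily

/-! ### The entropy bound in terms of the Hellinger singularity -/

section Singularity

variable {α : Type*} [MeasurableSpace α] {n : ℕ} {ν : Measure α} [IsProbabilityMeasure ν]
  {ρ : Fin n → α → ℝ} {𝓜 : Set (Measure α)}

lemma meanChiSq_nonneg : 0 ≤ meanChiSq ν ρ :=
  div_nonneg (Finset.sum_nonneg fun _ _ ↦ integral_nonneg fun _ ↦ sq_nonneg _) (Nat.cast_nonneg n)

lemma one_le_hellingerSingularity : 1 ≤ hellingerSingularity 𝓜 := by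
  rw [hellingerSingularity, ENNReal.one_le_inv]
  exact pow_le_one₀ zero_le tsub_le_self

lemma zero_le_one_add_log_hellingerSingularity :
    0 ≤ 1 + ENNReal.log (hellingerSingularity 𝓜) :=
  add_nonneg zero_le_one (ENNReal.zero_le_log_iff.mpr one_le_hellingerSingularity)

lemma IsDensityFamily.mixEntropy_le_mul_log_hellingerSingularity [NeZero n]
    (h : IsDensityFamily ν ρ) (h𝓜 : ∀ j, memberLaw ν ρ j ∈ 𝓜) :
    (mixEntropy ν ρ Finset.univ : EReal) ≤
      (meanChiSq ν ρ : EReal) * (1 + ENNReal.log (hellingerSingularity 𝓜)) := by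
  have hprob := h.isProbabilityMeasure_memberLaw
  rcases le_or_gt 2 (hellingerDiam 𝓜) with hd | hd
  · have h0 : 1 - hellingerDiam 𝓜 / 2 = 0 := by
      refine tsub_eq_zero_of_le ?_
      rw [ENNReal.le_div_iff_mul_le (by simp) (by simp), one_mul]
      exact hd
    have hs : hellingerSingularity 𝓜 = ∞ := by simp [hellingerSingularity, h0]
    rw [hs, ENNReal.log_top, EReal.add_top_of_ne_bot (by decide)]
    -- The singularity is infinite here. With `0 * ⊤ = 0`, the case of zero `χ²` still demands a
    -- nonpositive entropy, which the power bound provides.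
    rcases (meanChiSq_nonneg (ν := ν) (ρ := ρ)).eq_or_lt with hx | hx
    · have h1 := h.mixEntropy_le_sum_pow
      rw [← hx] at h1 ⊢
      rw [Finset.sum_eq_zero fun l hl ↦ zero_pow (by have := (Finset.mem_Icc.mp hl).1; omega),
        mul_zero] at h1
      rw [EReal.coe_zero, zero_mul]
      exact_mod_cast h1
    · rw [EReal.mul_top_of_pos (by exact_mod_cast hx)]
      exact le_top
  · set D := (hellingerDiam 𝓜).toReal with hD
    have hDof : hellingerDiam 𝓜 = ENNReal.ofReal D :=
      (ENNReal.ofReal_toReal (hd.trans_le le_top).ne).symm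
    have hD0 : 0 ≤ D := ENNReal.toReal_nonneg
    have hD2 : D < 2 := by
      rw [hDof] at hd
      exact (ENNReal.ofReal_lt_ofNat).mp hd
    set δ := 1 - D / 2 with hδ
    have hδ0 : 0 < δ := by linarith
    have hδ1 : δ ≤ 1 := by linarith
    have hinv : 1 ≤ (δ ^ 2)⁻¹ := (one_le_inv₀ (by positivity)).mpr (pow_le_one₀ hδ0.le hδ1)
    have hs : hellingerSingularity 𝓜 = ENNReal.ofReal (δ ^ 2)⁻¹ := by
      have h2 : (2 : ℝ≥0∞) = ENNReal.ofReal 2 := by simp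
      rw [hellingerSingularity, hDof, h2, ← ENNReal.ofReal_div_of_pos two_pos, ← ENNReal.ofReal_one,
        ← ENNReal.ofReal_sub _ (by positivity), ← ENNReal.ofReal_pow hδ0.le,
        ENNReal.ofReal_inv_of_pos (by positivity)]
    have hvar : HasVarianceBound ν ρ (2 * (δ ^ 2)⁻¹ - 1) := fun j k u C hu hC ↦ by
      refine sq_sub_le_of_hellingerSq_le hδ0 hδ1 ?_ hu hC
      have e : 2 - 2 * δ = D := by rw [hδ]; ring
      rw [e, ← hDof]
      exact le_iSup₂_of_le _ (h𝓜 j) (le_iSup₂_of_le _ (h𝓜 k) le_rfl)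
    have h1 := h.mixEntropy_le_log (L := 2 * (δ ^ 2)⁻¹ - 1) (by linarith) (NeZero.pos n) hvar
    rw [hs, ENNReal.log_ofReal_of_pos (by positivity)]
    have e : 1 + (2 * (δ ^ 2)⁻¹ - 1) = 2 * (δ ^ 2)⁻¹ := by ring
    rw [e, Real.log_mul two_ne_zero (by positivity)] at h1
    -- The factor `2` in `1 + L = 2 / δ²` costs only `log 2 ≤ 1`.
    have h2 : mixEntropy ν ρ Finset.univ ≤ meanChiSq ν ρ * (1 + Real.log (δ ^ 2)⁻¹) :=
      h1.trans (mul_le_mul_of_nonneg_left (by linarith [Real.log_two_lt_d9]) meanChiSq_nonneg)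
    exact_mod_cast h2

end Singularity

/-! ### Mutual information for finitely many inputs -/

section FiniteInput

variable {β γ ι Ω : Type*} [MeasurableSpace β] [MeasurableSpace γ] [MeasurableSpace Ω]
  [Fintype ι] [Nonempty ι] {a : ι → β} {P : ι → Measure γ} [∀ s, IsProbabilityMeasure (P s)]

lemma withDensity_dirac_prod (b : β) (Q : Measure γ) [SFinite Q] {f : β × γ → ℝ≥0∞}
    (hf : Measurable f) : ((Measure.dirac b).prod Q).withDensity f =
      (Q.withDensity fun x ↦ f (b, x)).map (Prod.mk b) := by
  ext A hA
  rw [withDensity_apply _ hA, Measure.dirac_prod, setLIntegral_map hA hf measurable_prodMk_left,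
    Measure.map_apply measurable_prodMk_left hA,
    withDensity_apply _ (measurable_prodMk_left hA)]

lemma uniformMixture_prod (R : ι → Measure β) [∀ s, IsProbabilityMeasure (R s)] (Q : Measure γ)
    [IsProbabilityMeasure Q] :
    (uniformMixture R).prod Q = uniformMixture fun s ↦ (R s).prod Q := by
  ext A hA
  rw [Measure.prod_apply hA, lintegral_uniformMixture, uniformMixture_apply]
  simp_rw [Measure.prod_apply hA]

/-- The joint law of an input which is uniform among the points `a s` and of the output of a
channel which sends `a s` to a random variable with law `P s`. -/
def jointLaw (a : ι → β) (P : ι → Measure γ) : Measure (β × γ) :=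
  uniformMixture fun s ↦ (Measure.dirac (a s)).prod (P s)

lemma fst_jointLaw : (jointLaw a P).fst = uniformMixture fun s ↦ Measure.dirac (a s) := by
  rw [Measure.fst, jointLaw, map_uniformMixture _ measurable_fst]
  congr 1
  funext s
  exact Measure.fst_prod

lemma snd_jointLaw : (jointLaw a P).snd = uniformMixture P := by
  rw [Measure.snd, jointLaw, map_uniformMixture _ measurable_snd]
  congr 1
  funext s
  exact Measure.snd_prod

variable {r : β × γ → ℝ}

/-- Only the values of `r` at the inputs `a s` matter. A jointly measurable `r` is used because
singletons of `β` need not be measurable. -/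
lemma jointLaw_eq_withDensity (hr : Measurable r) (hP : ∀ s, P s =
      (uniformMixture P).withDensity fun x ↦ ENNReal.ofReal (r (a s, x))) :
    jointLaw a P = ((uniformMixture fun s ↦ Measure.dirac (a s)).prod
      (uniformMixture P)).withDensity fun p ↦ ENNReal.ofReal (r p) := by
  rw [uniformMixture_prod, withDensity_uniformMixture, jointLaw]
  congr 1
  funext s
  rw [withDensity_dirac_prod _ _ hr.ennreal_ofReal, ← hP s, Measure.dirac_prod]

variable {μ : Measure Ω} {U : Ω → β} {V : Ω → γ}

lemma map_prod_map_of_jointLaw (hU : Measurable U) (hV : Measurable V)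
    (hJ : μ.map (fun ω ↦ (U ω, V ω)) = jointLaw a P) :
    (μ.map U).prod (μ.map V) =
      (uniformMixture fun s ↦ Measure.dirac (a s)).prod (uniformMixture P) := by
  rw [← fst_jointLaw (a := a) (P := P), ← snd_jointLaw (a := a) (P := P), ← hJ,
    Measure.fst_map_prodMk hV, Measure.snd_map_prodMk hU]

/-- The mutual information of the input and the output of a channel with finitely many inputs. -/
lemma mutualInfo_of_jointLaw (hU : Measurable U) (hV : Measurable V)
    (hJ : μ.map (fun ω ↦ (U ω, V ω)) = jointLaw a P) (hr : Measurable r) (hr0 : ∀ p, 0 ≤ r p)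
    (hP : ∀ s, P s = (uniformMixture P).withDensity fun x ↦ ENNReal.ofReal (r (a s, x)))
    (hi : ∀ s, Integrable (fun x ↦ Real.log (r (a s, x))) (P s)) :
    mutualInfo μ U V ≠ ∞ ∧ (mutualInfo μ U V).toReal =
      (Fintype.card ι : ℝ)⁻¹ * ∑ s, ∫ x, Real.log (r (a s, x)) ∂(P s) := by
  have hprob : IsProbabilityMeasure (jointLaw a P) := isProbabilityMeasure_uniformMixture _
  have hs : ∀ s, Integrable (fun p ↦ Real.log (r p)) ((Measure.dirac (a s)).prod (P s)) :=
    fun s ↦ by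
      rw [Measure.dirac_prod, integrable_map_measure hr.log.aestronglyMeasurable
        measurable_prodMk_left.aemeasurable]
      exact hi s
  have hiJ : Integrable (fun p ↦ Real.log (r p)) (jointLaw a P) := by
    rw [jointLaw, uniformMixture]
    exact ((integrable_finsetSum_measure).mpr fun s _ ↦ hs s).smul_measure
      (ENNReal.inv_ne_top.mpr card_ne_zero)
  rw [mutualInfo, map_prod_map_of_jointLaw hU hV hJ, hJ]
  obtain ⟨h1, h2⟩ := klDiv_withDensity _ hr hr0 (jointLaw_eq_withDensity hr hP) hiJ
  refine ⟨h1, ?_⟩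
  rw [h2, jointLaw, integral_uniformMixture _ hs]
  congr 1
  refine Finset.sum_congr rfl fun s _ ↦ ?_
  rw [Measure.dirac_prod, integral_map measurable_prodMk_left.aemeasurable
    hr.log.aestronglyMeasurable]

/-- The `χ²` mutual information of the input and the output of a channel with finitely many
inputs. -/
lemma chiSqInfo_of_jointLaw (hU : Measurable U) (hV : Measurable V)
    (hJ : μ.map (fun ω ↦ (U ω, V ω)) = jointLaw a P) (hr : Measurable r) (hr0 : ∀ p, 0 ≤ r p)
    (hP : ∀ s, P s = (uniformMixture P).withDensity fun x ↦ ENNReal.ofReal (r (a s, x))) :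
    chiSqInfo μ U V = (Fintype.card ι : ℝ≥0∞)⁻¹ *
      ∑ s, ∫⁻ x, ENNReal.ofReal ((r (a s, x) - 1) ^ 2) ∂(uniformMixture P) := by
  have hJd := jointLaw_eq_withDensity hr hP
  rw [chiSqInfo, map_prod_map_of_jointLaw hU hV hJ, hJ, chiSqDiv,
    if_pos (hJd ▸ withDensity_absolutelyContinuous _ _)]
  have hae := toReal_rnDeriv_withDensity_ofReal_ae
    ((uniformMixture fun s ↦ Measure.dirac (a s)).prod (uniformMixture P)) hr hr0
  rw [← hJd] at hae
  rw [lintegral_congr_ae (g := fun p ↦ ENNReal.ofReal ((r p - 1) ^ 2))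
    (hae.mono fun p hp ↦ by simp only [hp]), uniformMixture_prod, lintegral_uniformMixture]
  congr 1
  refine Finset.sum_congr rfl fun s _ ↦ ?_
  rw [Measure.dirac_prod, lintegral_map ((hr.sub_const 1).pow_const 2).ennreal_ofReal
    measurable_prodMk_left]

end FiniteInput

/-! ### Laws of the noisy permutation channel -/

section ChannelLaws

variable {T α Ω : Type*} [MeasurableSpace T] [MeasurableSpace α] [MeasurableSpace Ω]
  {K : Kernel T α} [IsMarkovKernel K] {n : ℕ}

lemma uniformOn_univ_perm (n : ℕ) :
    (uniformOn Set.univ : Measure (Equiv.Perm (Fin n))) = uniformMixture Measure.dirac := by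
  ext A hA
  rw [uniformOn_univ, Measure.count, Measure.sum_fintype, uniformMixture_apply,
    Measure.finsetSum_apply, ENNReal.div_eq_inv_mul]

lemma measurable_comp_perm (σ : Equiv.Perm (Fin n)) : Measurable fun t : Fin n → T ↦ t ∘ σ :=
  measurable_pi_lambda _ fun i ↦ measurable_pi_apply (σ i)

variable (K n) in
/-- The law of the observations given the parameter vector, before its permutation. -/
def permutedKernel : Kernel (Fin n → T) (Fin n → α) where
  toFun t := uniformMixture fun σ : Equiv.Perm (Fin n) ↦ productKernel K n (t ∘ σ)
  measurable' := by
    refine Measure.measurable_of_measurable_coe _ fun A hA ↦ ?_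
    simp_rw [uniformMixture_apply]
    exact (Finset.measurable_sum _ fun σ _ ↦
      ((productKernel K n).measurable_coe hA).comp (measurable_comp_perm σ)).const_mul _

lemma permutedKernel_apply (t : Fin n → T) : permutedKernel K n t =
    uniformMixture fun σ : Equiv.Perm (Fin n) ↦ Measure.pi fun i ↦ K (t (σ i)) := rfl

instance : IsMarkovKernel (permutedKernel K n) :=
  ⟨fun t ↦ inferInstanceAs (IsProbabilityMeasure
    (uniformMixture fun σ : Equiv.Perm (Fin n) ↦ productKernel K n (t ∘ σ)))⟩

namespace IsNoisyPermutation

variable {μ : Measure Ω} [IsProbabilityMeasure μ] {θ : Ω → Fin n → T}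
  {π : Ω → Equiv.Perm (Fin n)} {X : Ω → Fin n → α}

lemma measurable_permuted (h : IsNoisyPermutation K μ θ π X) : Measurable (permuted θ π) := by
  have hg : Measurable fun p : (Fin n → T) × Equiv.Perm (Fin n) ↦ p.1 ∘ p.2 :=
    measurable_from_prod_countable_left measurable_comp_perm
  exact hg.comp (h.measurable_param.prodMk h.measurable_perm)

/-- Averaging over the independent permutation and then over the observations. The joint laws of
`(θ, X)` and `(ϑ, X)` follow by letting `F` ignore one of the two parameter vectors. -/
lemma lintegral_eq (h : IsNoisyPermutation K μ θ π X)
    {F : ((Fin n → T) × (Fin n → T)) × (Fin n → α) → ℝ≥0∞} (hF : Measurable F) :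
    ∫⁻ ω, F ((θ ω, permuted θ π ω), X ω) ∂μ =
      ∫⁻ t, (Fintype.card (Equiv.Perm (Fin n)) : ℝ≥0∞)⁻¹ * ∑ σ : Equiv.Perm (Fin n),
        ∫⁻ x, F ((t, t ∘ σ), x) ∂(productKernel K n (t ∘ σ)) ∂(μ.map θ) := by
  have hm1 : Measurable fun ω ↦ (θ ω, permuted θ π ω) :=
    h.measurable_param.prodMk h.measurable_permuted
  have hg : Measurable fun p : (Fin n → T) × Equiv.Perm (Fin n) ↦ (p.1, p.1 ∘ p.2) :=
    measurable_fst.prodMk (measurable_from_prod_countable_left measurable_comp_perm)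
  let G : (Fin n → T) × (Fin n → T) → ℝ≥0∞ := fun p ↦ ∫⁻ x, F (p, x) ∂(productKernel K n p.2)
  have hG : Measurable G := hF.lintegral_kernel_prod_right'
    (κ := Kernel.prodMkLeft (Fin n → T) (productKernel K n))
  have hlaw : μ.map (fun ω ↦ (θ ω, π ω)) =
      (μ.map θ).prod (uniformMixture Measure.dirac) := by
    rw [(indepFun_iff_map_prod_eq_prod_map_map h.measurable_param.aemeasurable
      h.measurable_perm.aemeasurable).mp h.indep, h.hasLaw_perm.map_eq, uniformOn_univ_perm]
  have hGg : Measurable fun p : (Fin n → T) × Equiv.Perm (Fin n) ↦ G (p.1, p.1 ∘ p.2) :=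
    hG.comp hg
  calc ∫⁻ ω, F ((θ ω, permuted θ π ω), X ω) ∂μ
      = ∫⁻ p, F p ∂(μ.map fun ω ↦ ((θ ω, permuted θ π ω), X ω)) :=
        (lintegral_map hF (hm1.prodMk h.measurable_obs)).symm
    _ = ∫⁻ p, G p ∂(μ.map fun ω ↦ (θ ω, permuted θ π ω)) := by
        have := Measure.isProbabilityMeasure_map (μ := μ) hm1.aemeasurable
        rw [h.hasCondDistrib_obs.map_eq, Measure.lintegral_compProd hF]
        rfl
    _ = ∫⁻ p, G (p.1, p.1 ∘ p.2) ∂(μ.map fun ω ↦ (θ ω, π ω)) := by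
        rw [lintegral_map hG hm1, lintegral_map hGg
          (h.measurable_param.prodMk h.measurable_perm)]
        rfl
    _ = _ := by
        rw [hlaw, lintegral_prod _ hGg.aemeasurable]
        refine lintegral_congr fun t ↦ ?_
        rw [lintegral_uniformMixture]
        simp only [lintegral_dirac]
        rfl

lemma map_param_obs (h : IsNoisyPermutation K μ θ π X) :
    μ.map (fun ω ↦ (θ ω, X ω)) = μ.map θ ⊗ₘ permutedKernel K n := by
  have := Measure.isProbabilityMeasure_map (μ := μ) h.measurable_param.aemeasurable
  refine Measure.ext_of_lintegral _ fun f hf ↦ ?_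
  have h1 := h.lintegral_eq (F := fun p ↦ f (p.1.1, p.2))
    (hf.comp ((measurable_fst.comp measurable_fst).prodMk measurable_snd))
  rw [lintegral_map hf (h.measurable_param.prodMk h.measurable_obs), h1,
    Measure.lintegral_compProd hf]
  refine lintegral_congr fun t ↦ ?_
  rw [permutedKernel_apply, lintegral_uniformMixture]
  rfl

lemma map_permuted_obs {θ : Fin n → T} (h : IsNoisyPermutation K μ (fun _ ↦ θ) π X) :
    μ.map (fun ω ↦ (permuted (fun _ ↦ θ) π ω, X ω)) =
      jointLaw (fun σ : Equiv.Perm (Fin n) ↦ θ ∘ σ)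
        fun σ ↦ Measure.pi fun i ↦ K (θ (σ i)) := by
  refine Measure.ext_of_lintegral _ fun f hf ↦ ?_
  have h1 := h.lintegral_eq (F := fun p ↦ f (p.1.2, p.2))
    (hf.comp ((measurable_snd.comp measurable_fst).prodMk measurable_snd))
  have hmeas : ∀ σ : Equiv.Perm (Fin n), Measurable fun t : Fin n → T ↦
      ∫⁻ x, f (t ∘ σ, x) ∂(productKernel K n (t ∘ σ)) := fun σ ↦
    (hf.lintegral_kernel_prod_right' (κ := productKernel K n)).comp (measurable_comp_perm σ)
  rw [lintegral_map hf (h.measurable_permuted.prodMk h.measurable_obs), h1, Measure.map_const,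
    measure_univ, one_smul, lintegral_dirac' _
      ((Finset.measurable_sum _ fun σ _ ↦ hmeas σ).const_mul _), jointLaw,
    lintegral_uniformMixture]
  congr 1
  refine Finset.sum_congr rfl fun σ _ ↦ ?_
  rw [Measure.dirac_prod, lintegral_map hf measurable_prodMk_left]
  rfl

lemma map_permuted_obs_apply {θ : Fin n → T} (h : IsNoisyPermutation K μ (fun _ ↦ θ) π X)
    (i : Fin n) : μ.map (fun ω ↦ (permuted (fun _ ↦ θ) π ω i, X ω i)) =
      jointLaw θ fun j ↦ K (θ j) := by
  have hg : Measurable fun p : (Fin n → T) × (Fin n → α) ↦ (p.1 i, p.2 i) :=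
    ((measurable_pi_apply i).comp measurable_fst).prodMk
      ((measurable_pi_apply i).comp measurable_snd)
  have h1 := Measure.map_map (μ := μ) hg (h.measurable_permuted.prodMk h.measurable_obs)
  rw [h.map_permuted_obs, jointLaw, map_uniformMixture _ hg] at h1
  refine h1.symm.trans ?_
  rw [jointLaw, ← uniformMixture_perm_apply (fun j ↦ (Measure.dirac (θ j)).prod (K (θ j))) i]
  congr 1
  funext σ
  have h2 := Measure.map_prod_map (Measure.dirac (θ ∘ σ)) (Measure.pi fun i ↦ K (θ (σ i)))
    (measurable_pi_apply (X := fun _ ↦ T) i) (measurable_pi_apply (X := fun _ ↦ α) i)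
  refine h2.symm.trans ?_
  rw [Measure.map_dirac' (measurable_pi_apply i)]
  congr 1
  exact (measurePreserving_eval (fun i ↦ K (θ (σ i))) i).map_eq

end IsNoisyPermutation

end ChannelLaws

/-! ### Deterministic parameter vectors -/

section DeterministicParameter

variable {T α Ω : Type*} [MeasurableSpace T] [MeasurableSpace α] [MeasurableSpace Ω]
  {K : Kernel T α} [IsMarkovKernel K] {n : ℕ}

/-- Densities of finitely many members of a kernel extend to a jointly measurable function. -/
lemma exists_measurable_extension (θ : Fin n → T) {ρ : Fin n → α → ℝ}
    (hρ : ∀ j, Measurable (ρ j)) (hρ0 : ∀ j x, 0 ≤ ρ j x)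
    (hcongr : ∀ i j, K (θ i) = K (θ j) → ρ i = ρ j) :
    ∃ r : T × α → ℝ, Measurable r ∧ (∀ p, 0 ≤ r p) ∧ ∀ j x, r (θ j, x) = ρ j x := by
  -- Distinct laws among the `K (θ i)` are separated by finitely many events. The level sets of the
  -- measurable maps `t ↦ K t A` then stand in for the singletons of `T`.
  have hsep : ∀ i k, ∃ A : Set α, MeasurableSet A ∧
      (K (θ k) A = K (θ i) A → K (θ k) = K (θ i)) := fun i k ↦ by
    by_cases hik : K (θ k) = K (θ i)
    · exact ⟨∅, MeasurableSet.empty, fun _ ↦ hik⟩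
    · by_contra! hA
      exact hik (Measure.ext fun A hAm ↦ (hA A hAm).1)
  choose A hAm hA using hsep
  let S : Fin n → Set T := fun i ↦ {t | ∀ k, K t (A i k) = K (θ i) (A i k)}
  have hS : ∀ i, MeasurableSet (S i) := fun i ↦ by
    have : S i = ⋂ k, {t | K t (A i k) = K (θ i) (A i k)} := by ext; simp [S]
    rw [this]
    exact MeasurableSet.iInter fun k ↦
      measurableSet_eq_fun (K.measurable_coe (hAm i k)) measurable_const
  let w : Fin n → T → ℝ := fun i ↦ (S i).indicator fun _ ↦ 1
  have hw : ∀ i, Measurable (w i) := fun i ↦ measurable_const.indicator (hS i)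
  have hw0 : ∀ i t, 0 ≤ w i t := fun i t ↦ Set.indicator_nonneg (fun _ _ ↦ zero_le_one) t
  -- The weight `w i` is nonzero at `θ j` only when `K (θ i) = K (θ j)`; then `ρ i = ρ j`, and the
  -- weighted average returns `ρ j`.
  refine ⟨fun p ↦ (∑ i, w i p.1 * ρ i p.2) / ∑ i, w i p.1, ?_, fun p ↦ ?_, fun j x ↦ ?_⟩
  · exact (Finset.measurable_sum _ fun i _ ↦
      ((hw i).comp measurable_fst).mul ((hρ i).comp measurable_snd)).div
        (Finset.measurable_sum _ fun i _ ↦ (hw i).comp measurable_fst)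
  · exact div_nonneg (Finset.sum_nonneg fun i _ ↦ mul_nonneg (hw0 i _) (hρ0 i _))
      (Finset.sum_nonneg fun i _ ↦ hw0 i _)
  · have h1 : ∀ i, w i (θ j) * ρ i x = w i (θ j) * ρ j x := fun i ↦ by
      by_cases hj : θ j ∈ S i
      · rw [hcongr i j (hA i j (hj j)).symm]
      · simp [w, hj]
    have h2 : 0 < ∑ i, w i (θ j) := by
      refine Finset.sum_pos' (fun i _ ↦ hw0 i _) ⟨j, Finset.mem_univ j, ?_⟩
      have hj : θ j ∈ S j := fun k ↦ rfl
      simp [w, hj]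
    simp only [h1, ← Finset.sum_mul]
    rw [mul_div_cancel_left₀ _ h2.ne']

namespace IsDensityFamily

variable {ν : Measure α} [IsProbabilityMeasure ν] {ρ : Fin n → α → ℝ} (h : IsDensityFamily ν ρ)
include h

lemma integrable_log_memberLaw (j : Fin n) :
    Integrable (fun y ↦ Real.log (ρ j y)) (memberLaw ν ρ j) := by
  rw [memberLaw, integrable_withDensity_iff_integrable_smul'
    (h.measurable j).ennreal_ofReal (by simp)]
  obtain ⟨C, hC⟩ := isCompact_Icc.exists_bound_of_continuousOn
    (s := Set.Icc (0 : ℝ) n) Real.continuous_mul_log.continuousOn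
  refine (integrable_of_abs_le ((h.measurable j).mul (h.measurable j).log) (C := C) fun y ↦
    hC _ ⟨h.nonneg j y, h.le_card j y⟩).congr (Filter.Eventually.of_forall fun y ↦ ?_)
  simp [ENNReal.toReal_ofReal (h.nonneg j y)]

lemma ne_zero_ae_memberLaw (j : Fin n) : ∀ᵐ y ∂(memberLaw ν ρ j), ρ j y ≠ 0 := by
  rw [memberLaw, ae_withDensity_iff (h.measurable j).ennreal_ofReal]
  refine Filter.Eventually.of_forall fun y hy h0 ↦ hy ?_
  rw [h0, ENNReal.ofReal_zero]

lemma ofReal_meanChiSq : ENNReal.ofReal (meanChiSq ν ρ) =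
    (n : ℝ≥0∞)⁻¹ * ∑ j, ∫⁻ x, ENNReal.ofReal ((ρ j x - 1) ^ 2) ∂ν := by
  rcases Nat.eq_zero_or_pos n with rfl | hn
  · simp [meanChiSq]
  · rw [meanChiSq, ENNReal.ofReal_div_of_pos (by exact_mod_cast hn), ENNReal.ofReal_natCast,
      ENNReal.ofReal_sum_of_nonneg fun j _ ↦ integral_nonneg fun x ↦ sq_nonneg _,
      ENNReal.div_eq_inv_mul]
    congr 1
    refine Finset.sum_congr rfl fun j _ ↦ ofReal_integral_eq_lintegral_ofReal ?_
      (Filter.Eventually.of_forall fun x ↦ sq_nonneg _)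
    simpa only [sq] using h.integrable_sub_one_mul j j

/-- Where the mixture density vanishes, each product does too, being at most `n!` times it; the
value of the quotient there is harmless. -/
lemma pi_memberLaw_eq_withDensity_mixLaw (σ : Equiv.Perm (Fin n)) :
    Measure.pi (fun i ↦ memberLaw ν ρ (σ i)) = (mixLaw ν ρ).withDensity fun x ↦
      ENNReal.ofReal ((∏ i, ρ (σ i) (x i)) / mixDensity ρ Finset.univ x) := by
  have hm : Measurable fun x : Fin n → α ↦
      (∏ i, ρ (σ i) (x i)) / mixDensity ρ Finset.univ x :=
    (h.measurable_prod Finset.univ σ).div (h.measurable_mixDensity _)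
  rw [mixLaw, ← withDensity_mul _ (h.measurable_mixDensity _).ennreal_ofReal hm.ennreal_ofReal,
    h.pi_memberLaw]
  congr 1
  funext x
  rw [Pi.mul_apply, ← ENNReal.ofReal_mul (h.mixDensity_nonneg _ x)]
  by_cases h0 : mixDensity ρ Finset.univ x = 0
  · have h1 := h.prod_le_factorial_mul_mixDensity Finset.univ σ x
    rw [h0, mul_zero] at h1
    rw [h0, zero_mul, le_antisymm h1 (h.prod_nonneg _ _ _)]
  · rw [mul_div_cancel₀ _ h0]

/-- The product part of the log-likelihood has a mean that does not depend on `σ`: coordinate `i`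
contributes the term of member `σ i`, and `σ` only permutes these terms. -/
lemma integral_log_prod_div_mixDensity (σ : Equiv.Perm (Fin n)) :
    Integrable (fun x ↦ Real.log ((∏ i, ρ (σ i) (x i)) / mixDensity ρ Finset.univ x))
      (Measure.pi fun i ↦ memberLaw ν ρ (σ i)) ∧
    Integrable (fun x ↦ Real.log (mixDensity ρ Finset.univ x))
      (Measure.pi fun i ↦ memberLaw ν ρ (σ i)) ∧
    ∫ x, Real.log ((∏ i, ρ (σ i) (x i)) / mixDensity ρ Finset.univ x)
      ∂(Measure.pi fun i ↦ memberLaw ν ρ (σ i)) =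
      ∑ j, ∫ y, Real.log (ρ j y) ∂(memberLaw ν ρ j) -
        ∫ x, Real.log (mixDensity ρ Finset.univ x) ∂(Measure.pi fun i ↦ memberLaw ν ρ (σ i)) := by
  have hprob := h.isProbabilityMeasure_memberLaw
  set M := Measure.pi fun i ↦ memberLaw ν ρ (σ i) with hM
  have hmp : ∀ i, MeasurePreserving (Function.eval i) M (memberLaw ν ρ (σ i)) := fun i ↦
    measurePreserving_eval _ i
  have hq : Integrable (fun x ↦ Real.log (mixDensity ρ Finset.univ x)) M := by
    have hle := le_card_smul_uniformMixture
      (fun σ : Equiv.Perm (Fin n) ↦ Measure.pi fun i ↦ memberLaw ν ρ (σ i)) σ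
    rw [h.uniformMixture_pi_memberLaw] at hle
    exact (h.integrable_log_mixDensity.smul_measure (by simp)).mono_measure hle
  have hac : M ≪ mixLaw ν ρ := by
    rw [hM, h.pi_memberLaw_eq_withDensity_mixLaw]
    exact withDensity_absolutelyContinuous _ _
  have hpos : ∀ᵐ x ∂M, ∀ i, ρ (σ i) (x i) ≠ 0 := ae_all_iff.mpr fun i ↦
    (hmp i).quasiMeasurePreserving.ae (h.ne_zero_ae_memberLaw (σ i))
  have hlog : (fun x ↦ Real.log ((∏ i, ρ (σ i) (x i)) / mixDensity ρ Finset.univ x)) =ᵐ[M]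
      fun x ↦ ∑ i, Real.log (ρ (σ i) (x i)) - Real.log (mixDensity ρ Finset.univ x) := by
    filter_upwards [hpos, hac.ae_le h.mixDensity_ne_zero_ae] with x h1 h2
    rw [Real.log_div (Finset.prod_ne_zero_iff.mpr fun i _ ↦ h1 i) h2,
      Real.log_prod fun i _ ↦ h1 i]
  have hi : ∀ i, Integrable (fun x : Fin n → α ↦ Real.log (ρ (σ i) (x i))) M := fun i ↦
    ((hmp i).integrable_comp (h.measurable _).log.aestronglyMeasurable).mpr
      (h.integrable_log_memberLaw (σ i))
  have hi' : Integrable (fun x : Fin n → α ↦ ∑ i, Real.log (ρ (σ i) (x i))) M :=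
    integrable_finsetSum _ fun i _ ↦ hi i
  refine ⟨(hi'.sub hq).congr hlog.symm, hq, ?_⟩
  rw [integral_congr_ae hlog, integral_sub hi' hq, integral_finsetSum _ fun i _ ↦ hi i,
    ← Equiv.sum_comp σ fun j ↦ ∫ y, Real.log (ρ j y) ∂(memberLaw ν ρ j)]
  congr 1
  refine Finset.sum_congr rfl fun i _ ↦ ?_
  have h3 := integral_map (μ := M) (hmp i).measurable.aemeasurable
    (f := fun y ↦ Real.log (ρ (σ i) y)) (h.measurable _).log.aestronglyMeasurable
  rw [(hmp i).map_eq] at h3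
  exact h3.symm

end IsDensityFamily

variable {μ : Measure Ω} [IsProbabilityMeasure μ] {θ : Fin n → T}
  {π : Ω → Equiv.Perm (Fin n)} {X : Ω → Fin n → α}

/-- The mutual informations of the noisy permutation channel with a deterministic parameter
vector. -/
theorem IsNoisyPermutation.mutualInfo_eq [NeZero n]
    (hX : IsNoisyPermutation K μ (fun _ ↦ θ) π X) {ρ : Fin n → α → ℝ} {ν : Measure α}
    (hν : ν = uniformMixture fun j ↦ K (θ j)) (h : IsDensityFamily ν ρ)
    (hlaw : ∀ j, memberLaw ν ρ j = K (θ j)) (hcongr : ∀ i j, K (θ i) = K (θ j) → ρ i = ρ j)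
    (i : Fin n) :
    let ϑ := permuted (fun _ ↦ θ) π
    mutualInfo μ (fun ω ↦ ϑ ω i) (fun ω ↦ X ω i) ≠ ∞ ∧ mutualInfo μ ϑ X ≠ ∞ ∧
      n * (mutualInfo μ (fun ω ↦ ϑ ω i) (fun ω ↦ X ω i)).toReal - (mutualInfo μ ϑ X).toReal =
        mixEntropy ν ρ Finset.univ ∧
      chiSqInfo μ (fun ω ↦ ϑ ω i) (fun ω ↦ X ω i) = ENNReal.ofReal (meanChiSq ν ρ) := by
  intro ϑ
  have hprob : IsProbabilityMeasure ν := by rw [hν]; infer_instance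
  obtain ⟨r, hr, hr0, hrρ⟩ := exists_measurable_extension θ h.measurable h.nonneg hcongr
  have hϑ : Measurable ϑ := hX.measurable_permuted
  have hϑi : Measurable fun ω ↦ ϑ ω i := (measurable_pi_apply i).comp hϑ
  have hXi : Measurable fun ω ↦ X ω i := (measurable_pi_apply i).comp hX.measurable_obs
  have hP : ∀ j, K (θ j) = (uniformMixture fun j ↦ K (θ j)).withDensity
      fun x ↦ ENNReal.ofReal (r (θ j, x)) := fun j ↦ by
    rw [← hν, ← hlaw j]
    simp only [hrρ]
    rfl
  obtain ⟨h1, h2⟩ := mutualInfo_of_jointLaw hϑi hXi (hX.map_permuted_obs_apply i) hr hr0 hP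
    fun j ↦ by
      simp only [hrρ]
      rw [← hlaw j]
      exact h.integrable_log_memberLaw j
  have h3 := chiSqInfo_of_jointLaw hϑi hXi (hX.map_permuted_obs_apply i) hr hr0 hP
  simp only [hrρ] at h2 h3
  have hmix : (uniformMixture fun σ : Equiv.Perm (Fin n) ↦ Measure.pi fun i ↦ K (θ (σ i))) =
      mixLaw ν ρ := by
    rw [← h.uniformMixture_pi_memberLaw]
    simp only [hlaw]
  let R : (Fin n → T) × (Fin n → α) → ℝ := fun p ↦
    (∏ i, r (p.1 i, p.2 i)) / mixDensity ρ Finset.univ p.2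
  have hR : Measurable R :=
    (Finset.measurable_prod _ fun i _ ↦ hr.comp
      (((measurable_pi_apply i).comp measurable_fst).prodMk
        ((measurable_pi_apply i).comp measurable_snd))).div
      ((h.measurable_mixDensity _).comp measurable_snd)
  have hR0 : ∀ p, 0 ≤ R p := fun p ↦
    div_nonneg (Finset.prod_nonneg fun i _ ↦ hr0 _) (h.mixDensity_nonneg _ _)
  have hRσ : ∀ (σ : Equiv.Perm (Fin n)) x, R (θ ∘ σ, x) =
      (∏ i, ρ (σ i) (x i)) / mixDensity ρ Finset.univ x := fun σ x ↦ by
    simp only [R, Function.comp_apply, hrρ]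
  have hlog := fun σ ↦ h.integral_log_prod_div_mixDensity σ
  simp only [hlaw] at hlog
  obtain ⟨h4, h5⟩ := mutualInfo_of_jointLaw hϑ hX.measurable_obs hX.map_permuted_obs hR hR0
    (fun σ ↦ by
      rw [hmix]
      simp only [hRσ]
      rw [← h.pi_memberLaw_eq_withDensity_mixLaw]
      simp only [hlaw])
    fun σ ↦ by simpa only [hRσ] using (hlog σ).1
  simp only [hRσ] at h5
  refine ⟨h1, h4, ?_, ?_⟩
  -- Averaging over `σ`, the terms with `log (ρ j)` cancel against `n I(ϑ₁;X₁)`, and what remains is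
  -- the integral of `log q` under the mixture.
  · have hn : (n : ℝ) ≠ 0 := Nat.cast_ne_zero.mpr (NeZero.ne n)
    have hf : (n.factorial : ℝ) ≠ 0 := Nat.cast_ne_zero.mpr n.factorial_ne_zero
    have h6 := integral_uniformMixture
      (fun σ : Equiv.Perm (Fin n) ↦ Measure.pi fun i ↦ K (θ (σ i)))
      (f := fun x ↦ Real.log (mixDensity ρ Finset.univ x)) fun σ ↦ (hlog σ).2.1
    rw [hmix, h.integral_log_mixDensity] at h6
    rw [h2, h5, h6, Finset.sum_congr rfl fun σ _ ↦ (hlog σ).2.2, Finset.sum_sub_distrib,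
      Finset.sum_const, Finset.card_univ, Fintype.card_perm, Fintype.card_fin, nsmul_eq_mul]
    field_simp
    ring
  · rw [h3, ← hν, h.ofReal_meanChiSq, Fintype.card_fin]

/-- The comparison of the mutual informations for a deterministic parameter vector. -/
theorem IsNoisyPermutation.mutualInfo_bounds [NeZero n]
    (hX : IsNoisyPermutation K μ (fun _ ↦ θ) π X) {𝓜 : Set (Measure α)}
    (hθ : ∀ i, K (θ i) ∈ 𝓜) (i : Fin n) {ϑ : Ω → Fin n → T}
    (hϑ : ϑ = permuted (fun _ ↦ θ) π) {I₁ I Iχ : ℝ≥0∞}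
    (hI₁ : I₁ = mutualInfo μ (fun ω ↦ ϑ ω i) (fun ω ↦ X ω i)) (hI : I = mutualInfo μ ϑ X)
    (hIχ : Iχ = chiSqInfo μ (fun ω ↦ ϑ ω i) (fun ω ↦ X ω i)) :
    I₁ ≠ ∞ ∧ I ≠ ∞ ∧ Iχ ≠ ∞ ∧
      0 ≤ (n : EReal) * (I₁ : EReal) - (I : EReal) ∧
      (n : EReal) * (I₁ : EReal) - (I : EReal) ≤
        min ((10 * ∑ l ∈ Finset.Icc 2 n, Iχ ^ l : ℝ≥0∞) : EReal)
          ((Iχ : EReal) * (1 + ENNReal.log (hellingerSingularity 𝓜))) := by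
  subst hϑ
  obtain ⟨ρ, h, hlaw, hcongr⟩ := exists_isDensityFamily fun j ↦ K (θ j)
  obtain ⟨h1, h2, h3, h4⟩ := hX.mutualInfo_eq rfl h hlaw hcongr i
  rw [← hI₁] at h1 h3
  rw [← hI] at h2 h3
  rw [← hIχ] at h4
  set ν := uniformMixture fun j ↦ K (θ j) with hν
  have hx := meanChiSq_nonneg (ν := ν) (ρ := ρ)
  have e : (n : EReal) * (I₁ : EReal) - (I : EReal) = (mixEntropy ν ρ Finset.univ : EReal) := by
    rw [← h3, ← EReal.coe_ennreal_toReal h1, ← EReal.coe_ennreal_toReal h2]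
    norm_cast
  refine ⟨h1, h2, h4 ▸ ENNReal.ofReal_ne_top, ?_, ?_⟩
  · rw [e]
    exact_mod_cast h.mixEntropy_nonneg
  · rw [e, le_min_iff]
    constructor
    · have e1 : (10 * ∑ l ∈ Finset.Icc 2 n, Iχ ^ l : ℝ≥0∞) =
          ENNReal.ofReal (10 * ∑ l ∈ Finset.Icc 2 n, meanChiSq ν ρ ^ l) := by
        rw [ENNReal.ofReal_mul (by norm_num),
          ENNReal.ofReal_sum_of_nonneg fun l _ ↦ pow_nonneg hx l, h4]
        simp [ENNReal.ofReal_pow hx]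
      have hs : 0 ≤ ∑ l ∈ Finset.Icc 2 n, meanChiSq ν ρ ^ l :=
        Finset.sum_nonneg fun l _ ↦ pow_nonneg hx l
      rw [e1, EReal.coe_ennreal_ofReal, max_eq_left (by positivity), EReal.coe_le_coe_iff]
      linarith [h.mixEntropy_le_sum_pow]
    · rw [h4, EReal.coe_ennreal_ofReal, max_eq_left hx]
      exact h.mixEntropy_le_mul_log_hellingerSingularity fun j ↦ by rw [hlaw]; exact hθ j

end DeterministicParameter

/-! ### Lower bound for the `χ²` capacity -/

section Capacity

variable {α : Type*} [MeasurableSpace α] {n : ℕ}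

lemma ofReal_integral_le_lintegral {m : Measure α} {f : α → ℝ} (hf : Integrable f m) :
    ENNReal.ofReal (∫ x, f x ∂m) ≤ ∫⁻ x, ENNReal.ofReal (f x) ∂m := by
  refine ENNReal.ofReal_le_of_le_toReal ?_
  rw [integral_eq_lintegral_pos_part_sub_lintegral_neg_part hf]
  exact sub_le_self _ ENNReal.toReal_nonneg

/-- The variational lower bound for the `χ²` divergence. -/
lemma ofReal_sub_le_chiSqDiv {P Q : Measure α} [IsProbabilityMeasure P] [IsProbabilityMeasure Q]
    {f : α → ℝ} {C : ℝ} (hf : Measurable f) (hC : ∀ x, |f x| ≤ C) :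
    ENNReal.ofReal (2 * (∫ x, f x ∂P - ∫ x, f x ∂Q) - ∫ x, f x ^ 2 ∂Q) ≤ chiSqDiv P Q := by
  rw [chiSqDiv]
  split_ifs with hac
  swap
  · exact le_top
  set g : α → ℝ := fun x ↦ (P.rnDeriv Q x).toReal with hg
  have hgi : Integrable g Q := Measure.integrable_toReal_rnDeriv
  have hfg : Integrable (fun x ↦ g x * f x) Q :=
    hgi.mul_bdd hf.aestronglyMeasurable (c := C) (Filter.Eventually.of_forall hC)
  have hfi : Integrable f Q := integrable_of_abs_le hf hC
  have hf2 : Integrable (fun x ↦ f x ^ 2) Q :=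
    integrable_of_abs_le (hf.pow_const 2) (C := C ^ 2) fun x ↦ by
      rw [abs_pow]; exact pow_le_pow_left₀ (abs_nonneg _) (hC x) 2
  have e : ∫ x, f x ∂P = ∫ x, g x * f x ∂Q := (integral_rnDeriv_smul hac).symm
  have h1 : Integrable (fun x ↦ g x * f x - f x) Q := hfg.sub hfi
  have h2 : Integrable (fun x ↦ 2 * (g x * f x - f x)) Q := h1.const_mul 2
  have h3 : Integrable (fun x ↦ 2 * (g x * f x - f x) - f x ^ 2) Q := h2.sub hf2
  rw [e, ← integral_sub hfg hfi, ← integral_const_mul, ← integral_sub h2 hf2]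
  refine (ofReal_integral_le_lintegral h3).trans (lintegral_mono fun x ↦
    ENNReal.ofReal_le_ofReal ?_)
  -- Pointwise `2 (g - 1) f - f² ≤ (g - 1)²`, with equality at `f = g - 1`.
  nlinarith [sq_nonneg (g x - 1 - f x)]

lemma join_uniformMixture_dirac [NeZero n] (P : Fin n → Measure α) :
    Measure.join (uniformMixture fun j ↦ Measure.dirac (P j)) = uniformMixture P := by
  ext A hA
  rw [Measure.join_apply hA, lintegral_uniformMixture, uniformMixture_apply]
  simp_rw [lintegral_dirac' _ (Measure.measurable_coe hA)]

/-- The uniform prior on finitely many members of the family bounds the capacity from below. -/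
lemma IsDensityFamily.ofReal_meanChiSq_le_chiSqCapacity [NeZero n] {ν : Measure α}
    [IsProbabilityMeasure ν] {ρ : Fin n → α → ℝ} (h : IsDensityFamily ν ρ)
    {𝓜 : Set (Measure α)} (h𝓜 : ∀ P ∈ 𝓜, IsProbabilityMeasure P)
    (hρ : ∀ j, memberLaw ν ρ j ∈ 𝓜) : ENNReal.ofReal (meanChiSq ν ρ) ≤ chiSqCapacity 𝓜 := by
  have hprob := h.isProbabilityMeasure_memberLaw
  let p : Fin n → 𝓜 := fun j ↦ ⟨memberLaw ν ρ j, hρ j⟩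
  let prior : Measure 𝓜 := uniformMixture fun j ↦ Measure.dirac (p j)
  have hmean : priorMean prior = ν := by
    rw [priorMean, map_uniformMixture _ measurable_subtype_coe]
    simp_rw [Measure.map_dirac' measurable_subtype_coe]
    rw [join_uniformMixture_dirac, h.uniformMixture_memberLaw]
  refine le_iSup₂_of_le prior (isProbabilityMeasure_uniformMixture _) ?_
  rw [hmean, lintegral_uniformMixture, h.ofReal_meanChiSq, Fintype.card_fin]
  refine mul_le_mul_right (Finset.sum_le_sum fun j _ ↦ ?_) _
  -- The integral against a Dirac mass is evaluated through a measurable function of the measure,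
  -- without measurability of `P ↦ chiSqDiv P ν`. The variational bound with test function `ρ j - 1`
  -- gives such a minorant, attained at the member `j`.
  let φ : Measure α → ℝ≥0∞ := fun M ↦ ENNReal.ofReal
    (2 * ((∫⁻ x, ENNReal.ofReal (ρ j x) ∂M).toReal - 1) - ∫ x, (ρ j x - 1) ^ 2 ∂ν)
  have hφ : Measurable φ := (((Measure.measurable_lintegral
    (h.measurable j).ennreal_ofReal).ennreal_toReal.sub_const 1).const_mul 2).sub_const _
      |>.ennreal_ofReal
  have hφeq : ∀ M : Measure α, IsProbabilityMeasure M → φ M = ENNReal.ofReal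
      (2 * (∫ x, (ρ j x - 1) ∂M - ∫ x, (ρ j x - 1) ∂ν) - ∫ x, (ρ j x - 1) ^ 2 ∂ν) := fun M _ ↦ by
    have hi : ∀ M : Measure α, IsProbabilityMeasure M → Integrable (ρ j) M := fun M _ ↦
      integrable_of_abs_le (h.measurable j) (C := n) fun x ↦ by
        rw [abs_of_nonneg (h.nonneg j x)]; exact h.le_card j x
    have h0 : ∫ x, (ρ j x - 1) ∂ν = 0 := by
      rw [integral_sub (h.integrable j) (integrable_const 1), h.integral_eq_one]
      simp
    rw [h0, integral_sub (hi M inferInstance) (integrable_const 1),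
      integral_eq_lintegral_of_nonneg_ae (Filter.Eventually.of_forall (h.nonneg j))
        (h.measurable j).aestronglyMeasurable]
    simp [φ]
  have hle : ∀ M : 𝓜, φ M.1 ≤ chiSqDiv M.1 ν := fun M ↦ by
    have := h𝓜 M.1 M.2
    rw [hφeq M.1 this]
    exact ofReal_sub_le_chiSqDiv ((h.measurable j).sub_const 1) (h.abs_sub_one_le j)
  have hj : φ (memberLaw ν ρ j) = ∫⁻ x, ENNReal.ofReal ((ρ j x - 1) ^ 2) ∂ν := by
    have hsq : Integrable (fun x ↦ (ρ j x - 1) ^ 2) ν := by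
      simpa only [sq] using h.integrable_sub_one_mul j j
    have h1 : Integrable (fun x ↦ ρ j x - 1) ν := (h.integrable j).sub (integrable_const 1)
    have e : ∫ x, (ρ j x - 1) ∂(memberLaw ν ρ j) =
        ∫ x, (ρ j x - 1) ∂ν + ∫ x, (ρ j x - 1) ^ 2 ∂ν := by
      rw [memberLaw, integral_withDensity_eq_integral_toReal_smul
        (h.measurable j).ennreal_ofReal (by simp), ← integral_add h1 hsq]
      refine integral_congr_ae (Filter.Eventually.of_forall fun x ↦ ?_)
      simp only [smul_eq_mul, ENNReal.toReal_ofReal (h.nonneg j x)]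
      ring
    rw [hφeq _ (hprob j), ← ofReal_integral_eq_lintegral_ofReal hsq
      (Filter.Eventually.of_forall fun x ↦ sq_nonneg _), e]
    congr 1
    ring
  calc ∫⁻ x, ENNReal.ofReal ((ρ j x - 1) ^ 2) ∂ν
      = ∫⁻ M, φ M.1 ∂(Measure.dirac (p j)) := by
        have hφ' : Measurable fun M : 𝓜 ↦ φ M.1 := hφ.comp measurable_subtype_coe
        rw [lintegral_dirac' _ hφ', ← hj]
    _ ≤ _ := lintegral_mono hle

end Capacity

/-! ### Convex hulls and covering numbers -/

section Covering

variable {α : Type*} [MeasurableSpace α] {n : ℕ} {𝓜 : Set (Measure α)}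

lemma isProbabilityMeasure_of_mem_mixtures (h𝓜 : ∀ P ∈ 𝓜, IsProbabilityMeasure P)
    {P : Measure α} (hP : P ∈ mixtures 𝓜) : IsProbabilityMeasure P := by
  refine convexHull_min (t := {P : Measure α | IsProbabilityMeasure P}) h𝓜 ?_ hP
  intro P hP Q hQ a b _ _ hab
  have hP' : P Set.univ = 1 := hP.measure_univ
  have hQ' : Q Set.univ = 1 := hQ.measure_univ
  refine ⟨?_⟩
  change (a : ℝ≥0∞) * P Set.univ + (b : ℝ≥0∞) * Q Set.univ = 1
  rw [hP', hQ', mul_one, mul_one, ← ENNReal.coe_add, hab, ENNReal.coe_one]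

lemma inv_card_smul_sum_mem {E ι : Type*} [AddCommMonoid E] [Module ℝ≥0 E] {C : Set E}
    (hC : Convex ℝ≥0 C) {f : ι → E} {s : Finset ι} (hs : s.Nonempty) (hf : ∀ i ∈ s, f i ∈ C) :
    (s.card : ℝ≥0)⁻¹ • ∑ i ∈ s, f i ∈ C := by
  induction hs using Finset.Nonempty.cons_induction with
  | singleton a => simpa using hf
  | cons a s ha hs ih =>
    have hs0 : (s.card : ℝ≥0) ≠ 0 := Nat.cast_ne_zero.mpr hs.card_pos.ne'
    have h1 := ih fun i hi ↦ hf i (Finset.mem_cons_of_mem hi)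
    have h2 := hC (hf a (Finset.mem_cons_self a s)) h1
      (a := ((s.card : ℝ≥0) + 1)⁻¹) (b := ((s.card : ℝ≥0) + 1)⁻¹ * s.card) zero_le zero_le (by
        field_simp
        rw [add_comm])
    rw [smul_smul, mul_assoc, mul_inv_cancel₀ hs0, mul_one, ← smul_add] at h2
    rw [Finset.sum_cons, Finset.card_cons]
    push_cast
    exact h2

lemma uniformMixture_mem_mixtures [NeZero n] {P : Fin n → Measure α} (hP : ∀ j, P j ∈ 𝓜) :
    uniformMixture P ∈ mixtures 𝓜 := by
  have h := inv_card_smul_sum_mem (convex_convexHull ℝ≥0 𝓜) (f := P)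
    (Finset.univ_nonempty (α := Fin n)) fun j _ ↦ subset_convexHull ℝ≥0 𝓜 (hP j)
  have e : uniformMixture P = ((Finset.univ : Finset (Fin n)).card : ℝ≥0)⁻¹ • ∑ j, P j := by
    ext A _
    change _ = ((((Finset.univ : Finset (Fin n)).card : ℝ≥0)⁻¹ : ℝ≥0) : ℝ≥0∞) * (∑ j, P j) A
    rw [uniformMixture_apply, Measure.finsetSum_apply, ENNReal.coe_inv (by simp [NeZero.ne n])]
    simp
  rw [e]
  exact h

/-- The infimum over nets of a given size need not be attained, so a net is extracted at the price
of an arbitrarily small `η`. -/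
lemma exists_finset_klDiv_le {𝓠 : Set (Measure α)} {ε η : ℝ} (hη : 0 < η)
    (hN : klCoveringNumber 𝓠 ε ≠ ⊤) : ∃ 𝓠₀ : Finset (Measure α), (𝓠₀ : Set (Measure α)) ⊆ 𝓠 ∧
      (𝓠₀.card : ℕ∞) ≤ klCoveringNumber 𝓠 ε ∧
      ∀ P ∈ 𝓠, ∃ P₀ ∈ 𝓠₀, klDiv P P₀ ≤ ENNReal.ofReal (ε ^ 2 + η) := by
  have h1 : klCoveringNumber 𝓠 ε < klCoveringNumber 𝓠 ε + 1 :=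
    ENat.lt_add_one_iff hN |>.mpr le_rfl
  conv_lhs at h1 => rw [klCoveringNumber]
  simp only [iInf_lt_iff] at h1
  obtain ⟨m, hm, hlt⟩ := h1
  have hlt' : ENNReal.ofReal (ε ^ 2) < ENNReal.ofReal (ε ^ 2 + η) :=
    (ENNReal.ofReal_lt_ofReal_iff (by positivity)).mpr (by linarith)
  have h2 := hm.trans_lt hlt'
  simp only [iInf_lt_iff] at h2
  obtain ⟨𝓠₀, hsub, hcard, h3⟩ := h2
  refine ⟨𝓠₀, hsub, hcard ▸ (ENat.lt_add_one_iff hN).mp hlt, fun P hP ↦ ?_⟩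
  have h4 := (le_iSup₂ (f := fun P (_ : P ∈ 𝓠) ↦ ⨅ P₀ ∈ 𝓠₀, klDiv P P₀) P hP).trans_lt h3
  simp only [iInf_lt_iff] at h4
  obtain ⟨P₀, hP₀, h5⟩ := h4
  exact ⟨P₀, hP₀, h5.le⟩

/-- Ensures that the logarithm of the covering number is nonnegative. -/
lemma one_le_klCoveringNumber {𝓠 : Set (Measure α)} (h𝓠 : 𝓠.Nonempty) (ε : ℝ) :
    1 ≤ klCoveringNumber 𝓠 ε := by
  by_contra hlt
  have hN : klCoveringNumber 𝓠 ε ≠ ⊤ := fun h ↦ hlt (h ▸ le_top)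
  obtain ⟨𝓠₀, -, hcard, hcov⟩ := exists_finset_klDiv_le one_pos hN
  obtain ⟨P, hP⟩ := h𝓠
  obtain ⟨P₀, hP₀, -⟩ := hcov P hP
  refine hlt (le_trans ?_ hcard)
  exact_mod_cast Finset.card_pos.mpr ⟨P₀, hP₀⟩

end Covering

/-! ### Random parameter vectors -/

section RandomParameter

variable {T α Ω : Type*} [MeasurableSpace T] [MeasurableSpace α] [MeasurableSpace Ω]
  {K : Kernel T α} [IsMarkovKernel K] {n : ℕ} [NeZero n] {𝓜 : Set (Measure α)}

/-- The divergence of the law of the observations from a product measure. -/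
lemma klDiv_permutedKernel_le (h𝓜 : ∀ P ∈ 𝓜, IsProbabilityMeasure P) {t : Fin n → T}
    (ht : ∀ i, K (t i) ∈ 𝓜) {c : ℝ}
    (hc : (chiSqCapacity 𝓜 : EReal) * (1 + ENNReal.log (hellingerSingularity 𝓜)) ≤ c)
    (Q : Measure α) [IsProbabilityMeasure Q] {b : ℝ} (hb : 0 ≤ b)
    (hQ : klDiv (uniformMixture fun j ↦ K (t j)) Q ≤ ENNReal.ofReal b) :
    klDiv (permutedKernel K n t) (Measure.pi fun _ ↦ Q) ≠ ∞ ∧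
      (klDiv (permutedKernel K n t) (Measure.pi fun _ ↦ Q)).toReal ≤ c + n * b := by
  obtain ⟨ρ, h, hlaw, -⟩ := exists_isDensityFamily fun j ↦ K (t j)
  set ν := uniformMixture fun j ↦ K (t j) with hν
  have hmem : ∀ j, memberLaw ν ρ j ∈ 𝓜 := fun j ↦ by rw [hlaw]; exact ht j
  have e : permutedKernel K n t = mixLaw ν ρ := by
    rw [permutedKernel_apply, ← h.uniformMixture_pi_memberLaw]
    simp only [hlaw]
  obtain ⟨h1, h2⟩ := h.klDiv_mixLaw_le Q (ne_top_of_le_ne_top ENNReal.ofReal_ne_top hQ)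
  rw [e, h2]
  refine ⟨h1, add_le_add ?_ (mul_le_mul_of_nonneg_left
    (ENNReal.toReal_le_of_le_ofReal hb hQ) (Nat.cast_nonneg n))⟩
  have h3 : (meanChiSq ν ρ : EReal) ≤ (chiSqCapacity 𝓜 : EReal) := by
    have := EReal.coe_ennreal_le_coe_ennreal_iff.mpr
      (h.ofReal_meanChiSq_le_chiSqCapacity h𝓜 hmem)
    rwa [EReal.coe_ennreal_ofReal, max_eq_left meanChiSq_nonneg] at this
  have h4 := (h.mixEntropy_le_mul_log_hellingerSingularity hmem).trans
    ((mul_le_mul_of_nonneg_right h3 zero_le_one_add_log_hellingerSingularity).trans hc)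
  exact_mod_cast h4

variable {μ : Measure Ω} [IsProbabilityMeasure μ] {θ : Ω → Fin n → T}
  {π : Ω → Equiv.Perm (Fin n)} {X : Ω → Fin n → α}

/-- The reference law is the uniform mixture of the `Q^n` over the net. Given `θ`, the centre close
to the average of the `K (θ j)` carries weight `1 / 𝓠₀.card`, which costs its logarithm, and the
divergence from `Q^n` tensorizes up to the entropy `c`. -/
lemma IsNoisyPermutation.mutualInfo_le_of_cover (h𝓜 : ∀ P ∈ 𝓜, IsProbabilityMeasure P)
    (hθ : ∀ᵐ ω ∂μ, ∀ i, K (θ ω i) ∈ 𝓜) (hX : IsNoisyPermutation K μ θ π X) {c : ℝ} (hc0 : 0 ≤ c)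
    (hc : (chiSqCapacity 𝓜 : EReal) * (1 + ENNReal.log (hellingerSingularity 𝓜)) ≤ c)
    {𝓠₀ : Finset (Measure α)} (h𝓠₀ : 𝓠₀.Nonempty) (hsub : (𝓠₀ : Set (Measure α)) ⊆ mixtures 𝓜)
    {b : ℝ} (hb : 0 ≤ b)
    (hcov : ∀ P ∈ mixtures 𝓜, ∃ P₀ ∈ 𝓠₀, klDiv P P₀ ≤ ENNReal.ofReal b) :
    mutualInfo μ θ X ≤ ENNReal.ofReal (Real.log 𝓠₀.card + (c + n * b)) := by
  have hne : Nonempty 𝓠₀ := h𝓠₀.to_subtype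
  have hprob : ∀ Q : 𝓠₀, IsProbabilityMeasure Q.1 := fun Q ↦
    isProbabilityMeasure_of_mem_mixtures h𝓜 (hsub Q.2)
  let ξ : Measure (Fin n → α) := uniformMixture fun Q : 𝓠₀ ↦ Measure.pi fun _ ↦ Q.1
  have hξ : IsProbabilityMeasure ξ := isProbabilityMeasure_uniformMixture _
  have hlog : 0 ≤ Real.log 𝓠₀.card := Real.log_natCast_nonneg _
  have hsnd : μ.map X = (μ.map θ ⊗ₘ permutedKernel K n).snd := by
    rw [← hX.map_param_obs, Measure.snd_map_prodMk hX.measurable_param]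
  rw [mutualInfo, hsnd, hX.map_param_obs]
  refine klDiv_compProd_prod_le hX.measurable_param _ ξ ?_ (by positivity)
  filter_upwards [hθ] with ω hω
  obtain ⟨Q, hQ, hQb⟩ := hcov _ (uniformMixture_mem_mixtures hω)
  have hQprob : IsProbabilityMeasure Q := hprob ⟨Q, hQ⟩
  obtain ⟨h1, h2⟩ := klDiv_permutedKernel_le h𝓜 hω hc Q hb hQb
  have hle : (Measure.pi fun _ : Fin n ↦ Q) ≤ (𝓠₀.card : ℝ≥0∞) • ξ := by
    have := le_card_smul_uniformMixture (fun Q : 𝓠₀ ↦ Measure.pi fun _ : Fin n ↦ Q.1) ⟨Q, hQ⟩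
    rwa [Fintype.card_coe] at this
  exact (klDiv_le_add_log h𝓠₀.card_pos hle h1).trans (ENNReal.ofReal_le_ofReal (by linarith))

/-- The mutual information of a random parameter vector and the observations. -/
theorem IsNoisyPermutation.mutualInfo_le (h𝓜 : ∀ P ∈ 𝓜, IsProbabilityMeasure P)
    (hθ : ∀ᵐ ω ∂μ, ∀ i, K (θ ω i) ∈ 𝓜) (hX : IsNoisyPermutation K μ θ π X) :
    (mutualInfo μ θ X : EReal) ≤
      (⨅ (ε : ℝ) (_ : 0 < ε), (((n : ℝ) * ε ^ 2 : ℝ) : EReal) +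
        ENNReal.log (klCoveringNumber (mixtures 𝓜) ε : ℝ≥0∞)) +
      (chiSqCapacity 𝓜 : EReal) * (1 + ENNReal.log (hellingerSingularity 𝓜)) := by
  have hne : (mixtures 𝓜).Nonempty := by
    obtain ⟨ω, hω⟩ := hθ.exists
    exact ⟨_, subset_convexHull ℝ≥0 𝓜 (hω 0)⟩
  have hlog : ∀ ε, 0 ≤ ENNReal.log (klCoveringNumber (mixtures 𝓜) ε : ℝ≥0∞) := fun ε ↦ by
    rw [ENNReal.zero_le_log_iff]
    exact_mod_cast one_le_klCoveringNumber hne ε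
  set c := (chiSqCapacity 𝓜 : EReal) * (1 + ENNReal.log (hellingerSingularity 𝓜)) with hc
  have hc0 : 0 ≤ c := mul_nonneg (by positivity) zero_le_one_add_log_hellingerSingularity
  have hinf : 0 ≤ ⨅ (ε : ℝ) (_ : 0 < ε), (((n : ℝ) * ε ^ 2 : ℝ) : EReal) +
      ENNReal.log (klCoveringNumber (mixtures 𝓜) ε : ℝ≥0∞) :=
    le_iInf₂ fun ε _ ↦ add_nonneg (by exact_mod_cast (by positivity : 0 ≤ (n : ℝ) * ε ^ 2)) (hlog ε)
  clear_value c
  induction c with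
  | bot => simp at hc0
  | top =>
    rw [EReal.add_top_of_ne_bot (ne_bot_of_le_ne_bot (by decide) hinf)]
    exact le_top
  | coe c =>
    have hc0' : 0 ≤ c := by exact_mod_cast hc0
    -- Moving the finite `c` to the other side reduces the bound by an infimum to one bound for each
    -- `ε`.
    refine EReal.sub_le_iff_le_add (by simp) (by simp) |>.mp (le_iInf₂ fun ε hε ↦ ?_)
    refine EReal.sub_le_iff_le_add (by simp) (by simp) |>.mpr ?_
    by_cases hN : klCoveringNumber (mixtures 𝓜) ε = ⊤
    · rw [hN, ENat.toENNReal_top, ENNReal.log_top, EReal.add_top_of_ne_bot (EReal.coe_ne_bot _),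
        EReal.top_add_of_ne_bot (EReal.coe_ne_bot _)]
      exact le_top
    obtain ⟨N, hN'⟩ := ENat.ne_top_iff_exists.mp hN
    have hN1 : 1 ≤ N := by
      have := one_le_klCoveringNumber hne ε
      rw [← hN'] at this
      exact_mod_cast this
    have hNpos : (0 : ℝ) < N := by exact_mod_cast hN1
    have key : ∀ η : ℝ, 0 < η → mutualInfo μ θ X ≤
        ENNReal.ofReal (n * ε ^ 2 + Real.log N + c + n * η) := fun η hη ↦ by
      obtain ⟨𝓠₀, hsub, hcard, hcov⟩ := exists_finset_klDiv_le hη hN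
      have h𝓠₀ : 𝓠₀.Nonempty := by
        obtain ⟨P, hP⟩ := hne
        obtain ⟨P₀, hP₀, -⟩ := hcov P hP
        exact ⟨P₀, hP₀⟩
      rw [← hN', Nat.cast_le] at hcard
      refine (hX.mutualInfo_le_of_cover h𝓜 hθ hc0' hc.ge h𝓠₀ hsub (by positivity) hcov).trans
        (ENNReal.ofReal_le_ofReal ?_)
      have : Real.log 𝓠₀.card ≤ Real.log N := Real.log_le_log
        (by exact_mod_cast h𝓠₀.card_pos) (by exact_mod_cast hcard)
      linarith
    have hn : (0 : ℝ) < n := by exact_mod_cast NeZero.pos n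
    have hlogN : 0 ≤ Real.log N := Real.log_natCast_nonneg N
    have hfin : mutualInfo μ θ X ≠ ∞ := ne_top_of_le_ne_top ENNReal.ofReal_ne_top (key 1 one_pos)
    have hle : (mutualInfo μ θ X).toReal ≤ n * ε ^ 2 + Real.log N + c := by
      -- The slack `η = δ / n` of the net contributes exactly `δ`, which tends to zero.
      refine le_of_forall_pos_le_add fun δ hδ ↦ ?_
      have h1 := ENNReal.toReal_le_of_le_ofReal (by positivity) (key (δ / n) (by positivity))
      rwa [mul_div_cancel₀ _ hn.ne'] at h1
    have e : ENNReal.log (klCoveringNumber (mixtures 𝓜) ε : ℝ≥0∞) = (Real.log N : EReal) := by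
      rw [← hN', ENat.toENNReal_coe, ← ENNReal.ofReal_natCast, ENNReal.log_ofReal_of_pos hNpos]
    rw [e, ← EReal.coe_ennreal_toReal hfin]
    exact_mod_cast hle

end RandomParameter

end PermMix

end

theorem mainTheorem8 {T α Ω : Type*} [MeasurableSpace T] [MeasurableSpace α] [MeasurableSpace Ω]
    (K : Kernel T α) [IsMarkovKernel K]
    (𝓜 : Set (Measure α)) (h𝓜 : ∀ P ∈ 𝓜, IsProbabilityMeasure P)
    (μ : Measure Ω) [IsProbabilityMeasure μ]
    (n : ℕ) [NeZero n] (π : Ω → Equiv.Perm (Fin n)) (X : Ω → Fin n → α) :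
    (∀ θ : Fin n → T, (∀ i, K (θ i) ∈ 𝓜) →
      PermMix.IsNoisyPermutation K μ (fun _ ↦ θ) π X →
      ∀ ϑ : Ω → Fin n → T, ϑ = PermMix.permuted (fun _ ↦ θ) π →
      ∀ I₁ I Iχ : ℝ≥0∞,
        I₁ = PermMix.mutualInfo μ (fun ω ↦ ϑ ω 0) (fun ω ↦ X ω 0) →
        I = PermMix.mutualInfo μ ϑ X →
        Iχ = PermMix.chiSqInfo μ (fun ω ↦ ϑ ω 0) (fun ω ↦ X ω 0) →
        I₁ ≠ ∞ ∧ I ≠ ∞ ∧ Iχ ≠ ∞ ∧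
        0 ≤ (n : EReal) * (I₁ : EReal) - (I : EReal) ∧
        (n : EReal) * (I₁ : EReal) - (I : EReal) ≤
          min ((10 * ∑ l ∈ Finset.Icc 2 n, Iχ ^ l : ℝ≥0∞) : EReal)
            ((Iχ : EReal) * (1 + ENNReal.log (PermMix.hellingerSingularity 𝓜)))) ∧
    (∀ θ : Ω → Fin n → T, (∀ᵐ ω ∂μ, ∀ i, K (θ ω i) ∈ 𝓜) →
      PermMix.IsNoisyPermutation K μ θ π X →
      (PermMix.mutualInfo μ θ X : EReal) ≤
        (⨅ (ε : ℝ) (_ : 0 < ε), (((n : ℝ) * ε ^ 2 : ℝ) : EReal) +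
          ENNReal.log (PermMix.klCoveringNumber (PermMix.mixtures 𝓜) ε : ℝ≥0∞)) +
        (PermMix.chiSqCapacity 𝓜 : EReal) *
          (1 + ENNReal.log (PermMix.hellingerSingularity 𝓜))) :=
  ⟨fun _ hθ hX _ hϑ _ _ _ hI₁ hI hIχ ↦ hX.mutualInfo_bounds hθ 0 hϑ hI₁ hI hIχ,
    fun _ hθ hX ↦ hX.mutualInfo_le h𝓜 hθ⟩
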